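/- A \emph{B-diagram} is a tuple $G=(n,\lambda,E^\uparrow,E^\downarrow,E)$ where $n\in\mathbb N$, $\lambda=[\lambda_1,\dots,\lambda_n]$ is a list of positive integers, $E^\uparrow$ (outer half-edges that are not cut) and $E^\downarrow$ (inner half-edges that are not cut) are subsets of $\{1,\dots,\lambda_1+\cdots+\lambda_n\}$, and $E\subset E^\uparrow\times E^\downarrow$ is a set of pairs $(a,b)$ with $v(a)<v(b)$ in which every $a$ and every $b$ occurs at most once. Here the half-edges $\lambda_1+\cdots+\lambda_{i-1}+p$, $1\le p\le\lambda_i$, belong to the vertex $i\in\{1,\dots,n\}$, and $v(k)$ is the vertex of the half-edge $k$. Let $H_f^\uparrow(G)$ and $H_f^\downarrow(G)$ be the sets of elements of $E^\uparrow$ and of $E^\downarrow$ that occur in no pair of $E$. Let $\mathcal B$ be the complex vector space with basis the B-diagrams. The product $G\star G'$ is the sum, over all $k\ge 0$, all $a_1<\cdots<a_k$ in $H_f^\uparrow(G)$ and all distinct $b_1,\dots,b_k$ in $H_f^\downarrow(G')$, of the diagram obtained by placing the vertices of $G'$ after those of $G$ and adding the edges from $a_\ell$ to $b_\ell$ (with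 $b_\ell$ renumbered accordingly). The unit is the empty diagram $\varepsilon$. A set $I$ of vertices of $G$ is \emph{isolated} if no edge joins a vertex in $I$ to a vertex outside $I$; $G[I]$ is the diagram obtained by keeping only the vertices in $I$ with their half-edges and the edges between them, renumbered increasingly. The coproduct is $\Delta(G)=\sum_{I\text{ isolated}}G[I]\otimes G[\complement I]$, and the counit is the coefficient of $\varepsilon$. Let $\mathcal G^2_1$ be the set of the B-diagrams of the form $(n,[2,\dots,2],\{1,\dots,2n\},\{1,3,\dots,2n-1\},E)$, and $\mathcal B^2_1\subset\mathcal B$ its linear span. A \emph{set partition into lists} $\Pi\vDash n$ is a set of non-empty lists of integers such that each element of $\{1,\dots,n\}$, and no other integer, occurs exactly once in exactly one list. For $\Pi\vDash n$, $\Pi\uplus\Pi'$ is the union of $\Pi$ and of $\Pi'$ with all its integers increased by $n$; $\Pi$ is \emph{indivisible} if $\Pi=\Pi'\uplus\Pi''$ implies $\Pi'=\Pi$ or $\Pi''=\Pi$. $\mathrm{BWSym}$ is the complex vector space with basis $\{\Phi^\Pi\}$, with product $\Phi^\Pi\Phi^{\Pi'}=\Phi^{\Pi\uplus\Pi'}$,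 unit $\Phi^\emptyset$, coproduct $\Delta(\Phi^\Pi)=\sum_{E\sqcup F=\Pi}\Phi^{\mathrm{std}(E)}\otimes\Phi^{\mathrm{std}(F)}$, where $\mathrm{std}$ relabels increasingly the integers that occur by $1,2,\dots$, and counit the coefficient of $\Phi^\emptyset$. For a permutation $\sigma$ of $\{1,\dots,n\}$, viewed as the word $\sigma(1)\cdots\sigma(n)$, let $m_\sigma\in\mathcal G^2_1$ be the diagram with $n$ vertices whose edges are \begin{itemize} \item $(2i-1,2j-1)$ whenever $i<j$ and $j=\min\{k:\alpha_i<\sigma^{-1}(k)<\sigma^{-1}(i)\}$, with $\alpha_i=\sup\{\sigma^{-1}(k):k<i,\ \sigma^{-1}(k)<\sigma^{-1}(i)\}$, and \item $(2i,2j-1)$ whenever $i<j$ and $j=\min\{k:\sigma^{-1}(i)<\sigma^{-1}(k)<\beta_i\}$, with $\beta_i=\inf\{\sigma^{-1}(k):k<i,\ \sigma^{-1}(k)>\sigma^{-1}(i)\}$, \end{itemize} where $\sup\emptyset=-\infty$ and $\inf\emptyset=+\infty$. For $\Pi\vDash n$, let $m_\Pi\in\mathcal G^2_1$ be the diagram with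 $n$ vertices obtained as the union, over the lists $L$ of $\Pi$, of the diagrams $m_{\mathrm{std}(L)}$ with vertices renamed increasingly by the integers in $L$. \textbf{Theorem.} $\mathcal B$ and $\mathrm{BWSym}$ are Hopf algebras, $\mathcal B^2_1$ is a sub-Hopf algebra of $\mathcal B$, and the Hopf algebras $\mathrm{BWSym}$ and $\mathcal B^2_1$ are isomorphic. More precisely: \begin{enumerate} \item For each $n\ge 0$, $\sigma\mapsto m_\sigma$ is a bijection from the permutations of $\{1,\dots,n\}$ onto the connected diagrams in $\mathcal G^2_1$ with $n$ vertices, and $\Pi\mapsto m_\Pi$ is a bijection from the set partitions into lists onto $\mathcal G^2_1$. \item The linear map $\Phi^\Pi\mapsto m_\Pi$ (all $\Pi$) is an isomorphism of coalgebras from $\mathrm{BWSym}$ to $\mathcal B^2_1$. \item There is an isomorphism of algebras from $\mathrm{BWSym}$ to $\mathcal B^2_1$ that sends $\Phi^\Pi$ to $m_\Pi$ for each indivisible $\Pi$. \item There is an isomorphism of Hopf algebras $\eta:\mathrm{BWSym}\to\mathcal B^2_1$ such that, for all $n\ge 0$ and all $\Pi\vDash n$, $\eta(\Phi^\Pi)-m_\Pi$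 is a linear combination of diagrams $m_{\Pi'}$ with $\Pi'\vDash n$ and with fewer lists in $\Pi'$ than in $\Pi$; in particular $\eta(\Phi^\Pi)=m_\Pi$ if $\Pi$ has exactly one list. \end{enumerate} -/

import Mathlib

open scoped TensorProduct
open Finset

noncomputable section

/-! ### Hopf algebras given by their structure maps -/

/-- A multiplication, a unit, a comultiplication and a counit on a complex vector space;
the axioms are stated separately, in `HopfOps.IsHopf`. -/
structure HopfOps (V : Type) [AddCommGroup V] [Module ℂ V] where
  mul : V →ₗ[ℂ] V →ₗ[ℂ] V
  one : V
  comul : V →ₗ[ℂ] V ⊗[ℂ] V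
  counit : V →ₗ[ℂ] ℂ

namespace HopfOps

section
variable {V : Type} [AddCommGroup V] [Module ℂ V]

/-- `S` is an antipode: `μ ∘ (S ⊗ id) ∘ Δ = μ ∘ (id ⊗ S) ∘ Δ = counit · 1`. -/
def IsAntipode (D : HopfOps V) (S : V →ₗ[ℂ] V) : Prop :=
  (∀ x, TensorProduct.lift D.mul (S.rTensor V (D.comul x)) = D.counit x • D.one) ∧
  (∀ x, TensorProduct.lift D.mul (S.lTensor V (D.comul x)) = D.counit x • D.one)

/-- The axioms of a Hopf algebra. -/
structure IsHopf (D : HopfOps V) : Prop where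
  mul_assoc : ∀ x y z, D.mul (D.mul x y) z = D.mul x (D.mul y z)
  one_mul : ∀ x, D.mul D.one x = x
  mul_one : ∀ x, D.mul x D.one = x
  coassoc : TensorProduct.assoc ℂ V V V ∘ₗ D.comul.rTensor V ∘ₗ D.comul =
    D.comul.lTensor V ∘ₗ D.comul
  rTensor_counit : D.counit.rTensor V ∘ₗ D.comul = TensorProduct.mk ℂ ℂ V 1
  lTensor_counit : D.counit.lTensor V ∘ₗ D.comul = (TensorProduct.mk ℂ V ℂ).flip 1
  counit_one : D.counit D.one = 1
  counit_mul : ∀ x y, D.counit (D.mul x y) = D.counit x * D.counit y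
  comul_one : D.comul D.one = D.one ⊗ₜ[ℂ] D.one
  comul_mul : ∀ x y,
    D.comul (D.mul x y) = TensorProduct.map₂ D.mul D.mul (D.comul x) (D.comul y)
  exists_antipode : ∃ S, D.IsAntipode S

/-- The space `V`, seen as a Hopf algebra in the sense of Mathlib. -/
def IsHopf.Carrier {D : HopfOps V} (_h : D.IsHopf) : Type := V

instance {D : HopfOps V} (h : D.IsHopf) : AddCommGroup h.Carrier :=
  inferInstanceAs (AddCommGroup V)

instance {D : HopfOps V} (h : D.IsHopf) : Module ℂ h.Carrier :=
  inferInstanceAs (Module ℂ V)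

/-- The identity, from `V` to the Hopf algebra with underlying space `V`. -/
def IsHopf.of {D : HopfOps V} (h : D.IsHopf) : V ≃ₗ[ℂ] h.Carrier := LinearEquiv.refl ℂ V

instance {D : HopfOps V} (h : D.IsHopf) : Ring h.Carrier where
  __ := (inferInstance : AddCommGroup h.Carrier)
  mul := fun x y => D.mul x y
  one := D.one
  mul_assoc := h.mul_assoc
  one_mul := h.one_mul
  mul_one := h.mul_one
  left_distrib := fun x y z => (D.mul x).map_add y z
  right_distrib := fun x y z => LinearMap.map_add₂ D.mul x y z
  zero_mul := fun x => LinearMap.map_zero₂ D.mul x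
  mul_zero := fun x => (D.mul x).map_zero

instance {D : HopfOps V} (h : D.IsHopf) : Algebra ℂ h.Carrier :=
  Algebra.ofModule (fun c x y => LinearMap.map_smul₂ D.mul c x y)
    (fun c x y => (D.mul x).map_smul c y)

instance {D : HopfOps V} (h : D.IsHopf) : Coalgebra ℂ h.Carrier where
  comul := D.comul
  counit := D.counit
  coassoc := h.coassoc
  rTensor_counit_comp_comul := h.rTensor_counit
  lTensor_counit_comp_comul := h.lTensor_counit

theorem tmul_mul_eq_map₂ {A : Type} [Ring A] [Algebra ℂ A] (s t : A ⊗[ℂ] A) :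
    s * t = TensorProduct.map₂ (LinearMap.mul ℂ A) (LinearMap.mul ℂ A) s t := by
  induction s using TensorProduct.induction_on with
  | zero => simp
  | add a b ha hb => simp [add_mul, ha, hb]
  | tmul a b =>
    induction t using TensorProduct.induction_on with
    | zero => simp
    | add c d hc hd => simp only [mul_add, map_add, hc, hd]
    | tmul c d => simp [TensorProduct.map₂]

instance {D : HopfOps V} (h : D.IsHopf) : Bialgebra ℂ h.Carrier :=
  Bialgebra.mk' ℂ h.Carrier h.counit_one (fun {a b} => h.counit_mul a b) h.comul_one
    (fun {a b} => (h.comul_mul a b).trans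
      (tmul_mul_eq_map₂ (A := h.Carrier) (D.comul a) (D.comul b)).symm)

instance {D : HopfOps V} (h : D.IsHopf) : HopfAlgebra ℂ h.Carrier where
  antipode := h.exists_antipode.choose
  mul_antipode_rTensor_comul := by
    ext x
    exact (h.exists_antipode.choose_spec.1 x).trans
      (Algebra.algebraMap_eq_smul_one (A := h.Carrier) (D.counit x)).symm
  mul_antipode_lTensor_comul := by
    ext x
    exact (h.exists_antipode.choose_spec.2 x).trans
      (Algebra.algebraMap_eq_smul_one (A := h.Carrier) (D.counit x)).symm

/-- `W` is a sub-Hopf algebra: it contains the unit, and it is stable under the product,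
under the coproduct, that is `Δ(W) ⊆ W ⊗ W`, and under the antipode. -/
structure IsSubHopf (D : HopfOps V) (W : Submodule ℂ V) : Prop where
  one_mem : D.one ∈ W
  mul_mem : ∀ x ∈ W, ∀ y ∈ W, D.mul x y ∈ W
  comul_mem : ∀ x ∈ W, D.comul x ∈ LinearMap.range (TensorProduct.map W.subtype W.subtype)
  antipode_mem : ∃ S, D.IsAntipode S ∧ ∀ x ∈ W, S x ∈ W

theorem map_subtype_injective (W : Submodule ℂ V) :
    Function.Injective (TensorProduct.map W.subtype W.subtype) :=
  TensorProduct.map_injective_of_flat_flat W.subtype W.subtype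
    W.injective_subtype W.injective_subtype

/-- The structure maps of `D` restricted to the sub-Hopf algebra `W`; the tensor square of `W`
is identified with its image in the tensor square of `V`. -/
def restrict (D : HopfOps V) (W : Submodule ℂ V) (h : D.IsSubHopf W) : HopfOps W where
  mul := LinearMap.mk₂ ℂ (fun x y => ⟨D.mul x y, h.mul_mem x x.2 y y.2⟩)
    (fun x y z => Subtype.ext (by simp)) (fun c x y => Subtype.ext (by simp))
    (fun x y z => Subtype.ext (by simp)) (fun c x y => Subtype.ext (by simp))
  one := ⟨D.one, h.one_mem⟩
  comul := (LinearEquiv.ofInjective _ (map_subtype_injective W)).symm.toLinearMap ∘ₗ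
    (D.comul ∘ₗ W.subtype).codRestrict _ (fun x => h.comul_mem x x.2)
  counit := D.counit ∘ₗ W.subtype

end

end HopfOps

/-! ### Relabelling a finite set of integers increasingly -/

/-- The rank of `x` in `U`, counted from `1`: on `U` this is the increasing bijection from `U`
onto `{1, …, #U}`. -/
def rank (U : Finset ℕ) (x : ℕ) : ℕ := #{y ∈ U | y ≤ x}

theorem rank_lt {U : Finset ℕ} {x y : ℕ} (hy : y ∈ U) (h : x < y) : rank U x < rank U y := by
  apply card_lt_card
  rw [ssubset_iff_of_subset]
  · exact ⟨y, by simp [hy], by simp [h]⟩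
  · intro z hz
    simp only [mem_filter] at hz ⊢
    exact ⟨hz.1, hz.2.trans h.le⟩

theorem rank_injOn (U : Finset ℕ) : Set.InjOn (rank U) U := by
  intro x hx y hy h
  rcases lt_trichotomy x y with hxy | hxy | hxy
  · exact absurd h (rank_lt hy hxy).ne
  · exact hxy
  · exact absurd h (rank_lt hx hxy).ne'

theorem rank_mem {U : Finset ℕ} {x : ℕ} (hx : x ∈ U) : rank U x ∈ Icc 1 #U := by
  rw [mem_Icc]
  exact ⟨card_pos.2 ⟨x, by simp [hx]⟩, card_le_card (filter_subset _ _)⟩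

theorem image_rank (U : Finset ℕ) : U.image (rank U) = Icc 1 #U := by
  apply eq_of_subset_of_card_le
  · intro z hz
    obtain ⟨x, hx, rfl⟩ := mem_image.1 hz
    exact rank_mem hx
  · rw [card_image_of_injOn (rank_injOn U)]
    simp

/-! ### B-diagrams -/

/-- A B-diagram `(n, λ, E↑, E↓, E)`. Its vertices are `1, …, n`. The list `λ₁, …, λₙ` of positive
integers is a function on `ℕ` that vanishes off `{1, …, n}`. A half-edge is written as a pair
`(i, p)` with `1 ≤ i ≤ n` and `1 ≤ p ≤ λᵢ`: this is the half-edge `λ₁ + ⋯ + λᵢ₋₁ + p` in the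
numbering by `1, …, λ₁ + ⋯ + λₙ`, which is the lexicographic order, and its vertex is its first
component. The sets `up` and `down` hold the outer and the inner half-edges that are not cut. -/
@[ext]
structure BDiagram where
  n : ℕ
  lam : ℕ → ℕ
  up : Finset (ℕ × ℕ)
  down : Finset (ℕ × ℕ)
  edges : Finset ((ℕ × ℕ) × (ℕ × ℕ))
  lam_pos_iff : ∀ i, 0 < lam i ↔ i ∈ Icc 1 n
  up_valid : ∀ h ∈ up, h.2 ∈ Icc 1 (lam h.1)
  down_valid : ∀ h ∈ down, h.2 ∈ Icc 1 (lam h.1)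
  edges_valid : ∀ e ∈ edges, e.1 ∈ up ∧ e.2 ∈ down ∧ e.1.1 < e.2.1
  out_unique : ∀ e ∈ edges, ∀ f ∈ edges, e.1 = f.1 → e = f
  in_unique : ∀ e ∈ edges, ∀ f ∈ edges, e.2 = f.2 → e = f

namespace BDiagram

/-- The empty diagram `ε`. -/
def empty : BDiagram where
  n := 0
  lam := fun _ => 0
  up := ∅
  down := ∅
  edges := ∅
  lam_pos_iff := by simp
  up_valid := by simp
  down_valid := by simp
  edges_valid := by simp
  out_unique := by simp
  in_unique := by simp

theorem up_vertex (G : BDiagram) {h : ℕ × ℕ} (hh : h ∈ G.up) : h.1 ∈ Icc 1 G.n := by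
  have := mem_Icc.1 (G.up_valid h hh)
  exact (G.lam_pos_iff _).1 (by omega)

theorem down_vertex (G : BDiagram) {h : ℕ × ℕ} (hh : h ∈ G.down) : h.1 ∈ Icc 1 G.n := by
  have := mem_Icc.1 (G.down_valid h hh)
  exact (G.lam_pos_iff _).1 (by omega)

/-- The outer half-edges that are neither cut nor used by an edge. -/
def freeUp (G : BDiagram) : Finset (ℕ × ℕ) := G.up \ G.edges.image Prod.fst

/-- The inner half-edges that are neither cut nor used by an edge. -/
def freeDown (G : BDiagram) : Finset (ℕ × ℕ) := G.down \ G.edges.image Prod.snd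

open Classical in
/-- The choices of free outer half-edges `a₁ < ⋯ < aₖ` of `G` and of distinct free inner
half-edges `b₁, …, bₖ` of `G'`, with `k ≥ 0`, each given as the set of the pairs `(aₗ, bₗ)`. -/
def matchings (G G' : BDiagram) : Finset (Finset ((ℕ × ℕ) × (ℕ × ℕ))) :=
  {M ∈ (G.freeUp ×ˢ G'.freeDown).powerset |
    Set.InjOn Prod.fst (M : Set ((ℕ × ℕ) × (ℕ × ℕ))) ∧
    Set.InjOn Prod.snd (M : Set ((ℕ × ℕ) × (ℕ × ℕ)))}

theorem mem_matchings_free {G G' : BDiagram} {M : Finset ((ℕ × ℕ) × (ℕ × ℕ))}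
    (hM : M ∈ matchings G G') {e} (he : e ∈ M) : e.1 ∈ G.freeUp ∧ e.2 ∈ G'.freeDown :=
  mem_product.1 (mem_powerset.1 (mem_filter.1 hM).1 he)

/-- The half-edge `h` after its vertex has been moved up by `k`. -/
def shift (k : ℕ) (h : ℕ × ℕ) : ℕ × ℕ := (h.1 + k, h.2)

theorem shift_injective (k : ℕ) : Function.Injective (shift k) := by
  intro x y h
  simp only [shift, Prod.mk.injEq, Nat.add_right_cancel_iff] at h
  exact Prod.ext h.1 h.2

/-- The composition of `G` (below) and `G'` (above) along the pairs of `M`: the vertices of `G'`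
are numbered after those of `G`, and `aₗ` is joined to `bₗ` for each `(aₗ, bₗ) ∈ M`. -/
def comp (G G' : BDiagram) (M : Finset ((ℕ × ℕ) × (ℕ × ℕ))) (hM : M ∈ matchings G G') :
    BDiagram where
  n := G.n + G'.n
  lam := fun i => if i ≤ G.n then G.lam i else G'.lam (i - G.n)
  up := G.up ∪ G'.up.image (shift G.n)
  down := G.down ∪ G'.down.image (shift G.n)
  edges := G.edges ∪ M.image (Prod.map id (shift G.n)) ∪
    G'.edges.image (Prod.map (shift G.n) (shift G.n))
  lam_pos_iff := by
    intro i
    have h1 := G.lam_pos_iff i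
    have h2 := G'.lam_pos_iff (i - G.n)
    rw [mem_Icc] at *
    split_ifs <;> omega
  up_valid := by
    intro h hh
    rcases mem_union.1 hh with hh | hh
    · have := mem_Icc.1 (G.up_vertex hh)
      simpa [this.2] using G.up_valid h hh
    · obtain ⟨k, hk, rfl⟩ := mem_image.1 hh
      have := mem_Icc.1 (G'.up_vertex hk)
      have h3 : ¬ k.1 + G.n ≤ G.n := by omega
      simpa [shift, h3] using G'.up_valid k hk
  down_valid := by
    intro h hh
    rcases mem_union.1 hh with hh | hh
    · have := mem_Icc.1 (G.down_vertex hh)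
      simpa [this.2] using G.down_valid h hh
    · obtain ⟨k, hk, rfl⟩ := mem_image.1 hh
      have := mem_Icc.1 (G'.down_vertex hk)
      have h3 : ¬ k.1 + G.n ≤ G.n := by omega
      simpa [shift, h3] using G'.down_valid k hk
  edges_valid := by
    intro e he
    rcases mem_union.1 he with he | he
    · rcases mem_union.1 he with he | he
      · obtain ⟨h1, h2, h3⟩ := G.edges_valid e he
        exact ⟨mem_union_left _ h1, mem_union_left _ h2, h3⟩
      · obtain ⟨k, hk, rfl⟩ := mem_image.1 he
        obtain ⟨h1, h2⟩ := mem_matchings_free hM hk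
        have h1 := (mem_sdiff.1 h1).1
        have h2 := (mem_sdiff.1 h2).1
        refine ⟨mem_union_left _ h1, mem_union_right _ (mem_image_of_mem _ h2), ?_⟩
        have := mem_Icc.1 (G.up_vertex h1)
        have := mem_Icc.1 (G'.down_vertex h2)
        simp only [Prod.map, id, shift]
        omega
    · obtain ⟨k, hk, rfl⟩ := mem_image.1 he
      obtain ⟨h1, h2, h3⟩ := G'.edges_valid k hk
      exact ⟨mem_union_right _ (mem_image_of_mem _ h1),
        mem_union_right _ (mem_image_of_mem _ h2), Nat.add_lt_add_right h3 _⟩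
  out_unique := by
    have hG : ∀ e ∈ G.edges, e.1.1 ≤ G.n := fun e he =>
      (mem_Icc.1 (G.up_vertex (G.edges_valid e he).1)).2
    have hM1 : ∀ e ∈ M, e.1.1 ≤ G.n := fun e he =>
      (mem_Icc.1 (G.up_vertex (mem_sdiff.1 (mem_matchings_free hM he).1).1)).2
    have hG' : ∀ e ∈ G'.edges, 1 ≤ e.1.1 := fun e he =>
      (mem_Icc.1 (G'.up_vertex (G'.edges_valid e he).1)).1
    have hdis : ∀ e ∈ G.edges, ∀ f ∈ M, e.1 ≠ f.1 := fun e he f hf h =>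
      (mem_sdiff.1 (mem_matchings_free hM hf).1).2 (h ▸ mem_image_of_mem _ he)
    have hinj := (mem_filter.1 hM).2.1
    intro e he f hf h
    simp only [mem_union, mem_image] at he hf
    rcases he with (he | ⟨e, he, rfl⟩) | ⟨e, he, rfl⟩ <;>
      rcases hf with (hf | ⟨f, hf, rfl⟩) | ⟨f, hf, rfl⟩
    · exact G.out_unique e he f hf h
    · exact absurd h (hdis e he f hf)
    · have := hG e he
      have := hG' f hf
      have := congrArg Prod.fst h
      simp only [Prod.map, shift] at this
      omega
    · exact absurd h.symm (hdis f hf e he)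
    · rw [hinj he hf h]
    · have := hM1 e he
      have := hG' f hf
      have := congrArg Prod.fst h
      simp only [Prod.map, shift, id] at this
      omega
    · have := hG f hf
      have := hG' e he
      have := congrArg Prod.fst h
      simp only [Prod.map, shift] at this
      omega
    · have := hM1 f hf
      have := hG' e he
      have := congrArg Prod.fst h
      simp only [Prod.map, shift, id] at this
      omega
    · rw [G'.out_unique e he f hf (shift_injective _ h)]
  in_unique := by
    have hG : ∀ e ∈ G.edges, e.2.1 ≤ G.n := fun e he =>
      (mem_Icc.1 (G.down_vertex (G.edges_valid e he).2.1)).2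
    have hM1 : ∀ e ∈ M, 1 ≤ e.2.1 := fun e he =>
      (mem_Icc.1 (G'.down_vertex (mem_sdiff.1 (mem_matchings_free hM he).2).1)).1
    have hG' : ∀ e ∈ G'.edges, 1 ≤ e.2.1 := fun e he =>
      (mem_Icc.1 (G'.down_vertex (G'.edges_valid e he).2.1)).1
    have hdis : ∀ e ∈ G'.edges, ∀ f ∈ M, e.2 ≠ f.2 := fun e he f hf h =>
      (mem_sdiff.1 (mem_matchings_free hM hf).2).2 (h ▸ mem_image_of_mem _ he)
    have hinj := (mem_filter.1 hM).2.2
    intro e he f hf h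
    simp only [mem_union, mem_image] at he hf
    rcases he with (he | ⟨e, he, rfl⟩) | ⟨e, he, rfl⟩ <;>
      rcases hf with (hf | ⟨f, hf, rfl⟩) | ⟨f, hf, rfl⟩
    · exact G.in_unique e he f hf h
    · have := hG e he
      have := hM1 f hf
      have := congrArg Prod.fst h
      simp only [Prod.map, shift] at this
      omega
    · have := hG e he
      have := hG' f hf
      have := congrArg Prod.fst h
      simp only [Prod.map, shift] at this
      omega
    · have := hG f hf
      have := hM1 e he
      have := congrArg Prod.fst h
      simp only [Prod.map, shift] at this
      omega
    · rw [hinj he hf (shift_injective _ h)]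
    · exact absurd (shift_injective _ h).symm (hdis f hf e he)
    · have := hG f hf
      have := hG' e he
      have := congrArg Prod.fst h
      simp only [Prod.map, shift] at this
      omega
    · exact absurd (shift_injective _ h) (hdis e he f hf)
    · rw [G'.in_unique e he f hf (shift_injective _ h)]

theorem sub_lam {I : Finset ℕ} {f : ℕ → ℕ} {j : ℕ} (hj : j ∈ I) :
    ∑ k ∈ I with rank I k = rank I j, f k = f j := by
  have : {k ∈ I | rank I k = rank I j} = {j} := by
    ext k
    simp only [mem_filter, mem_singleton]
    constructor
    · exact fun h => rank_injOn I h.1 hj h.2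
    · rintro rfl
      exact ⟨hj, rfl⟩
  rw [this, sum_singleton]

/-- The sub-diagram `G[I]` on a set `I` of vertices of `G`: keep the vertices in `I`, their
half-edges and the edges between them, and renumber the vertices increasingly. The sum in `lam`
has the single term `λⱼ`, where `j` is the vertex of rank `i`. -/
def sub (G : BDiagram) (I : Finset ℕ) (hI : I ⊆ Icc 1 G.n) : BDiagram where
  n := #I
  lam := fun i => ∑ j ∈ I with rank I j = i, G.lam j
  up := {h ∈ G.up | h.1 ∈ I}.image (Prod.map (rank I) id)
  down := {h ∈ G.down | h.1 ∈ I}.image (Prod.map (rank I) id)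
  edges := {e ∈ G.edges | e.1.1 ∈ I ∧ e.2.1 ∈ I}.image
    (Prod.map (Prod.map (rank I) id) (Prod.map (rank I) id))
  lam_pos_iff := by
    intro i
    rw [← image_rank, mem_image]
    constructor
    · intro h
      obtain ⟨j, hj⟩ : {j ∈ I | rank I j = i}.Nonempty := by
        by_contra hne
        rw [not_nonempty_iff_eq_empty.1 hne] at h
        simp at h
      exact ⟨j, (mem_filter.1 hj).1, (mem_filter.1 hj).2⟩
    · rintro ⟨j, hj, rfl⟩
      rw [sub_lam hj]
      exact (G.lam_pos_iff j).2 (hI hj)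
  up_valid := by
    intro h hh
    obtain ⟨k, hk, rfl⟩ := mem_image.1 hh
    rw [mem_filter] at hk
    simpa only [Prod.map, id, sub_lam hk.2] using G.up_valid k hk.1
  down_valid := by
    intro h hh
    obtain ⟨k, hk, rfl⟩ := mem_image.1 hh
    rw [mem_filter] at hk
    simpa only [Prod.map, id, sub_lam hk.2] using G.down_valid k hk.1
  edges_valid := by
    intro e he
    obtain ⟨k, hk, rfl⟩ := mem_image.1 he
    rw [mem_filter] at hk
    obtain ⟨h1, h2, h3⟩ := G.edges_valid k hk.1
    exact ⟨mem_image_of_mem _ (mem_filter.2 ⟨h1, hk.2.1⟩),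
      mem_image_of_mem _ (mem_filter.2 ⟨h2, hk.2.2⟩), rank_lt hk.2.2 h3⟩
  out_unique := by
    intro e he f hf h
    obtain ⟨e, hk, rfl⟩ := mem_image.1 he
    obtain ⟨f, hl, rfl⟩ := mem_image.1 hf
    rw [mem_filter] at hk hl
    simp only [Prod.map, id, Prod.mk.injEq] at h
    rw [G.out_unique e hk.1 f hl.1 (Prod.ext (rank_injOn I hk.2.1 hl.2.1 h.1) h.2)]
  in_unique := by
    intro e he f hf h
    obtain ⟨e, hk, rfl⟩ := mem_image.1 he
    obtain ⟨f, hl, rfl⟩ := mem_image.1 hf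
    rw [mem_filter] at hk hl
    simp only [Prod.map, id, Prod.mk.injEq] at h
    rw [G.in_unique e hk.1 f hl.1 (Prod.ext (rank_injOn I hk.2.2 hl.2.2 h.1) h.2)]

/-- The isolated sets of vertices: no edge leaves `I`. -/
def iso (G : BDiagram) : Finset (Finset ℕ) :=
  {I ∈ (Icc 1 G.n).powerset | ∀ e ∈ G.edges, e.1.1 ∈ I ↔ e.2.1 ∈ I}

theorem iso_subset {G : BDiagram} {I : Finset ℕ} (hI : I ∈ G.iso) : I ⊆ Icc 1 G.n :=
  mem_powerset.1 (mem_filter.1 hI).1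

/-- Two vertices are adjacent if an edge joins them. -/
def Adj (G : BDiagram) (i j : ℕ) : Prop :=
  ∃ e ∈ G.edges, (e.1.1 = i ∧ e.2.1 = j) ∨ (e.1.1 = j ∧ e.2.1 = i)

/-- Any two vertices are linked by a sequence of edges. -/
def Connected (G : BDiagram) : Prop :=
  ∀ i ∈ Icc 1 G.n, ∀ j ∈ Icc 1 G.n, Relation.ReflTransGen G.Adj i j

end BDiagram

/-! ### The Hopf algebra of B-diagrams -/

/-- The complex vector space with basis the B-diagrams. -/
abbrev BSpace : Type := BDiagram →₀ ℂ

/-- The structure maps of the algebra of B-diagrams: `G ⋆ G'` is the sum of all compositions of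
`G` and `G'`, the unit is the empty diagram, `Δ(G) = ∑ G[I] ⊗ G[∁I]` over the isolated sets `I`,
and the counit is the coefficient of the empty diagram. -/
def hopfB : HopfOps BSpace where
  mul := Finsupp.linearCombination ℂ fun G : BDiagram =>
    Finsupp.linearCombination ℂ fun G' : BDiagram =>
      ∑ M ∈ (G.matchings G').attach, (Finsupp.single (G.comp G' M.1 M.2) 1 : BSpace)
  one := Finsupp.single BDiagram.empty 1
  comul := Finsupp.linearCombination ℂ fun G : BDiagram =>
    ∑ I ∈ G.iso.attach,
      (Finsupp.single (G.sub I.1 (BDiagram.iso_subset I.2)) 1 : BSpace) ⊗ₜ[ℂ]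
        (Finsupp.single (G.sub (Icc 1 G.n \ I.1) sdiff_subset) 1 : BSpace)
  counit := Finsupp.lapply BDiagram.empty

/-- The diagrams `(n, [2, …, 2], {1, …, 2n}, {1, 3, …, 2n - 1}, E)`. As `λᵢ = 2`, the half-edges
`2i - 1` and `2i` are `(i, 1)` and `(i, 2)`. -/
def G21 : Set BDiagram :=
  {G | (∀ i ∈ Icc 1 G.n, G.lam i = 2) ∧ G.up = Icc 1 G.n ×ˢ {1, 2} ∧ G.down = Icc 1 G.n ×ˢ {1}}

/-- The space spanned by the diagrams in `G21`. -/
def B21 : Submodule ℂ BSpace := Submodule.span ℂ ((fun G => Finsupp.single G 1) '' G21)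

/-! ### Set partitions into lists -/

/-- A set partition into lists of `{1, …, n}`: a set of non-empty lists such that every integer
of `{1, …, n}`, and no other one, occurs in exactly one list, and there exactly once. -/
@[ext]
structure ListPartition where
  n : ℕ
  lists : Finset (List ℕ)
  ne_nil : ∀ L ∈ lists, L ≠ []
  nodup : ∀ L ∈ lists, L.Nodup
  disjoint : ∀ L ∈ lists, ∀ L' ∈ lists, ∀ x, x ∈ L → x ∈ L' → L = L'
  mem_iff : ∀ x, (∃ L ∈ lists, x ∈ L) ↔ x ∈ Icc 1 n

namespace ListPartition

/-- The empty partition, of the empty set. -/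
def empty : ListPartition where
  n := 0
  lists := ∅
  ne_nil := by simp
  nodup := by simp
  disjoint := by simp
  mem_iff := by simp

/-- The shifted union `Π ⊎ Π'`: all integers in `Π'` are increased by `n`. -/
def shiftedUnion (P Q : ListPartition) : ListPartition where
  n := P.n + Q.n
  lists := P.lists ∪ Q.lists.image (List.map (· + P.n))
  ne_nil := by
    intro L hL
    rcases mem_union.1 hL with hL | hL
    · exact P.ne_nil L hL
    · obtain ⟨K, hK, rfl⟩ := mem_image.1 hL
      simpa using Q.ne_nil K hK
  nodup := by
    intro L hL
    rcases mem_union.1 hL with hL | hL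
    · exact P.nodup L hL
    · obtain ⟨K, hK, rfl⟩ := mem_image.1 hL
      exact (Q.nodup K hK).map (add_left_injective P.n)
  disjoint := by
    have hP : ∀ L ∈ P.lists, ∀ x ∈ L, x ≤ P.n := fun L hL x hx =>
      (mem_Icc.1 ((P.mem_iff x).1 ⟨L, hL, hx⟩)).2
    have hQ : ∀ L ∈ Q.lists, ∀ x ∈ L, 1 ≤ x := fun L hL x hx =>
      (mem_Icc.1 ((Q.mem_iff x).1 ⟨L, hL, hx⟩)).1
    intro L hL L' hL' x hx hx'
    simp only [mem_union, mem_image] at hL hL'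
    rcases hL with hL | ⟨L, hL, rfl⟩ <;> rcases hL' with hL' | ⟨L', hL', rfl⟩
    · exact P.disjoint L hL L' hL' x hx hx'
    · obtain ⟨y, hy, rfl⟩ := List.mem_map.1 hx'
      have := hP L hL _ hx
      have := hQ L' hL' y hy
      omega
    · obtain ⟨y, hy, rfl⟩ := List.mem_map.1 hx
      have := hP L' hL' _ hx'
      have := hQ L hL y hy
      omega
    · obtain ⟨y, hy, rfl⟩ := List.mem_map.1 hx
      obtain ⟨z, hz, hyz⟩ := List.mem_map.1 hx'
      obtain rfl : z = y := add_left_injective P.n hyz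
      rw [Q.disjoint L hL L' hL' z hy hz]
  mem_iff := by
    intro x
    have h1 := P.mem_iff x
    have h2 := Q.mem_iff (x - P.n)
    rw [mem_Icc] at *
    constructor
    · rintro ⟨L, hL, hx⟩
      rcases mem_union.1 hL with hL | hL
      · have := h1.1 ⟨L, hL, hx⟩
        omega
      · obtain ⟨K, hK, rfl⟩ := mem_image.1 hL
        obtain ⟨y, hy, rfl⟩ := List.mem_map.1 hx
        have := h2.1 ⟨K, hK, by simpa using hy⟩
        omega
    · intro hx
      by_cases h : x ≤ P.n
      · obtain ⟨L, hL, hL'⟩ := h1.2 ⟨hx.1, h⟩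
        exact ⟨L, mem_union_left _ hL, hL'⟩
      · obtain ⟨L, hL, hL'⟩ := h2.2 (by omega)
        exact ⟨_, mem_union_right _ (mem_image_of_mem _ hL),
          List.mem_map.2 ⟨_, hL', by omega⟩⟩

/-- The set of the integers that occur in the lists of `E`. -/
def support (E : Finset (List ℕ)) : Finset ℕ := E.biUnion List.toFinset

theorem mem_support {E : Finset (List ℕ)} {L : List ℕ} (hL : L ∈ E) {x : ℕ} (hx : x ∈ L) :
    x ∈ support E :=
  mem_biUnion.2 ⟨L, hL, List.mem_toFinset.2 hx⟩

/-- The standardization of a set `E` of lists of `Π`: its integers are relabelled increasingly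
by `1, 2, …`. -/
def std (P : ListPartition) (E : Finset (List ℕ)) (hE : E ⊆ P.lists) : ListPartition where
  n := #(support E)
  lists := E.image (List.map (rank (support E)))
  ne_nil := by
    intro L hL
    obtain ⟨K, hK, rfl⟩ := mem_image.1 hL
    simpa using P.ne_nil K (hE hK)
  nodup := by
    intro L hL
    obtain ⟨K, hK, rfl⟩ := mem_image.1 hL
    exact (P.nodup K (hE hK)).map_on fun x hx y hy h =>
      rank_injOn _ (mem_support hK hx) (mem_support hK hy) h
  disjoint := by
    intro L hL L' hL' x hx hx'
    obtain ⟨K, hK, rfl⟩ := mem_image.1 hL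
    obtain ⟨K', hK', rfl⟩ := mem_image.1 hL'
    obtain ⟨y, hy, rfl⟩ := List.mem_map.1 hx
    obtain ⟨z, hz, hyz⟩ := List.mem_map.1 hx'
    obtain rfl : z = y := rank_injOn _ (mem_support hK' hz) (mem_support hK hy) hyz
    rw [P.disjoint K (hE hK) K' (hE hK') z hy hz]
  mem_iff := by
    intro x
    rw [← image_rank, mem_image]
    constructor
    · rintro ⟨L, hL, hx⟩
      obtain ⟨K, hK, rfl⟩ := mem_image.1 hL
      obtain ⟨y, hy, rfl⟩ := List.mem_map.1 hx
      exact ⟨y, mem_support hK hy, rfl⟩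
    · rintro ⟨y, hy, rfl⟩
      obtain ⟨K, hK, hy⟩ := mem_biUnion.1 hy
      exact ⟨_, mem_image_of_mem _ hK, List.mem_map_of_mem (List.mem_toFinset.1 hy)⟩

/-- `Π` is indivisible: `Π = Π' ⊎ Π''` implies `Π' = Π` or `Π'' = Π`. -/
def Indivisible (P : ListPartition) : Prop :=
  ∀ Q R : ListPartition, P = Q.shiftedUnion R → Q = P ∨ R = P

end ListPartition

/-- The complex vector space with basis `Φ^Π`, for `Π` a set partition into lists. -/
abbrev BWSymSpace : Type := ListPartition →₀ ℂ

/-- The structure maps of `BWSym`: `Φ^Π Φ^Π' = Φ^(Π ⊎ Π')`, and `Δ(Φ^Π)` is the sum of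
`Φ^(std E) ⊗ Φ^(std F)` over the ways to split `Π` into two disjoint sets `E` and `F` of lists. -/
def hopfBWSym : HopfOps BWSymSpace where
  mul := Finsupp.linearCombination ℂ fun P : ListPartition =>
    Finsupp.linearCombination ℂ fun Q : ListPartition =>
      (Finsupp.single (P.shiftedUnion Q) 1 : BWSymSpace)
  one := Finsupp.single ListPartition.empty 1
  comul := Finsupp.linearCombination ℂ fun P : ListPartition =>
    ∑ E ∈ P.lists.powerset.attach,
      (Finsupp.single (P.std E.1 (mem_powerset.1 E.2)) 1 : BWSymSpace) ⊗ₜ[ℂ]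
        (Finsupp.single (P.std (P.lists \ E.1) sdiff_subset) 1 : BWSymSpace)
  counit := Finsupp.lapply ListPartition.empty

/-! ### From lists to diagrams -/

/-- `j = min {k ∈ L : αᵢ < pos k < pos i}` with `αᵢ = sup {pos k : k ∈ L, k < i, pos k < pos i}`
(and `sup ∅ = -∞`) and `i < j`, where `pos` is the position in the list `L`. -/
def LeftChild (L : List ℕ) (i j : ℕ) : Prop :=
  i ∈ L ∧ i < j ∧
  IsLeast {k | k ∈ L ∧ (∀ l ∈ L, l < i → L.idxOf l < L.idxOf i → L.idxOf l < L.idxOf k) ∧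
    L.idxOf k < L.idxOf i} j

/-- `j = min {k ∈ L : pos i < pos k < βᵢ}` with `βᵢ = inf {pos k : k ∈ L, k < i, pos k > pos i}`
(and `inf ∅ = +∞`) and `i < j`, where `pos` is the position in the list `L`. -/
def RightChild (L : List ℕ) (i j : ℕ) : Prop :=
  i ∈ L ∧ i < j ∧
  IsLeast {k | k ∈ L ∧ L.idxOf i < L.idxOf k ∧
    (∀ l ∈ L, l < i → L.idxOf i < L.idxOf l → L.idxOf k < L.idxOf l)} j

open Classical in
/-- The edges attached to a list of distinct integers: the first (second) outer half-edge of `i`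
is joined to the first inner half-edge of the left (right) child of `i`. -/
def listEdges (L : List ℕ) : Finset ((ℕ × ℕ) × (ℕ × ℕ)) :=
  {e ∈ (L.toFinset ×ˢ {1, 2}) ×ˢ (L.toFinset ×ˢ {1}) |
    (e.1.2 = 1 ∧ LeftChild L e.1.1 e.2.1) ∨ (e.1.2 = 2 ∧ RightChild L e.1.1 e.2.1)}

/-- The diagram in `G21` with vertices `1, …, n` and edges `E`. -/
def diagram21 (n : ℕ) (E : Finset ((ℕ × ℕ) × (ℕ × ℕ)))
    (h1 : ∀ e ∈ E, e.1 ∈ Icc 1 n ×ˢ ({1, 2} : Finset ℕ) ∧ e.2 ∈ Icc 1 n ×ˢ ({1} : Finset ℕ) ∧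
      e.1.1 < e.2.1)
    (h2 : ∀ e ∈ E, ∀ f ∈ E, e.1 = f.1 → e = f)
    (h3 : ∀ e ∈ E, ∀ f ∈ E, e.2 = f.2 → e = f) : BDiagram where
  n := n
  lam := fun i => if i ∈ Icc 1 n then 2 else 0
  up := Icc 1 n ×ˢ {1, 2}
  down := Icc 1 n ×ˢ {1}
  edges := E
  lam_pos_iff := by
    intro i
    split_ifs with h <;> simp [h]
  up_valid := by
    intro h hh
    obtain ⟨h1, h2⟩ := mem_product.1 hh
    rw [if_pos h1, mem_Icc]
    rw [mem_insert, mem_singleton] at h2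
    omega
  down_valid := by
    intro h hh
    obtain ⟨h1, h2⟩ := mem_product.1 hh
    rw [if_pos h1, mem_Icc]
    rw [mem_singleton] at h2
    omega
  edges_valid := h1
  out_unique := h2
  in_unique := h3

theorem mem_listEdges {L : List ℕ} {e : (ℕ × ℕ) × (ℕ × ℕ)} : e ∈ listEdges L ↔
    e ∈ (L.toFinset ×ˢ ({1, 2} : Finset ℕ)) ×ˢ (L.toFinset ×ˢ ({1} : Finset ℕ)) ∧
    ((e.1.2 = 1 ∧ LeftChild L e.1.1 e.2.1) ∨ (e.1.2 = 2 ∧ RightChild L e.1.1 e.2.1)) := by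
  simp only [listEdges, mem_filter]

theorem listEdges_valid {L : List ℕ} {e} (he : e ∈ listEdges L) :
    e.1.1 ∈ L ∧ e.1.2 ∈ ({1, 2} : Finset ℕ) ∧ e.2.1 ∈ L ∧ e.2.2 = 1 ∧ e.1.1 < e.2.1 := by
  obtain ⟨h1, h2⟩ := mem_listEdges.1 he
  simp only [mem_product, List.mem_toFinset] at h1
  exact ⟨h1.1.1, h1.1.2, h1.2.1, mem_singleton.1 h1.2.2, h2.elim (·.2.2.1) (·.2.2.1)⟩

theorem listEdges_out {L : List ℕ} {e f} (he : e ∈ listEdges L) (hf : f ∈ listEdges L)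
    (h : e.1 = f.1) : e = f := by
  have h1 := (listEdges_valid he).2.2.2.1
  have h2 := (listEdges_valid hf).2.2.2.1
  refine Prod.ext h (Prod.ext ?_ (h1.trans h2.symm))
  rcases (mem_listEdges.1 he).2 with ⟨h3, h4⟩ | ⟨h3, h4⟩ <;>
    rcases (mem_listEdges.1 hf).2 with ⟨h5, h6⟩ | ⟨h5, h6⟩
  · rw [h] at h4
    exact h4.2.2.unique h6.2.2
  · rw [h] at h3
    omega
  · rw [h] at h3
    omega
  · rw [h] at h4
    exact h4.2.2.unique h6.2.2

theorem leftChild_inj {L : List ℕ} {i i' j : ℕ} (h : LeftChild L i j) (h' : LeftChild L i' j) :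
    ¬ i < i' := by
  obtain ⟨hi, hij, ⟨hj, ha, hp⟩, hmin⟩ := h
  obtain ⟨hi', hij', ⟨-, ha', hp'⟩, -⟩ := h'
  intro hlt
  have h1 : ¬ L.idxOf i < L.idxOf i' := fun h => by
    have := ha' i hi hlt h
    omega
  have h2 : L.idxOf i' ≠ L.idxOf i := fun h => hlt.ne' ((List.idxOf_inj hi').1 h)
  have := hmin ⟨hi', fun l hl hli hpl => (ha l hl hli hpl).trans hp', by omega⟩
  omega

theorem rightChild_inj {L : List ℕ} {i i' j : ℕ} (h : RightChild L i j)
    (h' : RightChild L i' j) : ¬ i < i' := by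
  obtain ⟨hi, hij, ⟨hj, hp, hb⟩, hmin⟩ := h
  obtain ⟨hi', hij', ⟨-, hp', hb'⟩, -⟩ := h'
  intro hlt
  have h1 : ¬ L.idxOf i' < L.idxOf i := fun h => by
    have := hb' i hi hlt h
    omega
  have h2 : L.idxOf i' ≠ L.idxOf i := fun h => hlt.ne' ((List.idxOf_inj hi').1 h)
  have := hmin ⟨hi', by omega, fun l hl hli hpl => hp'.trans (hb l hl hli hpl)⟩
  omega

theorem not_leftChild_rightChild {L : List ℕ} {i i' j : ℕ} (h : LeftChild L i j)
    (h' : RightChild L i' j) : False := by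
  obtain ⟨hi, hij, ⟨hj, ha, hp⟩, hmin⟩ := h
  obtain ⟨hi', hij', ⟨-, hp', hb⟩, hmin'⟩ := h'
  rcases lt_trichotomy i i' with hlt | rfl | hlt
  · have := hmin ⟨hi', fun l hl hli hpl => by
      by_contra hc
      have h2 : L.idxOf i' ≠ L.idxOf l := fun h => by
        have := (List.idxOf_inj hi').1 h
        omega
      have := hb l hl (hli.trans hlt) (by omega)
      have := ha l hl hli hpl
      omega, by omega⟩
    omega
  · omega
  · have := hmin' ⟨hi, by omega, fun l hl hli hpl => by
      by_contra hc
      have h2 : L.idxOf i ≠ L.idxOf l := fun h => by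
        have := (List.idxOf_inj hi).1 h
        omega
      have := ha l hl (hli.trans hlt) (by omega)
      have := hb l hl hli hpl
      omega⟩
    omega

theorem listEdges_in {L : List ℕ} {e f} (he : e ∈ listEdges L) (hf : f ∈ listEdges L)
    (h : e.2 = f.2) : e = f := by
  refine Prod.ext ?_ h
  have key : e.1.2 = f.1.2 ∧ ¬ e.1.1 < f.1.1 ∧ ¬ f.1.1 < e.1.1 := by
    rcases (mem_listEdges.1 he).2 with ⟨h3, h4⟩ | ⟨h3, h4⟩ <;>
      rcases (mem_listEdges.1 hf).2 with ⟨h5, h6⟩ | ⟨h5, h6⟩ <;> rw [h] at h4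
    · exact ⟨h3.trans h5.symm, leftChild_inj h4 h6, leftChild_inj h6 h4⟩
    · exact (not_leftChild_rightChild h4 h6).elim
    · exact (not_leftChild_rightChild h6 h4).elim
    · exact ⟨h3.trans h5.symm, rightChild_inj h4 h6, rightChild_inj h6 h4⟩
  exact Prod.ext (by omega) key.1

/-- The word `[σ(1), …, σ(n)]` of a permutation of `{1, …, n}`, which is coded as a permutation
of `{0, …, n - 1}`. -/
def permWord {n : ℕ} (s : Equiv.Perm (Fin n)) : List ℕ := List.ofFn fun k => (s k : ℕ) + 1

theorem mem_permWord {n : ℕ} {s : Equiv.Perm (Fin n)} {x : ℕ} (hx : x ∈ permWord s) :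
    x ∈ Icc 1 n := by
  obtain ⟨k, rfl⟩ := List.mem_ofFn.1 hx
  have := (s k).2
  rw [mem_Icc]
  omega

/-- The diagram `m_σ` of a permutation. -/
def mPerm {n : ℕ} (s : Equiv.Perm (Fin n)) : BDiagram :=
  diagram21 n (listEdges (permWord s))
    (fun e he => by
      obtain ⟨h1, h2, h3, h4, h5⟩ := listEdges_valid he
      exact ⟨mem_product.2 ⟨mem_permWord h1, h2⟩,
        mem_product.2 ⟨mem_permWord h3, mem_singleton.2 h4⟩, h5⟩)
    (fun _ he _ hf => listEdges_out he hf) (fun _ he _ hf => listEdges_in he hf)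

/-- The diagram `m_Π`: the union, over the lists `L` of `Π`, of the diagrams `m_(std L)` with the
vertices renamed increasingly by the integers in `L`. As `listEdges` depends only on the relative
order of the integers, the edges obtained from `L` are those of `listEdges L`. -/
def mDiag (P : ListPartition) : BDiagram :=
  diagram21 P.n (P.lists.biUnion listEdges)
    (fun e he => by
      obtain ⟨L, hL, he⟩ := mem_biUnion.1 he
      obtain ⟨h1, h2, h3, h4, h5⟩ := listEdges_valid he
      exact ⟨mem_product.2 ⟨(P.mem_iff _).1 ⟨L, hL, h1⟩, h2⟩,
        mem_product.2 ⟨(P.mem_iff _).1 ⟨L, hL, h3⟩, mem_singleton.2 h4⟩, h5⟩)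
    (fun e he f hf h => by
      obtain ⟨L, hL, he⟩ := mem_biUnion.1 he
      obtain ⟨K, hK, hf⟩ := mem_biUnion.1 hf
      have h1 := (listEdges_valid he).1
      rw [h] at h1
      obtain rfl := P.disjoint L hL K hK _ h1 (listEdges_valid hf).1
      exact listEdges_out he hf h)
    (fun e he f hf h => by
      obtain ⟨L, hL, he⟩ := mem_biUnion.1 he
      obtain ⟨K, hK, hf⟩ := mem_biUnion.1 hf
      have h1 := (listEdges_valid he).2.2.1
      rw [h] at h1
      obtain rfl := P.disjoint L hL K hK _ h1 (listEdges_valid hf).2.2.1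
      exact listEdges_in he hf h)

theorem mDiag_mem (P : ListPartition) : (Finsupp.single (mDiag P) 1 : BSpace) ∈ B21 :=
  Submodule.subset_span ⟨mDiag P, ⟨fun _ hi => if_pos hi, rfl, rfl⟩, rfl⟩

end

/-! Combinatorics. A word with distinct letters is the in-order reading of an increasing binary
tree: its smallest letter is the root and separates the left subtree from the right one. The diagram
of a permutation is this tree, where the half-edges `(i, 1)` and `(i, 2)` are the slots for the left
and the right child of `i`. In a diagram of `G21` every vertex has at most one parent, which is
smaller, and at most one child in each slot, so the diagram is a forest of increasing binary trees.
Connected diagrams are therefore permutations, and all diagrams are set partitions into lists. The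
proof removes or inserts the largest vertex `x`: it has no influence on the edges between the other
vertices (`mem_listEdges_insert`), and it is the child of `i` in a free slot when it stands directly
beside `i`. This gives `listEdges_injective` and `exists_lists`.

Hopf structure. A term of `G ⋆ G'` is just a diagram whose first `G.n` vertices carry `G` and whose
other vertices carry `G'` (`mem_prodSet`), and each such diagram occurs once. Associativity then
compares two descriptions of the diagrams that are cut into three blocks. The coproduct is
multiplicative because a term `K` with an isolated set `I` amounts to isolated sets in `G` and `G'`
together with a gluing inside `I` and a gluing outside `I` (`sum_prodSet_iso`). The number of
vertices is a grading whose part of degree zero is the line of the unit, so the antipode is a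
geometric series for the convolution product, and it preserves every sub-bialgebra.

Comparison. The isolated sets of `mDiag P` are the unions of lists of `P`, so `Φ^Π ↦ m_Π` is an
injective map of coalgebras, and `BWSym` inherits the coalgebra axioms from the B-diagrams. In the
product of `m_Π` and `m_Π'` the term without new edges is `m_(Π ⊎ Π')`; all others have more edges,
hence, being forests, fewer lists (`mul_mDiag_sub_mem`). So both algebras have the same product up
to terms with fewer lists. Set partitions into lists form a free monoid on the non-empty indivisible
ones (`wordEquiv`), so `BWSym` is a free algebra, and an algebra map whose values at the generators
are correct up to fewer lists is unitriangular, hence bijective (`exists_algEquiv`).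

For an isomorphism of Hopf algebras the generators and their images must be primitive. In a
cocommutative Hopf algebra the convolution of the antipode with the degree map `Y` has primitive
values (`comul_dynkin`). Divided by the degree, it sends a basis element to itself plus products, so
it yields a second system of free generators of `BWSym`. The same construction in `B21` gives
primitive elements that differ from the images of these generators only by terms with fewer lists,
since both satisfy the same recursion (`dynkin_sub_basisMap_mem`). The algebra map that matches them
is the required isomorphism (`exists_bialgEquiv`). -/

noncomputable section

/-! ### Convolution on a graded connected bialgebra -/

section GradedConnected

open WithConv Coalgebra

variable {ι A : Type} [Ring A] [Bialgebra ℂ A] {b : Module.Basis ι ℂ A} {deg : ι → ℕ}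

/-- The coproduct of a basis vector is a combination of tensors of basis vectors whose degrees
add up to its degree. -/
def GradedComul (b : Module.Basis ι ℂ A) (deg : ι → ℕ) : Prop :=
  ∀ i, comul (R := ℂ) (b i) ∈
    Submodule.span ℂ {t | ∃ j k, deg j + deg k = deg i ∧ t = b j ⊗ₜ[ℂ] b k}

/-- A convolution product at a basis vector depends only on the values of its factors at pairs of
basis vectors whose degrees add up to the given degree. This locality lets infinite series be
replaced by truncations. -/
theorem GradedComul.conv_congr (hΔ : GradedComul b deg) {i : ι}
    {f f' g g' : WithConv (A →ₗ[ℂ] A)}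
    (h : ∀ j k, deg j + deg k = deg i → f (b j) * g (b k) = f' (b j) * g' (b k)) :
    (f * g) (b i) = (f' * g') (b i) := by
  rw [LinearMap.convMul_apply, LinearMap.convMul_apply]
  have hi := hΔ i
  generalize comul (R := ℂ) (b i) = t at hi ⊢
  induction hi using Submodule.span_induction with
  | mem x hx =>
    obtain ⟨j, k, hjk, rfl⟩ := hx
    simpa using h j k hjk
  | zero => simp
  | add x y _ _ hx hy => simp only [map_add, hx, hy]
  | smul c x _ hx => simp only [map_smul, hx]

/-- The identity minus the projection onto the line of the unit. -/
def augId (A : Type) [Ring A] [Bialgebra ℂ A] : WithConv (A →ₗ[ℂ] A) :=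
  toConv LinearMap.id - 1

theorem augId_apply (x : A) : augId A x = x - algebraMap ℂ A (counit x) := by
  simp [augId]

/-- Each convolution factor `id - ε` kills degree zero and so consumes at least one unit of degree;
`N` factors vanish on degrees below `N`. -/
theorem GradedComul.augId_pow_eq_zero (hΔ : GradedComul b deg)
    (h0 : ∀ i, deg i = 0 → b i = 1) (N : ℕ) :
    ∀ i, deg i < N → (augId A ^ N) (b i) = 0 := by
  induction N with
  | zero => intro i hi; omega
  | succ N ih =>
    intro i hi
    rw [pow_succ']
    rw [hΔ.conv_congr (f' := 0) (g' := 0)]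
    · simp
    · intro j k hjk
      -- In degree zero the first factor vanishes, as the basis vector is the unit; otherwise the
      -- second tensor factor has degree below `N`.
      rcases Nat.eq_zero_or_pos (deg j) with hj | hj
      · rw [h0 j hj, augId_apply]
        simp
      · rw [ih k (by omega)]
        simp

theorem GradedComul.neg_augId_pow_eq_zero (hΔ : GradedComul b deg)
    (h0 : ∀ i, deg i = 0 → b i = 1) {N : ℕ} {i : ι} (hi : deg i < N) :
    ((-augId A) ^ N) (b i) = 0 := by
  rw [neg_pow']
  have := hΔ.augId_pow_eq_zero h0 N i hi
  rcases neg_one_pow_eq_or (WithConv (A →ₗ[ℂ] A)) N with h | h <;> simp [h, this]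

/-- The truncated geometric series of `-J`, with `J = id - ε`. -/
def convGeom (A : Type) [Ring A] [Bialgebra ℂ A] (N : ℕ) : WithConv (A →ₗ[ℂ] A) :=
  ∑ k ∈ range N, (-augId A) ^ k

theorem GradedComul.convGeom_stable (hΔ : GradedComul b deg)
    (h0 : ∀ i, deg i = 0 → b i = 1) {i : ι} {N : ℕ} (hN : deg i < N) :
    convGeom A N (b i) = convGeom A (deg i + 1) (b i) := by
  obtain ⟨M, rfl⟩ := Nat.exists_eq_add_of_le (Nat.succ_le_of_lt hN)
  clear hN
  induction M with
  | zero => rfl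
  | succ M ih =>
    rw [← ih, ← add_assoc]
    conv_lhs => rw [convGeom, sum_range_succ]
    exact (congrArg (convGeom A ((deg i).succ + M) (b i) + ·)
      (hΔ.neg_augId_pow_eq_zero h0 (by omega))).trans (add_zero _)

/-- The convolution inverse of the identity. -/
def gradedAntipode (b : Module.Basis ι ℂ A) (deg : ι → ℕ) : A →ₗ[ℂ] A :=
  b.constr ℂ fun i => convGeom A (deg i + 1) (b i)

theorem gradedAntipode_apply (hΔ : GradedComul b deg) (h0 : ∀ i, deg i = 0 → b i = 1)
    {i : ι} {N : ℕ} (hN : deg i < N) : gradedAntipode b deg (b i) = convGeom A N (b i) := by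
  rw [gradedAntipode, Module.Basis.constr_basis, hΔ.convGeom_stable h0 hN]

theorem gradedAntipode_mul_id (hΔ : GradedComul b deg) (h0 : ∀ i, deg i = 0 → b i = 1) :
    toConv (gradedAntipode b deg) * toConv LinearMap.id = (1 : WithConv (A →ₗ[ℂ] A)) := by
  apply WithConv.ofConv_injective
  refine b.ext fun i => ?_
  change (toConv (gradedAntipode b deg) * toConv LinearMap.id : WithConv (A →ₗ[ℂ] A)) (b i) =
    (1 : WithConv (A →ₗ[ℂ] A)) (b i)
  -- The truncation in the antipode varies with the basis vector; `deg i + 1` terms suffice for all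
  -- degrees up to `deg i` at once. With `id = 1 - (-J)` the sum then telescopes, and its remainder
  -- vanishes in degree `deg i`.
  rw [hΔ.conv_congr (f' := convGeom A (deg i + 1)) (g' := toConv LinearMap.id)]
  · have h1 : (toConv LinearMap.id : WithConv (A →ₗ[ℂ] A)) = 1 - -augId A := by
      simp [augId]
    rw [h1, convGeom, geom_sum_mul_neg]
    exact (congrArg ((1 : WithConv (A →ₗ[ℂ] A)) (b i) - ·)
      (hΔ.neg_augId_pow_eq_zero h0 (by omega))).trans (sub_zero _)
  · intro j k hjk
    rw [← gradedAntipode_apply hΔ h0 (by omega)]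

theorem id_mul_gradedAntipode (hΔ : GradedComul b deg) (h0 : ∀ i, deg i = 0 → b i = 1) :
    toConv LinearMap.id * toConv (gradedAntipode b deg) = (1 : WithConv (A →ₗ[ℂ] A)) := by
  apply WithConv.ofConv_injective
  refine b.ext fun i => ?_
  change (toConv LinearMap.id * toConv (gradedAntipode b deg) : WithConv (A →ₗ[ℂ] A)) (b i) =
    (1 : WithConv (A →ₗ[ℂ] A)) (b i)
  rw [hΔ.conv_congr (g' := convGeom A (deg i + 1)) (f' := toConv LinearMap.id)]
  · have h1 : (toConv LinearMap.id : WithConv (A →ₗ[ℂ] A)) = 1 - -augId A := by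
      simp [augId]
    rw [h1, convGeom, mul_neg_geom_sum]
    exact (congrArg ((1 : WithConv (A →ₗ[ℂ] A)) (b i) - ·)
      (hΔ.neg_augId_pow_eq_zero h0 (by omega))).trans (sub_zero _)
  · intro j k hjk
    rw [← gradedAntipode_apply hΔ h0 (by omega)]

theorem conv_mem {W : Submodule ℂ A} (hmul : ∀ x ∈ W, ∀ y ∈ W, x * y ∈ W)
    (hcomul : ∀ x ∈ W, comul (R := ℂ) x ∈ LinearMap.range (TensorProduct.map W.subtype W.subtype))
    {f g : WithConv (A →ₗ[ℂ] A)} (hf : ∀ x ∈ W, f x ∈ W) (hg : ∀ x ∈ W, g x ∈ W) :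
    ∀ x ∈ W, (f * g) x ∈ W := by
  intro x hx
  rw [LinearMap.convMul_apply]
  obtain ⟨t, ht⟩ := hcomul x hx
  rw [← ht]
  clear ht
  induction t using TensorProduct.induction_on with
  | zero => simp
  | tmul a c => simpa using hmul _ (hf _ a.2) _ (hg _ c.2)
  | add s t hs ht =>
    simp only [map_add]
    exact W.add_mem hs ht

/-- At any given vector the antipode is a finite sum of convolution powers of `ε - id`. Maps that
preserve a sub-bialgebra are closed under convolution (`conv_mem`), so all of these powers preserve
it. -/
theorem gradedAntipode_mem (hΔ : GradedComul b deg) (h0 : ∀ i, deg i = 0 → b i = 1)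
    {W : Submodule ℂ A} (hone : 1 ∈ W) (hmul : ∀ x ∈ W, ∀ y ∈ W, x * y ∈ W)
    (hcomul : ∀ x ∈ W,
      comul (R := ℂ) x ∈ LinearMap.range (TensorProduct.map W.subtype W.subtype)) :
    ∀ x ∈ W, gradedAntipode b deg x ∈ W := by
  have h1 : ∀ x ∈ W, (1 : WithConv (A →ₗ[ℂ] A)) x ∈ W := fun x _ => by
    rw [LinearMap.convOne_apply, Algebra.algebraMap_eq_smul_one]
    exact W.smul_mem _ hone
  have hJ : ∀ x ∈ W, (-augId A) x ∈ W := fun x hx => by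
    change -(x - (1 : WithConv (A →ₗ[ℂ] A)) x) ∈ W
    exact W.neg_mem (W.sub_mem hx (h1 x hx))
  have hpow : ∀ k, ∀ x ∈ W, ((-augId A) ^ k) x ∈ W := by
    intro k
    induction k with
    | zero => simpa using h1
    | succ k ih =>
      rw [pow_succ]
      exact conv_mem hmul hcomul ih hJ
  have hgeom : ∀ N, ∀ x ∈ W, convGeom A N x ∈ W := by
    intro N x hx
    induction N with
    | zero => exact W.zero_mem
    | succ N ih =>
      rw [convGeom, sum_range_succ]
      exact W.add_mem ih (hpow N x hx)
  intro x hx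
  -- Only finitely many basis vectors occur in `y`, so a single truncation works for all of them.
  have key : ∀ y : A, ∃ N, ∀ M, N ≤ M → gradedAntipode b deg y = convGeom A M y := by
    intro y
    induction b.mem_span y using Submodule.span_induction with
    | mem y hy =>
      obtain ⟨i, rfl⟩ := hy
      exact ⟨deg i + 1, fun M hM => gradedAntipode_apply hΔ h0 (by omega)⟩
    | zero => exact ⟨0, fun M _ => ((gradedAntipode b deg).map_zero).trans
        (convGeom A M).ofConv.map_zero.symm⟩
    | add y z _ _ hy hz =>
      obtain ⟨N, hN⟩ := hy
      obtain ⟨N', hN'⟩ := hz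
      refine ⟨max N N', fun M hM => ?_⟩
      rw [map_add, hN M (by omega), hN' M (by omega)]
      exact ((convGeom A M).ofConv.map_add _ _).symm
    | smul c y _ hy =>
      obtain ⟨N, hN⟩ := hy
      refine ⟨N, fun M hM => ?_⟩
      rw [map_smul, hN M hM]
      exact ((convGeom A M).ofConv.map_smul _ _).symm
  obtain ⟨N, hN⟩ := key x
  rw [hN N le_rfl]
  exact hgeom N x hx

end GradedConnected

/-! ### The Dynkin operator of a cocommutative Hopf algebra -/

section Dynkin

open WithConv Coalgebra

variable {H : Type} [Ring H] [HopfAlgebra ℂ H]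

/-- The convolution of the antipode with `Y`. -/
def dynkin (Y : H →ₗ[ℂ] H) : H →ₗ[ℂ] H :=
  (toConv (HopfAlgebra.antipode ℂ (A := H)) * toConv Y).ofConv

theorem id_mul_dynkin (Y : H →ₗ[ℂ] H) :
    toConv LinearMap.id * toConv (dynkin Y) = toConv Y := by
  change toConv LinearMap.id * (toConv (HopfAlgebra.antipode ℂ (A := H)) * toConv Y) = _
  rw [← mul_assoc, LinearMap.id_mul_antipode, one_mul]

/-- Let `D = dynkin Y`, so that `id * D = Y`. In the convolution algebra of maps from `H` to `H ⊗
H`, the coproduct `δ` is `i1 * i2` for the two inclusions `i1`, `i2`. Composing `id * D = Y` with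
`δ` gives `δ * (δ ∘ D) = δ ∘ Y`, and commuting `i1` past `i2` gives `δ * (i1 ∘ D + i2 ∘ D) = (Y ⊗ id
+ id ⊗ Y) ∘ δ`. The right sides agree because `Y` is a coderivation, and `δ` can be cancelled. -/
theorem comul_dynkin [IsCocomm ℂ H] (Y : H →ₗ[ℂ] H)
    (hY : comul ∘ₗ Y = (Y.rTensor H + Y.lTensor H) ∘ₗ comul) (x : H) :
    comul (R := ℂ) (dynkin Y x) = dynkin Y x ⊗ₜ[ℂ] 1 + 1 ⊗ₜ[ℂ] dynkin Y x := by
  let i1 : H →ₐ[ℂ] H ⊗[ℂ] H := Algebra.TensorProduct.includeLeft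
  let i2 : H →ₐ[ℂ] H ⊗[ℂ] H := Algebra.TensorProduct.includeRight
  let δ : H →ₐ[ℂ] H ⊗[ℂ] H := Bialgebra.comulAlgHom ℂ H
  have conv_i1_i2 : ∀ f g : H →ₗ[ℂ] H, toConv (i1.toLinearMap ∘ₗ f) * toConv (i2.toLinearMap ∘ₗ g)
      = toConv (TensorProduct.map f g ∘ₗ comul) := by
    intro f g
    rw [LinearMap.convMul_def]
    congr 1
    rw [← LinearMap.comp_assoc]
    congr 1
    ext a c
    simp [i1, i2]
  -- Cocommutativity enters here: the images of the two inclusions commute, and flipping the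
  -- coproduct does not change it.
  have conv_i2_i1 : ∀ f g : H →ₗ[ℂ] H, toConv (i2.toLinearMap ∘ₗ f) * toConv (i1.toLinearMap ∘ₗ g)
      = toConv (i1.toLinearMap ∘ₗ g) * toConv (i2.toLinearMap ∘ₗ f) := by
    intro f g
    rw [LinearMap.convMul_def, LinearMap.convMul_def]
    congr 1
    conv_lhs => rw [← Coalgebra.comm_comp_comul ℂ H]
    rw [← LinearMap.comp_assoc, ← LinearMap.comp_assoc, ← LinearMap.comp_assoc]
    congr 1
    ext a c
    simp [i1, i2]
  have hδ : toConv δ.toLinearMap = toConv (i1.toLinearMap ∘ₗ LinearMap.id) *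
      toConv (i2.toLinearMap ∘ₗ LinearMap.id) := by
    rw [conv_i1_i2, TensorProduct.map_id]
    rfl
  have comp_conv : ∀ (j : H →ₐ[ℂ] H ⊗[ℂ] H) (f g : H →ₗ[ℂ] H),
      toConv (j.toLinearMap ∘ₗ f) * toConv (j.toLinearMap ∘ₗ g) =
        toConv (j.toLinearMap ∘ₗ (toConv f * toConv g).ofConv) := by
    intro j f g
    rw [LinearMap.algHom_comp_convMul_distrib]
  set D := dynkin Y with hD
  have hid : (toConv LinearMap.id * toConv D).ofConv = Y := by rw [hD, id_mul_dynkin]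
  have e1 : toConv δ.toLinearMap * toConv (i1.toLinearMap ∘ₗ D) =
      toConv (Y.rTensor H ∘ₗ comul) := by
    rw [hδ, mul_assoc, conv_i2_i1, ← mul_assoc, comp_conv, hid, conv_i1_i2]
    rfl
  have e2 : toConv δ.toLinearMap * toConv (i2.toLinearMap ∘ₗ D) =
      toConv (Y.lTensor H ∘ₗ comul) := by
    rw [hδ, mul_assoc, comp_conv, hid, conv_i1_i2]
    rfl
  have e3 : toConv δ.toLinearMap * toConv (δ.toLinearMap ∘ₗ D) =
      toConv δ.toLinearMap * (toConv (i1.toLinearMap ∘ₗ D) + toConv (i2.toLinearMap ∘ₗ D)) := by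
    rw [mul_add, e1, e2]
    have := comp_conv δ LinearMap.id D
    rw [LinearMap.comp_id, hid] at this
    rw [this]
    change toConv (comul ∘ₗ Y) = _
    rw [hY]
    rfl
  -- The composite of `δ` with the antipode is a left convolution inverse of `δ`, which permits the
  -- cancellation in `e3`.
  have e4 : toConv (δ.toLinearMap ∘ₗ HopfAlgebra.antipode ℂ (A := H)) * toConv δ.toLinearMap
      = 1 := by
    have := comp_conv δ (HopfAlgebra.antipode ℂ (A := H)) LinearMap.id
    rw [LinearMap.comp_id, LinearMap.antipode_mul_id] at this
    rw [this]
    rw [LinearMap.convOne_def, LinearMap.convOne_def]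
    congr 1
    ext a
    simp [δ]
  have e5 := congrArg (fun t => toConv (δ.toLinearMap ∘ₗ HopfAlgebra.antipode ℂ (A := H)) * t) e3
  simp only [← mul_assoc, e4, one_mul] at e5
  exact congrArg (fun t : WithConv (H →ₗ[ℂ] H ⊗[ℂ] H) => t x) e5

end Dynkin

/-! ### Unitriangular maps -/

/-- Let `F n` be spanned by the basis vectors of weight below `n`. Then `T - id` maps `F (n + 1)`
into `F n`, the union of the `F n` is everything and `F 0 = 0`. By induction on `n` a vector of the
kernel descends to `F 0`, and `y` is reached from a preimage `z` of `y - T y` as the image of `z +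
y`. The index set may be infinite. -/
theorem bijective_of_unitriangular {ι : Type} (T : (ι →₀ ℂ) →ₗ[ℂ] (ι →₀ ℂ)) (w : ι → ℕ)
    (h : ∀ i, T (Finsupp.single i 1) - Finsupp.single i 1 ∈
      Submodule.span ℂ {x | ∃ j, w j < w i ∧ x = Finsupp.single j 1}) :
    Function.Bijective T := by
  let F : ℕ → Submodule ℂ (ι →₀ ℂ) := fun n =>
    Submodule.span ℂ {x | ∃ j, w j < n ∧ x = Finsupp.single j 1}
  have hF : ∀ n x, x ∈ F (n + 1) → T x - x ∈ F n := by
    intro n x hx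
    induction hx using Submodule.span_induction with
    | mem x hx =>
      obtain ⟨j, hj, rfl⟩ := hx
      refine Submodule.span_mono ?_ (h j)
      rintro y ⟨k, hk, rfl⟩
      exact ⟨k, by omega, rfl⟩
    | zero => simp
    | add x y _ _ hx hy =>
      rw [map_add, add_sub_add_comm]
      exact (F n).add_mem hx hy
    | smul c x _ hx =>
      rw [map_smul, ← smul_sub]
      exact (F n).smul_mem c hx
  have hF0 : F 0 = ⊥ := by
    simp [F]
  have htop : ∀ x, ∃ n, x ∈ F n := by
    intro x
    induction x using Finsupp.induction_linear with
    | zero => exact ⟨0, zero_mem _⟩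
    | add x y hx hy =>
      obtain ⟨n, hn⟩ := hx
      obtain ⟨m, hm⟩ := hy
      have mono : ∀ k, k ≤ max n m → F k ≤ F (max n m) := fun k hk =>
        Submodule.span_mono fun y ⟨j, hj, hy⟩ => ⟨j, hj.trans_le hk, hy⟩
      exact ⟨max n m, add_mem (mono n (le_max_left _ _) hn) (mono m (le_max_right _ _) hm)⟩
    | single i c =>
      refine ⟨w i + 1, ?_⟩
      rw [← mul_one c, ← smul_eq_mul, ← Finsupp.smul_single]
      exact Submodule.smul_mem _ _ (Submodule.subset_span ⟨i, by omega, rfl⟩)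
  constructor
  · rw [injective_iff_map_eq_zero]
    intro x hx
    obtain ⟨n, hn⟩ := htop x
    induction n with
    | zero => simpa [hF0] using hn
    | succ n ih =>
      have := hF n x hn
      rw [hx, zero_sub] at this
      exact ih (neg_mem_iff.1 this)
  · intro y
    obtain ⟨n, hn⟩ := htop y
    induction n generalizing y with
    | zero =>
      rw [hF0, Submodule.mem_bot] at hn
      exact ⟨0, by rw [hn, map_zero]⟩
    | succ n ih =>
      obtain ⟨z, hz⟩ := ih (y - T y) (by simpa using neg_mem (hF n y hn))
      exact ⟨z + y, by rw [map_add, hz, sub_add_cancel]⟩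

/-! ### Bialgebras, transfer of axioms along injections, sub-Hopf algebras -/

namespace HopfOps

variable {V : Type} [AddCommGroup V] [Module ℂ V]

/-- The axioms of a bialgebra. -/
structure IsBialgebra (D : HopfOps V) : Prop where
  mul_assoc : ∀ x y z, D.mul (D.mul x y) z = D.mul x (D.mul y z)
  one_mul : ∀ x, D.mul D.one x = x
  mul_one : ∀ x, D.mul x D.one = x
  coassoc : TensorProduct.assoc ℂ V V V ∘ₗ D.comul.rTensor V ∘ₗ D.comul =
    D.comul.lTensor V ∘ₗ D.comul
  rTensor_counit : D.counit.rTensor V ∘ₗ D.comul = TensorProduct.mk ℂ ℂ V 1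
  lTensor_counit : D.counit.lTensor V ∘ₗ D.comul = (TensorProduct.mk ℂ V ℂ).flip 1
  counit_one : D.counit D.one = 1
  counit_mul : ∀ x y, D.counit (D.mul x y) = D.counit x * D.counit y
  comul_one : D.comul D.one = D.one ⊗ₜ[ℂ] D.one
  comul_mul : ∀ x y,
    D.comul (D.mul x y) = TensorProduct.map₂ D.mul D.mul (D.comul x) (D.comul y)

theorem IsBialgebra.isHopf {D : HopfOps V} (h : D.IsBialgebra) (hS : ∃ S, D.IsAntipode S) :
    D.IsHopf where
  __ := h
  exists_antipode := hS

/-- A graded connected bialgebra has an antipode, and it preserves the sub-bialgebras. -/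
theorem IsBialgebra.exists_antipode {D : HopfOps V} (h : D.IsBialgebra) {ι : Type}
    (b : Module.Basis ι ℂ V) (deg : ι → ℕ) (h0 : ∀ i, deg i = 0 → b i = D.one)
    (hΔ : ∀ i, D.comul (b i) ∈
      Submodule.span ℂ {t | ∃ j k, deg j + deg k = deg i ∧ t = b j ⊗ₜ[ℂ] b k}) :
    ∃ S, D.IsAntipode S ∧ ∀ W : Submodule ℂ V, D.one ∈ W → (∀ x ∈ W, ∀ y ∈ W, D.mul x y ∈ W) →
      (∀ x ∈ W, D.comul x ∈ LinearMap.range (TensorProduct.map W.subtype W.subtype)) →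
      ∀ x ∈ W, S x ∈ W := by
  -- The structure maps become instances on `V` itself, so that the convolution algebra of
  -- endomorphisms is available.
  let _ : Ring V :=
    { (inferInstance : AddCommGroup V) with
      mul := fun x y => D.mul x y
      one := D.one
      mul_assoc := h.mul_assoc
      one_mul := h.one_mul
      mul_one := h.mul_one
      left_distrib := fun x y z => (D.mul x).map_add y z
      right_distrib := fun x y z => LinearMap.map_add₂ D.mul x y z
      zero_mul := fun x => LinearMap.map_zero₂ D.mul x
      mul_zero := fun x => (D.mul x).map_zero }
  let _ : Algebra ℂ V := Algebra.ofModule (fun c x y => LinearMap.map_smul₂ D.mul c x y)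
    (fun c x y => (D.mul x).map_smul c y)
  let _ : Coalgebra ℂ V :=
    { comul := D.comul
      counit := D.counit
      coassoc := h.coassoc
      rTensor_counit_comp_comul := h.rTensor_counit
      lTensor_counit_comp_comul := h.lTensor_counit }
  let _ : Bialgebra ℂ V :=
    Bialgebra.mk' ℂ V h.counit_one (fun {a b} => h.counit_mul a b) h.comul_one
      (fun {a b} => (h.comul_mul a b).trans
        (tmul_mul_eq_map₂ (A := V) (D.comul a) (D.comul b)).symm)
  have lift_eq : ∀ f g : V →ₗ[ℂ] V, ∀ t, TensorProduct.lift D.mul (TensorProduct.map f g t) =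
      LinearMap.mul' ℂ V (TensorProduct.map f g t) := fun f g t => rfl
  refine ⟨gradedAntipode (A := V) b deg, ⟨fun x => ?_, fun x => ?_⟩, fun W hone hmul hcomul =>
    gradedAntipode_mem (A := V) hΔ h0 hone hmul hcomul⟩
  · exact (congrArg (fun f : WithConv (V →ₗ[ℂ] V) => f x)
      (gradedAntipode_mul_id (A := V) hΔ h0)).trans
      (Algebra.algebraMap_eq_smul_one (A := V) (D.counit x))
  · exact (congrArg (fun f : WithConv (V →ₗ[ℂ] V) => f x)
      (id_mul_gradedAntipode (A := V) hΔ h0)).trans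
      (Algebra.algebraMap_eq_smul_one (A := V) (D.counit x))

section pullback

variable {V' : Type} [AddCommGroup V'] [Module ℂ V'] {D : HopfOps V} {D' : HopfOps V'}
  {f : V' →ₗ[ℂ] V}

/-- The threefold tensor power of `f` is injective since vector spaces are flat, so the identity can
be checked in the target. This serves both the inclusion of a subspace and the map from `BWSym` to
the B-diagrams. -/
theorem coassoc_of_injective (hf : Function.Injective f)
    (hΔ : ∀ x, TensorProduct.map f f (D'.comul x) = D.comul (f x))
    (h : TensorProduct.assoc ℂ V V V ∘ₗ D.comul.rTensor V ∘ₗ D.comul =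
      D.comul.lTensor V ∘ₗ D.comul) :
    TensorProduct.assoc ℂ V' V' V' ∘ₗ D'.comul.rTensor V' ∘ₗ D'.comul =
      D'.comul.lTensor V' ∘ₗ D'.comul := by
  have hinj : Function.Injective (TensorProduct.map f (TensorProduct.map f f)) :=
    TensorProduct.map_injective_of_flat_flat _ _ hf
      (TensorProduct.map_injective_of_flat_flat _ _ hf hf)
  ext x
  apply hinj
  have h1 : ∀ t : V' ⊗[ℂ] V', TensorProduct.map f (TensorProduct.map f f)
      (TensorProduct.assoc ℂ V' V' V' (D'.comul.rTensor V' t)) =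
      TensorProduct.assoc ℂ V V V (D.comul.rTensor V (TensorProduct.map f f t)) := by
    intro t
    induction t using TensorProduct.induction_on with
    | zero => simp
    | tmul x y =>
      simp only [LinearMap.rTensor_tmul, TensorProduct.map_tmul]
      rw [← hΔ x]
      generalize D'.comul x = s
      induction s using TensorProduct.induction_on with
      | zero => simp
      | tmul a b => simp
      | add s t hs ht => simp only [TensorProduct.add_tmul, map_add, hs, ht]
    | add s t hs ht => simp only [map_add, hs, ht]
  have h2 : ∀ t : V' ⊗[ℂ] V', TensorProduct.map f (TensorProduct.map f f)
      (D'.comul.lTensor V' t) = D.comul.lTensor V (TensorProduct.map f f t) := by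
    intro t
    induction t using TensorProduct.induction_on with
    | zero => simp
    | tmul x y => simp only [LinearMap.lTensor_tmul, TensorProduct.map_tmul, hΔ]
    | add s t hs ht => simp only [map_add, hs, ht]
  have h3 := LinearMap.congr_fun h (f x)
  simp only [LinearMap.comp_apply, LinearEquiv.coe_coe] at h3 ⊢
  rw [h1, h2, hΔ, h3]

theorem rTensor_counit_of_injective (hf : Function.Injective f)
    (hΔ : ∀ x, TensorProduct.map f f (D'.comul x) = D.comul (f x))
    (hε : ∀ x, D'.counit x = D.counit (f x))
    (h : D.counit.rTensor V ∘ₗ D.comul = TensorProduct.mk ℂ ℂ V 1) :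
    D'.counit.rTensor V' ∘ₗ D'.comul = TensorProduct.mk ℂ ℂ V' 1 := by
  have hinj : Function.Injective (f.lTensor ℂ) :=
    Module.Flat.lTensor_preserves_injective_linearMap _ hf
  ext x
  apply hinj
  have h1 : ∀ t : V' ⊗[ℂ] V', f.lTensor ℂ (D'.counit.rTensor V' t) =
      D.counit.rTensor V (TensorProduct.map f f t) := by
    intro t
    induction t using TensorProduct.induction_on with
    | zero => simp
    | tmul x y => simp [hε]
    | add s t hs ht => simp only [map_add, hs, ht]
  have h3 := LinearMap.congr_fun h (f x)
  simp only [LinearMap.comp_apply] at h3 ⊢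
  rw [h1, hΔ, h3]
  rfl

theorem lTensor_counit_of_injective (hf : Function.Injective f)
    (hΔ : ∀ x, TensorProduct.map f f (D'.comul x) = D.comul (f x))
    (hε : ∀ x, D'.counit x = D.counit (f x))
    (h : D.counit.lTensor V ∘ₗ D.comul = (TensorProduct.mk ℂ V ℂ).flip 1) :
    D'.counit.lTensor V' ∘ₗ D'.comul = (TensorProduct.mk ℂ V' ℂ).flip 1 := by
  have hinj : Function.Injective (f.rTensor ℂ) :=
    Module.Flat.rTensor_preserves_injective_linearMap _ hf
  ext x
  apply hinj
  have h1 : ∀ t : V' ⊗[ℂ] V', f.rTensor ℂ (D'.counit.lTensor V' t) =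
      D.counit.lTensor V (TensorProduct.map f f t) := by
    intro t
    induction t using TensorProduct.induction_on with
    | zero => simp
    | tmul x y => simp [hε]
    | add s t hs ht => simp only [map_add, hs, ht]
  have h3 := LinearMap.congr_fun h (f x)
  simp only [LinearMap.comp_apply] at h3 ⊢
  rw [h1, hΔ, h3]
  rfl

end pullback

section restrict

variable {D : HopfOps V} {W : Submodule ℂ V} (hS : D.IsSubHopf W)

theorem subtype_restrict_mul (x y : W) :
    ((D.restrict W hS).mul x y : V) = D.mul x y := rfl

theorem map_subtype_restrict_comul (x : W) :
    TensorProduct.map W.subtype W.subtype ((D.restrict W hS).comul x) = D.comul x := by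
  exact congrArg Subtype.val ((LinearEquiv.ofInjective _ (map_subtype_injective W)).apply_symm_apply
    ((D.comul ∘ₗ W.subtype).codRestrict _ (fun x => hS.comul_mem x x.2) x))

theorem subtype_lift_restrict_mul (t : W ⊗[ℂ] W) :
    W.subtype (TensorProduct.lift (D.restrict W hS).mul t) =
      TensorProduct.lift D.mul (TensorProduct.map W.subtype W.subtype t) := by
  induction t using TensorProduct.induction_on with
  | zero => simp
  | tmul x y => simp [subtype_restrict_mul]
  | add s t hs ht => simp only [map_add, hs, ht]

/-- Every axiom is an equation that becomes the one for `D` under the inclusion of `W` or under its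
tensor square, and both are injective. -/
theorem IsSubHopf.isHopf_restrict (h : D.IsHopf) : (D.restrict W hS).IsHopf where
  mul_assoc x y z := Subtype.ext (h.mul_assoc x y z)
  one_mul x := Subtype.ext (h.one_mul x)
  mul_one x := Subtype.ext (h.mul_one x)
  coassoc := coassoc_of_injective W.injective_subtype (map_subtype_restrict_comul hS) h.coassoc
  rTensor_counit := rTensor_counit_of_injective W.injective_subtype
    (map_subtype_restrict_comul hS) (fun _ => rfl) h.rTensor_counit
  lTensor_counit := lTensor_counit_of_injective W.injective_subtype
    (map_subtype_restrict_comul hS) (fun _ => rfl) h.lTensor_counit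
  counit_one := h.counit_one
  counit_mul x y := h.counit_mul x y
  comul_one := by
    apply map_subtype_injective W
    rw [map_subtype_restrict_comul]
    exact h.comul_one
  comul_mul x y := by
    apply map_subtype_injective W
    have h1 : ∀ s t : W ⊗[ℂ] W, TensorProduct.map W.subtype W.subtype
        (TensorProduct.map₂ (D.restrict W hS).mul (D.restrict W hS).mul s t) =
        TensorProduct.map₂ D.mul D.mul (TensorProduct.map W.subtype W.subtype s)
          (TensorProduct.map W.subtype W.subtype t) := by
      intro s t
      induction s using TensorProduct.induction_on with
      | zero => simp
      | add a b ha hb => simp only [map_add, LinearMap.add_apply, ha, hb]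
      | tmul a b =>
        induction t using TensorProduct.induction_on with
        | zero => simp
        | add c d hc hd => simp only [map_add, hc, hd]
        | tmul c d => simp [TensorProduct.map₂, subtype_restrict_mul]
    rw [h1, map_subtype_restrict_comul, map_subtype_restrict_comul, map_subtype_restrict_comul]
    exact h.comul_mul x y
  exists_antipode := by
    obtain ⟨S, hS1, hS2⟩ := hS.antipode_mem
    refine ⟨(S ∘ₗ W.subtype).codRestrict W fun x => hS2 x x.2, fun x => ?_, fun x => ?_⟩
    · apply W.injective_subtype
      rw [subtype_lift_restrict_mul]
      refine (congrArg _ ?_).trans (hS1.1 x)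
      rw [← map_subtype_restrict_comul hS x]
      generalize (D.restrict W hS).comul x = t
      induction t using TensorProduct.induction_on with
      | zero => simp
      | tmul a b => rfl
      | add s t hs ht => simp only [map_add, hs, ht]
    · apply W.injective_subtype
      rw [subtype_lift_restrict_mul]
      refine (congrArg _ ?_).trans (hS1.2 x)
      rw [← map_subtype_restrict_comul hS x]
      generalize (D.restrict W hS).comul x = t
      induction t using TensorProduct.induction_on with
      | zero => simp
      | tmul a b => rfl
      | add s t hs ht => simp only [map_add, hs, ht]

end restrict

end HopfOps

/-! ### Ranks -/

theorem rank_lt_iff {U : Finset ℕ} {x y : ℕ} (hx : x ∈ U) (hy : y ∈ U) :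
    rank U x < rank U y ↔ x < y := by
  refine ⟨fun h => ?_, rank_lt hy⟩
  by_contra hc
  rcases (not_lt.1 hc).eq_or_lt with rfl | hc
  · exact lt_irrefl _ h
  · exact lt_asymm h (rank_lt hx hc)

/-- An increasing bijection onto `{1, …, m}` is unique: it maps the elements of `U` up to `x` onto
`{1, …, f x}`, and counting gives `f x`. -/
theorem eq_rank {U : Finset ℕ} {f : ℕ → ℕ} {m : ℕ} (hf : ∀ x ∈ U, ∀ y ∈ U, f x < f y ↔ x < y)
    (hmem : ∀ x ∈ U, f x ∈ Icc 1 m) (hsurj : ∀ k ∈ Icc 1 m, ∃ x ∈ U, f x = k) {x : ℕ}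
    (hx : x ∈ U) : f x = rank U x := by
  have h1 : ({y ∈ U | y ≤ x}).image f = Icc 1 (f x) := by
    ext k
    simp only [mem_image, mem_filter, mem_Icc]
    constructor
    · rintro ⟨y, ⟨hy, hyx⟩, rfl⟩
      have := mem_Icc.1 (hmem y hy)
      have := hf x hx y hy
      omega
    · rintro ⟨hk1, hk2⟩
      have := mem_Icc.1 (hmem x hx)
      obtain ⟨y, hy, rfl⟩ := hsurj k (mem_Icc.2 ⟨hk1, by omega⟩)
      have := hf x hx y hy
      exact ⟨y, ⟨hy, by omega⟩, rfl⟩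
  have h2 := congrArg card h1
  rw [card_image_of_injOn, Nat.card_Icc] at h2
  · rw [rank]
    omega
  · intro y hy z hz h
    have hy := (mem_filter.1 hy).1
    have hz := (mem_filter.1 hz).1
    have := hf y hy z hz
    have := hf z hz y hy
    omega

theorem exists_rank_eq {U : Finset ℕ} {k : ℕ} (hk : k ∈ Icc 1 #U) : ∃ x ∈ U, rank U x = k := by
  rw [← image_rank] at hk
  simpa using hk

theorem rank_Icc {a b x : ℕ} (hx : x ∈ Icc a b) : rank (Icc a b) x = x + 1 - a := by
  have : {y ∈ Icc a b | y ≤ x} = Icc a x := by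
    ext y
    simp only [mem_filter, mem_Icc] at hx ⊢
    omega
  rw [rank, this, Nat.card_Icc]

/-! ### Embeddings of diagrams and restriction to a set of vertices -/

namespace BDiagram

/-- The validity fields leave no freedom outside the vertices `1, …, n`, nor for edges that do not
increase, so only the data inside need comparison. -/
theorem ext_of_agree {K L : BDiagram} (hn : K.n = L.n) (hlam : ∀ i ∈ Icc 1 K.n, K.lam i = L.lam i)
    (hup : ∀ i ∈ Icc 1 K.n, ∀ p, (i, p) ∈ K.up ↔ (i, p) ∈ L.up)
    (hdown : ∀ i ∈ Icc 1 K.n, ∀ p, (i, p) ∈ K.down ↔ (i, p) ∈ L.down)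
    (hedges : ∀ i ∈ Icc 1 K.n, ∀ j ∈ Icc 1 K.n, i < j → ∀ p q,
      ((i, p), (j, q)) ∈ K.edges ↔ ((i, p), (j, q)) ∈ L.edges) : K = L := by
  refine BDiagram.ext hn (funext fun i => ?_) ?_ ?_ ?_
  · by_cases hi : i ∈ Icc 1 K.n
    · exact hlam i hi
    · have h1 := (K.lam_pos_iff i).not.2 hi
      have h2 := (L.lam_pos_iff i).not.2 (hn ▸ hi)
      omega
  · ext ⟨i, p⟩
    exact ⟨fun h => (hup i (K.up_vertex h) p).1 h, fun h => (hup i (hn ▸ L.up_vertex h) p).2 h⟩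
  · ext ⟨i, p⟩
    exact ⟨fun h => (hdown i (K.down_vertex h) p).1 h,
      fun h => (hdown i (hn ▸ L.down_vertex h) p).2 h⟩
  · ext ⟨⟨i, p⟩, ⟨j, q⟩⟩
    constructor
    · intro h
      obtain ⟨h1, h2, h3⟩ := K.edges_valid _ h
      exact (hedges i (K.up_vertex h1) j (K.down_vertex h2) h3 p q).1 h
    · intro h
      obtain ⟨h1, h2, h3⟩ := L.edges_valid _ h
      exact (hedges i (hn ▸ L.up_vertex h1) j (hn ▸ L.down_vertex h2) h3 p q).2 h

theorem eq_empty {K : BDiagram} (h : K.n = 0) : K = empty := by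
  refine ext_of_agree h ?_ ?_ ?_ ?_ <;> simp [h]

theorem edge_fst (K : BDiagram) {i p j q : ℕ} (h : ((i, p), (j, q)) ∈ K.edges) : i ∈ Icc 1 K.n :=
  K.up_vertex (K.edges_valid _ h).1

theorem edge_snd (K : BDiagram) {i p j q : ℕ} (h : ((i, p), (j, q)) ∈ K.edges) : j ∈ Icc 1 K.n :=
  K.down_vertex (K.edges_valid _ h).2.1

/-- `f` is an increasing bijection from the set `I` of vertices of `G` onto the vertices of `K`,
and it identifies `K` with the restriction of `G` to `I`. -/
structure Emb (f : ℕ → ℕ) (I : Finset ℕ) (G K : BDiagram) : Prop where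
  lt_iff : ∀ i ∈ I, ∀ j ∈ I, f i < f j ↔ i < j
  mem : ∀ i ∈ I, f i ∈ Icc 1 K.n
  surj : ∀ k ∈ Icc 1 K.n, ∃ i ∈ I, f i = k
  lam : ∀ i ∈ I, K.lam (f i) = G.lam i
  up : ∀ i ∈ I, ∀ p, (f i, p) ∈ K.up ↔ (i, p) ∈ G.up
  down : ∀ i ∈ I, ∀ p, (f i, p) ∈ K.down ↔ (i, p) ∈ G.down
  edges : ∀ i ∈ I, ∀ j ∈ I, ∀ p q,
    ((f i, p), (f j, q)) ∈ K.edges ↔ ((i, p), (j, q)) ∈ G.edges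

theorem emb_sub (G : BDiagram) (I : Finset ℕ) (hI : I ⊆ Icc 1 G.n) :
    Emb (rank I) I G (G.sub I hI) where
  lt_iff _ hi _ hj := rank_lt_iff hi hj
  mem _ hi := rank_mem hi
  surj _ hk := exists_rank_eq hk
  lam _ hi := sub_lam hi
  up i hi p := by
    simp only [sub, mem_image, mem_filter]
    constructor
    · rintro ⟨⟨j, q⟩, ⟨h1, h2⟩, h3⟩
      simp only [Prod.map, id, Prod.mk.injEq] at h3
      obtain rfl := rank_injOn I h2 hi h3.1
      exact h3.2 ▸ h1
    · exact fun h => ⟨_, ⟨h, hi⟩, rfl⟩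
  down i hi p := by
    simp only [sub, mem_image, mem_filter]
    constructor
    · rintro ⟨⟨j, q⟩, ⟨h1, h2⟩, h3⟩
      simp only [Prod.map, id, Prod.mk.injEq] at h3
      obtain rfl := rank_injOn I h2 hi h3.1
      exact h3.2 ▸ h1
    · exact fun h => ⟨_, ⟨h, hi⟩, rfl⟩
  edges i hi j hj p q := by
    simp only [sub, mem_image, mem_filter]
    constructor
    · rintro ⟨⟨⟨i', p'⟩, ⟨j', q'⟩⟩, ⟨h1, h2, h3⟩, h4⟩
      simp only [Prod.map, id, Prod.mk.injEq] at h4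
      obtain rfl := rank_injOn I h2 hi h4.1.1
      obtain rfl := rank_injOn I h3 hj h4.2.1
      obtain rfl := h4.1.2
      obtain rfl := h4.2.2
      exact h1
    · exact fun h => ⟨_, ⟨h, hi, hj⟩, rfl⟩

namespace Emb

variable {f g : ℕ → ℕ} {I J : Finset ℕ} {G K L : BDiagram}

theorem subset (h : Emb f I G K) : I ⊆ Icc 1 G.n := fun i hi => by
  rw [← G.lam_pos_iff, ← h.lam i hi, K.lam_pos_iff]
  exact h.mem i hi

theorem congr (h : Emb f I G K) (hfg : ∀ i ∈ I, f i = g i) : Emb g I G K where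
  lt_iff i hi j hj := by rw [← hfg i hi, ← hfg j hj, h.lt_iff i hi j hj]
  mem i hi := hfg i hi ▸ h.mem i hi
  surj k hk := by
    obtain ⟨i, hi, rfl⟩ := h.surj k hk
    exact ⟨i, hi, (hfg i hi).symm⟩
  lam i hi := hfg i hi ▸ h.lam i hi
  up i hi := hfg i hi ▸ h.up i hi
  down i hi := hfg i hi ▸ h.down i hi
  edges i hi j hj := by
    rw [← hfg i hi, ← hfg j hj]
    exact h.edges i hi j hj

theorem eq_rank (h : Emb f I G K) {i : ℕ} (hi : i ∈ I) : f i = rank I i :=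
  _root_.eq_rank h.lt_iff h.mem h.surj hi

/-- Both maps coincide with the rank on `I`, so all data of `K` and of `L` are read off from `G`
through the same map. This uniqueness replaces all computations with renumberings. -/
theorem unique (h : Emb f I G K) (h' : Emb g I G L) : K = L := by
  have h' := h'.congr (g := f) fun i hi => (h'.eq_rank hi).trans (h.eq_rank hi).symm
  have card_eq : ∀ {K}, Emb f I G K → #I = K.n := fun {K} h => by
    have : I.image f = Icc 1 K.n := by
      ext k
      rw [mem_image]
      exact ⟨fun ⟨i, hi, hk⟩ => hk ▸ h.mem i hi, h.surj k⟩
    rw [← card_image_of_injOn (s := I) (f := f), this, Nat.card_Icc, Nat.add_sub_cancel]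
    intro i hi j hj hij
    have := h.lt_iff i hi j hj
    have := h.lt_iff j hj i hi
    omega
  refine ext_of_agree ((card_eq h).symm.trans (card_eq h')) ?_ ?_ ?_ ?_
  · intro k hk
    obtain ⟨i, hi, rfl⟩ := h.surj k hk
    rw [h.lam i hi, h'.lam i hi]
  · intro k hk
    obtain ⟨i, hi, rfl⟩ := h.surj k hk
    intro p
    rw [h.up i hi, h'.up i hi]
  · intro k hk
    obtain ⟨i, hi, rfl⟩ := h.surj k hk
    intro p
    rw [h.down i hi, h'.down i hi]
  · intro k hk l hl _
    obtain ⟨i, hi, rfl⟩ := h.surj k hk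
    obtain ⟨j, hj, rfl⟩ := h.surj l hl
    intro p q
    rw [h.edges i hi j hj, h'.edges i hi j hj]

theorem comp (h : Emb f I G K) (h' : Emb g J K L) : Emb (g ∘ f) {i ∈ I | f i ∈ J} G L where
  lt_iff i hi j hj := by
    rw [mem_filter] at hi hj
    exact (h'.lt_iff _ hi.2 _ hj.2).trans (h.lt_iff _ hi.1 _ hj.1)
  mem i hi := h'.mem _ (mem_filter.1 hi).2
  surj k hk := by
    obtain ⟨j, hj, rfl⟩ := h'.surj k hk
    obtain ⟨i, hi, rfl⟩ := h.surj j (h'.subset hj)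
    exact ⟨i, mem_filter.2 ⟨hi, hj⟩, rfl⟩
  lam i hi := (h'.lam _ (mem_filter.1 hi).2).trans (h.lam _ (mem_filter.1 hi).1)
  up i hi p := (h'.up _ (mem_filter.1 hi).2 p).trans (h.up _ (mem_filter.1 hi).1 p)
  down i hi p := (h'.down _ (mem_filter.1 hi).2 p).trans (h.down _ (mem_filter.1 hi).1 p)
  edges i hi j hj p q := (h'.edges _ (mem_filter.1 hi).2 _ (mem_filter.1 hj).2 p q).trans
    (h.edges _ (mem_filter.1 hi).1 _ (mem_filter.1 hj).1 p q)

end Emb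

open Classical in
/-- The sub-diagram on `I`, with a default value if `I` is not a set of vertices. -/
def res (G : BDiagram) (I : Finset ℕ) : BDiagram :=
  if h : I ⊆ Icc 1 G.n then G.sub I h else empty

theorem res_eq_sub (G : BDiagram) {I : Finset ℕ} (hI : I ⊆ Icc 1 G.n) : G.res I = G.sub I hI :=
  dif_pos hI

theorem emb_res (G : BDiagram) {I : Finset ℕ} (hI : I ⊆ Icc 1 G.n) :
    Emb (rank I) I G (G.res I) := by
  rw [res_eq_sub G hI]
  exact emb_sub G I hI

/-- The way to compute a restriction: exhibit any embedding, for instance a translation or a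
composite of embeddings. -/
theorem Emb.res_eq {f I G K} (h : Emb f I G K) : G.res I = K := (emb_res G h.subset).unique h

theorem res_n (G : BDiagram) {I : Finset ℕ} (hI : I ⊆ Icc 1 G.n) : (G.res I).n = #I := by
  rw [res_eq_sub G hI]
  rfl

theorem res_self (G : BDiagram) : G.res (Icc 1 G.n) = G := by
  refine Emb.res_eq (f := id) ⟨?_, ?_, ?_, ?_, ?_, ?_, ?_⟩ <;> simp

theorem res_empty (G : BDiagram) : G.res ∅ = empty :=
  eq_empty (res_n G (empty_subset _))

theorem res_res (G : BDiagram) {I J : Finset ℕ} (hI : I ⊆ Icc 1 G.n) (hJ : J ⊆ Icc 1 #I) :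
    (G.res I).res J = G.res {i ∈ I | rank I i ∈ J} :=
  ((emb_res G hI).comp (emb_res _ (by rwa [res_n G hI]))).res_eq.symm

theorem res_res' (G : BDiagram) {I A : Finset ℕ} (hI : I ⊆ Icc 1 G.n) (hA : A ⊆ I) :
    (G.res I).res (A.image (rank I)) = G.res A := by
  rw [res_res G hI]
  · congr 1
    ext i
    simp only [mem_filter, mem_image]
    constructor
    · rintro ⟨h1, j, hj, h2⟩
      exact rank_injOn I (hA hj) h1 h2 ▸ hj
    · exact fun h => ⟨hA h, i, h, rfl⟩
  · rw [← image_rank]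
    exact image_subset_image hA

/-- As `I` is the same on both sides, the renumbering is the same too and can be undone. -/
theorem agree_of_res_eq {K L : BDiagram} {I : Finset ℕ} (hK : I ⊆ Icc 1 K.n) (hL : I ⊆ Icc 1 L.n)
    (h : K.res I = L.res I) : (∀ i ∈ I, K.lam i = L.lam i) ∧
    (∀ i ∈ I, ∀ p, (i, p) ∈ K.up ↔ (i, p) ∈ L.up) ∧
    (∀ i ∈ I, ∀ p, (i, p) ∈ K.down ↔ (i, p) ∈ L.down) ∧
    (∀ i ∈ I, ∀ j ∈ I, ∀ p q, ((i, p), (j, q)) ∈ K.edges ↔ ((i, p), (j, q)) ∈ L.edges) := by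
  have h1 := emb_res K hK
  have h2 := emb_res L hL
  rw [← h] at h2
  exact ⟨fun i hi => (h1.lam i hi).symm.trans (h2.lam i hi),
    fun i hi p => (h1.up i hi p).symm.trans (h2.up i hi p),
    fun i hi p => (h1.down i hi p).symm.trans (h2.down i hi p),
    fun i hi j hj p q => (h1.edges i hi j hj p q).symm.trans (h2.edges i hi j hj p q)⟩

/-! ### The product -/

section comp

variable {G G' : BDiagram} {M : Finset ((ℕ × ℕ) × (ℕ × ℕ))} (hM : M ∈ matchings G G')

theorem mem_comp_up {i p : ℕ} : (i, p) ∈ (G.comp G' M hM).up ↔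
    (i, p) ∈ G.up ∨ (G.n < i ∧ (i - G.n, p) ∈ G'.up) := by
  simp only [comp, mem_union, mem_image, shift]
  refine or_congr_right ⟨?_, fun ⟨h1, h2⟩ => ⟨_, h2, Prod.ext (by simp; omega) rfl⟩⟩
  rintro ⟨⟨j, q⟩, h1, h2⟩
  obtain ⟨rfl, rfl⟩ := Prod.mk.inj h2
  have := mem_Icc.1 (G'.up_vertex h1)
  simp only at this ⊢
  exact ⟨by omega, by simpa using h1⟩

theorem mem_comp_down {i p : ℕ} : (i, p) ∈ (G.comp G' M hM).down ↔
    (i, p) ∈ G.down ∨ (G.n < i ∧ (i - G.n, p) ∈ G'.down) := by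
  simp only [comp, mem_union, mem_image, shift]
  refine or_congr_right ⟨?_, fun ⟨h1, h2⟩ => ⟨_, h2, Prod.ext (by simp; omega) rfl⟩⟩
  rintro ⟨⟨j, q⟩, h1, h2⟩
  obtain ⟨rfl, rfl⟩ := Prod.mk.inj h2
  have := mem_Icc.1 (G'.down_vertex h1)
  simp only at this ⊢
  exact ⟨by omega, by simpa using h1⟩

theorem matching_fst {G G' : BDiagram} {M : Finset ((ℕ × ℕ) × (ℕ × ℕ))}
    (hM : M ∈ matchings G G') {i p j q : ℕ} (h : ((i, p), (j, q)) ∈ M) : i ∈ Icc 1 G.n :=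
  G.up_vertex (mem_sdiff.1 (mem_matchings_free hM h).1).1

theorem matching_snd {G G' : BDiagram} {M : Finset ((ℕ × ℕ) × (ℕ × ℕ))}
    (hM : M ∈ matchings G G') {i p j q : ℕ} (h : ((i, p), (j, q)) ∈ M) : j ∈ Icc 1 G'.n :=
  G'.down_vertex (mem_sdiff.1 (mem_matchings_free hM h).2).1

theorem mem_comp_edges {i p j q : ℕ} : ((i, p), (j, q)) ∈ (G.comp G' M hM).edges ↔
    ((i, p), (j, q)) ∈ G.edges ∨ (G.n < j ∧ ((i, p), (j - G.n, q)) ∈ M) ∨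
      (G.n < i ∧ G.n < j ∧ ((i - G.n, p), (j - G.n, q)) ∈ G'.edges) := by
  simp only [comp, mem_union, mem_image, or_assoc]
  refine or_congr_right (or_congr ?_ ?_)
  · constructor
    · rintro ⟨⟨⟨i', p'⟩, ⟨j', q'⟩⟩, h1, h2⟩
      simp only [Prod.map, shift, id, Prod.mk.injEq] at h2
      obtain ⟨⟨rfl, rfl⟩, rfl, rfl⟩ := h2
      have := mem_Icc.1 (matching_snd hM h1)
      exact ⟨by omega, by simpa using h1⟩
    · rintro ⟨h1, h2⟩
      refine ⟨_, h2, ?_⟩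
      simp only [Prod.map, shift, id, Prod.mk.injEq, and_true, true_and]
      omega
  · constructor
    · rintro ⟨⟨⟨i', p'⟩, ⟨j', q'⟩⟩, h1, h2⟩
      simp only [Prod.map, shift, Prod.mk.injEq] at h2
      obtain ⟨⟨rfl, rfl⟩, rfl, rfl⟩ := h2
      have := mem_Icc.1 (G'.edge_fst h1)
      have := mem_Icc.1 (G'.edge_snd h1)
      exact ⟨by omega, by omega, by simpa using h1⟩
    · rintro ⟨h0, h1, h2⟩
      refine ⟨_, h2, ?_⟩
      simp only [Prod.map, shift, Prod.mk.injEq, and_true]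
      omega

theorem emb_comp_left : Emb id (Icc 1 G.n) (G.comp G' M hM) G where
  lt_iff _ _ _ _ := Iff.rfl
  mem _ hi := hi
  surj k hk := ⟨k, hk, rfl⟩
  lam i hi := (if_pos (mem_Icc.1 hi).2).symm
  up i hi p := by
    rw [mem_comp_up, or_iff_left fun h => ?_, id]
    have := mem_Icc.1 hi
    omega
  down i hi p := by
    rw [mem_comp_down, or_iff_left fun h => ?_, id]
    have := mem_Icc.1 hi
    omega
  edges i hi j hj p q := by
    rw [mem_comp_edges, or_iff_left fun h => ?_, id, id]
    have := mem_Icc.1 hi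
    have := mem_Icc.1 hj
    omega

theorem emb_comp_right :
    Emb (· - G.n) (Icc (G.n + 1) (G.n + G'.n)) (G.comp G' M hM) G' where
  lt_iff i hi j hj := by
    rw [mem_Icc] at hi hj
    omega
  mem i hi := by
    rw [mem_Icc] at *
    omega
  surj k hk := by
    rw [mem_Icc] at hk
    exact ⟨k + G.n, mem_Icc.2 (by omega), by omega⟩
  lam i hi := by
    rw [mem_Icc] at hi
    exact (if_neg (by omega)).symm
  up i hi p := by
    rw [mem_Icc] at hi
    rw [mem_comp_up, or_iff_right fun h => ?_]
    · simp only [iff_and_self]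
      omega
    · have := mem_Icc.1 (G.up_vertex h)
      simp only at this
      omega
  down i hi p := by
    rw [mem_Icc] at hi
    rw [mem_comp_down, or_iff_right fun h => ?_]
    · simp only [iff_and_self]
      omega
    · have := mem_Icc.1 (G.down_vertex h)
      simp only at this
      omega
  edges i hi j hj p q := by
    rw [mem_Icc] at hi hj
    rw [mem_comp_edges, or_iff_right fun h => ?_, or_iff_right fun h => ?_]
    · exact ⟨fun h => ⟨by omega, by omega, h⟩, fun h => h.2.2⟩
    · have := mem_Icc.1 (matching_fst hM h.2)
      omega
    · have := mem_Icc.1 (G.edge_fst h)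
      omega

theorem mem_comp_cross {i p j q : ℕ} (hi : i ≤ G.n) (hj : G.n < j) :
    ((i, p), (j, q)) ∈ (G.comp G' M hM).edges ↔ ((i, p), (j - G.n, q)) ∈ M := by
  rw [mem_comp_edges, or_iff_right fun h => ?_, or_iff_left fun h => ?_]
  · exact and_iff_right hj
  · omega
  · have := mem_Icc.1 (G.edge_snd h)
    omega

end comp

instance : DecidableEq BDiagram := Classical.decEq _

/-- The diagrams that occur in the product of `G` and `G'`. -/
def prodSet (G G' : BDiagram) : Finset BDiagram :=
  (G.matchings G').attach.image fun M => G.comp G' M.1 M.2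

/-- This describes the terms of a product without matchings: the crossing edges of `K` are
necessarily a matching of free half-edges. Most statements about the product are derived from it. -/
theorem mem_prodSet {G G' K : BDiagram} : K ∈ prodSet G G' ↔
    K.n = G.n + G'.n ∧ K.res (Icc 1 G.n) = G ∧ K.res (Icc (G.n + 1) (G.n + G'.n)) = G' := by
  constructor
  · intro h
    obtain ⟨⟨M, hM⟩, -, rfl⟩ := mem_image.1 h
    exact ⟨rfl, (emb_comp_left hM).res_eq, (emb_comp_right hM).res_eq⟩
  · rintro ⟨hn, h1, h2⟩
    have e1 := emb_res K (I := Icc 1 G.n) (Icc_subset_Icc le_rfl (by omega))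
    have e2 := emb_res K (I := Icc (G.n + 1) (G.n + G'.n)) (Icc_subset_Icc (by omega) (by omega))
    rw [h1] at e1
    rw [h2] at e2
    -- On an interval the rank is a translation. Thus `K` is embedded by the same maps as a
    -- composition is in `emb_comp_left` and `emb_comp_right`.
    replace e1 := e1.congr (g := id) fun i hi => by rw [rank_Icc hi]; rfl
    replace e2 := e2.congr (g := (· - G.n)) fun i hi => by rw [rank_Icc hi]; omega
    -- A half-edge occurs in at most one edge of `K`. If it lies on a crossing edge, it lies on no
    -- edge inside a block, so it is free there.
    have hfree : ∀ i p j q, ((i, p), (j + G.n, q)) ∈ K.edges → i ≤ G.n → 1 ≤ j →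
        (i, p) ∈ G.freeUp ∧ (j, q) ∈ G'.freeDown := by
      intro i p j q h hi hj
      have hi1 : i ∈ Icc 1 G.n := mem_Icc.2 ⟨(mem_Icc.1 (K.edge_fst h)).1, hi⟩
      have hj1 : j + G.n ∈ Icc (G.n + 1) (G.n + G'.n) := by
        have := mem_Icc.1 (K.edge_snd h)
        exact mem_Icc.2 (by omega)
      rw [freeUp, freeDown, mem_sdiff, mem_sdiff]
      refine ⟨⟨(e1.up i hi1 p).2 (K.edges_valid _ h).1, fun hc => ?_⟩, ?_, fun hc => ?_⟩
      · obtain ⟨⟨⟨i', p'⟩, ⟨j', q'⟩⟩, h3, h4⟩ := mem_image.1 hc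
        obtain ⟨rfl, rfl⟩ := Prod.mk.inj h4
        have hj' := G.edge_snd h3
        have h5 := K.out_unique _ h _ ((e1.edges i' hi1 j' hj' p' q').1 h3) rfl
        have : j + G.n = j' := congrArg (fun e => e.2.1) h5
        have := mem_Icc.1 hj'
        omega
      · have := (e2.down _ hj1 q).2 (K.edges_valid _ h).2.1
        simpa using this
      · obtain ⟨⟨⟨i', p'⟩, ⟨j', q'⟩⟩, h3, h4⟩ := mem_image.1 hc
        obtain ⟨rfl, rfl⟩ := Prod.mk.inj h4
        obtain ⟨k, hk, rfl⟩ := e2.surj _ (G'.edge_fst h3)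
        have h6 := (e2.edges k hk _ hj1 p' q').1 (by simpa using h3)
        have h5 := K.in_unique _ h _ h6 rfl
        have : i = k := congrArg (fun e => e.1.1) h5
        have := mem_Icc.1 hk
        omega
    -- The matching consists of the edges of `K` from the first block to the second.
    let M : Finset ((ℕ × ℕ) × (ℕ × ℕ)) :=
      {e ∈ G.freeUp ×ˢ G'.freeDown | (e.1, shift G.n e.2) ∈ K.edges}
    have hM : M ∈ matchings G G' := by
      refine mem_filter.2 ⟨mem_powerset.2 (filter_subset _ _), ?_, ?_⟩
      · intro e he f hf h
        have he := (mem_filter.1 he).2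
        have hf := (mem_filter.1 hf).2
        have := K.out_unique _ he _ hf h
        exact Prod.ext h (shift_injective _ (Prod.ext_iff.1 this).2)
      · intro e he f hf h
        have he := (mem_filter.1 he).2
        have hf := (mem_filter.1 hf).2
        have := K.in_unique _ he _ hf (congrArg (shift G.n) h)
        exact Prod.ext (Prod.ext_iff.1 this).1 h
    have mem_M : ∀ i p j q, i ≤ G.n → G.n < j →
        (((i, p), (j - G.n, q)) ∈ M ↔ ((i, p), (j, q)) ∈ K.edges) := by
      intro i p j q hi hj
      have hs : shift G.n (j - G.n, q) = (j, q) := Prod.ext (by simp [shift]; omega) rfl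
      rw [mem_filter, hs, and_iff_right_iff_imp, mem_product]
      intro h
      exact hfree i p (j - G.n) q (by rwa [Nat.sub_add_cancel hj.le]) hi (by omega)
    refine mem_image.2 ⟨⟨M, hM⟩, mem_attach _ _, ?_⟩
    have split : ∀ i ∈ Icc 1 (G.n + G'.n), i ∈ Icc 1 G.n ∨ i ∈ Icc (G.n + 1) (G.n + G'.n) := by
      intro i hi
      rw [mem_Icc] at *
      rw [mem_Icc]
      omega
    have c1 := emb_comp_left hM
    have c2 := emb_comp_right hM
    refine ext_of_agree hn.symm ?_ ?_ ?_ ?_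
    · intro i hi
      rcases split i hi with hi | hi
      · rw [← c1.lam i hi, e1.lam i hi]
      · rw [← c2.lam i hi, e2.lam i hi]
    · intro i hi p
      rcases split i hi with hi | hi
      · rw [← c1.up i hi, e1.up i hi]
      · rw [← c2.up i hi, e2.up i hi]
    · intro i hi p
      rcases split i hi with hi | hi
      · rw [← c1.down i hi, e1.down i hi]
      · rw [← c2.down i hi, e2.down i hi]
    · intro i hi j hj hij p q
      rcases split i hi with hi | hi <;> rcases split j hj with hj | hj
      · rw [← c1.edges i hi j hj, e1.edges i hi j hj]
      · rw [mem_Icc] at hi hj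
        rw [mem_comp_cross hM (by omega) (by omega), mem_M _ _ _ _ (by omega) (by omega)]
      · rw [mem_Icc] at hi hj
        omega
      · rw [← c2.edges i hi j hj, e2.edges i hi j hj]

/-- A matching is recovered from the composition as its set of crossing edges, so the product has no
multiplicities. -/
theorem sum_comp_eq_sum_prodSet {X : Type} [AddCommMonoid X] (G G' : BDiagram)
    (F : BDiagram → X) :
    ∑ M ∈ (G.matchings G').attach, F (G.comp G' M.1 M.2) = ∑ K ∈ prodSet G G', F K := by
  rw [prodSet, sum_image]
  rintro ⟨M, hM⟩ - ⟨N, hN⟩ - h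
  simp only at h
  have key : ∀ M N hM hN, G.comp G' M hM = G.comp G' N hN → M ⊆ N := by
    rintro M N hM hN h ⟨⟨i, p⟩, ⟨j, q⟩⟩ he
    have hi := mem_Icc.1 (matching_fst hM he)
    have hj := mem_Icc.1 (matching_snd hM he)
    have h1 := (mem_comp_cross hM (i := i) (j := j + G.n) (p := p) (q := q) hi.2 (by omega)).2
      (by simpa using he)
    rw [h, mem_comp_cross hN hi.2 (by omega)] at h1
    simpa using h1
  exact Subtype.ext (subset_antisymm (key M N hM hN h) (key N M hN hM h.symm))

end BDiagram

theorem hopfB_mul_single (G G' : BDiagram) :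
    hopfB.mul (Finsupp.single G 1) (Finsupp.single G' 1) =
      ∑ K ∈ BDiagram.prodSet G G', (Finsupp.single K 1 : BSpace) := by
  rw [← BDiagram.sum_comp_eq_sum_prodSet]
  simp [hopfB]

namespace BDiagram

theorem res_Icc_res_Icc (L : BDiagram) {a b c d e f : ℕ} (ha : 1 ≤ a) (hb : b ≤ L.n)
    (hc : 1 ≤ c) (hd : a + d ≤ b + 1) (he : e + 1 = a + c) (hf : f + 1 = a + d) :
    (L.res (Icc a b)).res (Icc c d) = L.res (Icc e f) := by
  rw [res_res L (Icc_subset_Icc ha hb)]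
  · congr 1
    ext i
    rw [mem_filter]
    constructor
    · rintro ⟨h1, h2⟩
      rw [rank_Icc h1] at h2
      rw [mem_Icc] at *
      omega
    · intro h
      have h1 : i ∈ Icc a b := by
        rw [mem_Icc] at *
        omega
      rw [rank_Icc h1]
      simp only [mem_Icc] at *
      omega
  · rw [Nat.card_Icc]
    exact Icc_subset_Icc hc (by omega)

theorem res_Icc_n (L : BDiagram) {a b k : ℕ} (ha : 1 ≤ a) (hb : b ≤ L.n) (hk : k + a = b + 1) :
    (L.res (Icc a b)).n = k := by
  rw [res_n L (Icc_subset_Icc ha hb), Nat.card_Icc]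
  omega

/-- The right side does not depend on the bracketing, and `mem_biUnion_prodSet_right` reaches the
same condition; this is the content of associativity. -/
theorem mem_biUnion_prodSet_left {G G' G'' L : BDiagram} :
    L ∈ (prodSet G G').biUnion (prodSet · G'') ↔ L.n = G.n + G'.n + G''.n ∧
      L.res (Icc 1 G.n) = G ∧ L.res (Icc (G.n + 1) (G.n + G'.n)) = G' ∧
      L.res (Icc (G.n + G'.n + 1) (G.n + G'.n + G''.n)) = G'' := by
  simp only [mem_biUnion, mem_prodSet]
  constructor
  · rintro ⟨K, ⟨h1, h2, h3⟩, h4, h5, h6⟩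
    rw [h1] at h4 h5 h6
    refine ⟨h4, (Eq.symm ?_).trans h2, (Eq.symm ?_).trans h3, h6⟩
    · rw [← h5]
      exact res_Icc_res_Icc L le_rfl (by omega) le_rfl (by omega) rfl (by omega)
    · rw [← h5]
      exact res_Icc_res_Icc L le_rfl (by omega) (by omega) (by omega) (by omega) (by omega)
  · rintro ⟨h1, h2, h3, h4⟩
    have hn := res_Icc_n L (a := 1) (b := G.n + G'.n) le_rfl (by omega) rfl
    refine ⟨L.res (Icc 1 (G.n + G'.n)), ⟨hn, ?_, ?_⟩, by rw [hn, h1], by rw [hn], by rw [hn, h4]⟩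
    · exact (res_Icc_res_Icc L le_rfl (by omega) le_rfl (by omega) rfl (by omega)).trans h2
    · exact (res_Icc_res_Icc L le_rfl (by omega) (by omega) (by omega) (by omega) (by omega)).trans h3

theorem mem_biUnion_prodSet_right {G G' G'' L : BDiagram} :
    L ∈ (prodSet G' G'').biUnion (prodSet G) ↔ L.n = G.n + G'.n + G''.n ∧
      L.res (Icc 1 G.n) = G ∧ L.res (Icc (G.n + 1) (G.n + G'.n)) = G' ∧
      L.res (Icc (G.n + G'.n + 1) (G.n + G'.n + G''.n)) = G'' := by
  simp only [mem_biUnion, mem_prodSet]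
  constructor
  · rintro ⟨K, ⟨h1, h2, h3⟩, h4, h5, h6⟩
    rw [h1] at h4 h6
    refine ⟨by omega, h5, (Eq.symm ?_).trans h2, (Eq.symm ?_).trans h3⟩
    · rw [← h6]
      exact res_Icc_res_Icc L (by omega) (by omega) le_rfl (by omega) (by omega) (by omega)
    · rw [← h6]
      exact res_Icc_res_Icc L (by omega) (by omega) (by omega) (by omega) (by omega) (by omega)
  · rintro ⟨h1, h2, h3, h4⟩
    have hn := res_Icc_n L (a := G.n + 1) (b := G.n + (G'.n + G''.n)) (k := G'.n + G''.n)
      (by omega) (by omega) (by omega)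
    refine ⟨L.res (Icc (G.n + 1) (G.n + (G'.n + G''.n))), ⟨hn, ?_, ?_⟩, by omega, h2, by rw [hn]⟩
    · exact (res_Icc_res_Icc L (by omega) (by omega) le_rfl (by omega) (by omega) (by omega)).trans h3
    · exact (res_Icc_res_Icc L (by omega) (by omega) (by omega) (by omega) (by omega) (by omega)).trans h4

/-- The inner sums run over disjoint sets because the intermediate diagram `K` is a restriction of
`L`; hence both double sums run over one set of diagrams, each counted once. -/
theorem sum_prodSet_assoc {X : Type} [AddCommMonoid X] (G G' G'' : BDiagram)
    (F : BDiagram → X) : ∑ K ∈ prodSet G G', ∑ L ∈ prodSet K G'', F L =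
      ∑ K ∈ prodSet G' G'', ∑ L ∈ prodSet G K, F L := by
  rw [← sum_biUnion, ← sum_biUnion]
  · refine sum_congr ?_ fun _ _ => rfl
    ext L
    rw [mem_biUnion_prodSet_left, ← mem_biUnion_prodSet_right]
  · intro K hK K' hK' hne
    refine disjoint_left.2 fun L hL hL' => hne ?_
    rw [mem_coe, mem_prodSet] at hK hK'
    rw [mem_prodSet] at hL hL'
    rw [← hL.2.2, ← hL'.2.2, hK.1, hK'.1]
  · intro K hK K' hK' hne
    refine disjoint_left.2 fun L hL hL' => hne ?_
    rw [mem_coe, mem_prodSet] at hK hK'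
    rw [mem_prodSet] at hL hL'
    rw [← hL.2.1, ← hL'.2.1, hK.1, hK'.1]

theorem prodSet_empty_left (G : BDiagram) : prodSet empty G = {G} := by
  ext K
  rw [mem_prodSet, mem_singleton]
  have h0 : empty.n = 0 := rfl
  simp only [h0, zero_add]
  constructor
  · rintro ⟨h1, -, h2⟩
    rw [← h2, ← h1, res_self]
  · rintro rfl
    exact ⟨rfl, res_empty K, res_self K⟩

theorem prodSet_empty_right (G : BDiagram) : prodSet G empty = {G} := by
  ext K
  rw [mem_prodSet, mem_singleton]
  have h0 : empty.n = 0 := rfl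
  simp only [h0, add_zero]
  constructor
  · rintro ⟨h1, h2, -⟩
    rw [← h2, ← h1, res_self]
  · rintro rfl
    refine ⟨rfl, res_self K, ?_⟩
    rw [Icc_eq_empty (by omega), res_empty]

theorem emb_left {G G' K : BDiagram} (h : K ∈ prodSet G G') : Emb id (Icc 1 G.n) K G := by
  obtain ⟨⟨M, hM⟩, -, rfl⟩ := mem_image.1 h
  exact emb_comp_left hM

theorem emb_right {G G' K : BDiagram} (h : K ∈ prodSet G G') :
    Emb (· - G.n) (Icc (G.n + 1) (G.n + G'.n)) K G' := by
  obtain ⟨⟨M, hM⟩, -, rfl⟩ := mem_image.1 h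
  exact emb_comp_right hM

theorem prodSet_n {G G' K : BDiagram} (h : K ∈ prodSet G G') : K.n = G.n + G'.n :=
  (mem_prodSet.1 h).1

/-- Inside each block both diagrams agree with the same factor, so only crossing edges can
distinguish them. -/
theorem prodSet_ext {G G' K L : BDiagram} (hK : K ∈ prodSet G G') (hL : L ∈ prodSet G G')
    (h : ∀ i ∈ Icc 1 G.n, ∀ j ∈ Icc 1 G'.n, ∀ p q,
      ((i, p), (j + G.n, q)) ∈ K.edges ↔ ((i, p), (j + G.n, q)) ∈ L.edges) : K = L := by
  have c1 := emb_left hK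
  have c2 := emb_right hK
  have e1 := emb_left hL
  have e2 := emb_right hL
  have split : ∀ i ∈ Icc 1 K.n, i ∈ Icc 1 G.n ∨ i ∈ Icc (G.n + 1) (G.n + G'.n) := by
    intro i hi
    rw [prodSet_n hK] at hi
    rw [mem_Icc] at *
    rw [mem_Icc]
    omega
  refine ext_of_agree ((prodSet_n hK).trans (prodSet_n hL).symm) ?_ ?_ ?_ ?_
  · intro i hi
    rcases split i hi with hi | hi
    · exact (c1.lam i hi).symm.trans (e1.lam i hi)
    · exact (c2.lam i hi).symm.trans (e2.lam i hi)
  · intro i hi p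
    rcases split i hi with hi | hi
    · exact (c1.up i hi p).symm.trans (e1.up i hi p)
    · exact (c2.up i hi p).symm.trans (e2.up i hi p)
  · intro i hi p
    rcases split i hi with hi | hi
    · exact (c1.down i hi p).symm.trans (e1.down i hi p)
    · exact (c2.down i hi p).symm.trans (e2.down i hi p)
  · intro i hi j hj hij p q
    rcases split i hi with hi | hi <;> rcases split j hj with hj | hj
    · exact (c1.edges i hi j hj p q).symm.trans (e1.edges i hi j hj p q)
    · rw [mem_Icc] at hj
      have := h i hi (j - G.n) (mem_Icc.2 (by omega)) p q
      rwa [Nat.sub_add_cancel (by omega)] at this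
    · rw [mem_Icc] at hi hj
      omega
    · exact (c2.edges i hi j hj p q).symm.trans (e2.edges i hi j hj p q)

/-! ### The coproduct -/

theorem mem_iso {G : BDiagram} {I : Finset ℕ} : I ∈ G.iso ↔ I ⊆ Icc 1 G.n ∧
    ∀ i p j q, ((i, p), (j, q)) ∈ G.edges → (i ∈ I ↔ j ∈ I) := by
  rw [iso, mem_filter, mem_powerset]
  exact and_congr_right fun _ => ⟨fun h i p j q he => h _ he, fun h e he => h _ _ _ _ he⟩

theorem empty_mem_iso (G : BDiagram) : ∅ ∈ G.iso := mem_iso.2 (by simp)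

theorem compl_mem_iso {G : BDiagram} {I : Finset ℕ} (hI : I ∈ G.iso) : Icc 1 G.n \ I ∈ G.iso := by
  rw [mem_iso] at *
  refine ⟨sdiff_subset, fun i p j q he => ?_⟩
  rw [mem_sdiff, mem_sdiff, hI.2 i p j q he, and_iff_right (G.edge_fst he),
    and_iff_right (G.edge_snd he)]

theorem sdiff_mem_iso {G : BDiagram} {I J : Finset ℕ} (hI : I ∈ G.iso) (hJ : J ∈ G.iso) :
    I \ J ∈ G.iso := by
  rw [mem_iso] at *
  refine ⟨sdiff_subset.trans hI.1, fun i p j q he => ?_⟩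
  rw [mem_sdiff, mem_sdiff, hI.2 i p j q he, hJ.2 i p j q he]

theorem union_mem_iso {G : BDiagram} {I J : Finset ℕ} (hI : I ∈ G.iso) (hJ : J ∈ G.iso) :
    I ∪ J ∈ G.iso := by
  rw [mem_iso] at *
  refine ⟨union_subset hI.1 hJ.1, fun i p j q he => ?_⟩
  rw [mem_union, mem_union, hI.2 i p j q he, hJ.2 i p j q he]

/-- Since no edge leaves `I`, restricting to `I` loses no edge at a vertex of `A`. Thus iterating
the coproduct only involves isolated sets of the original diagram. -/
theorem image_rank_mem_iso {G : BDiagram} {I A : Finset ℕ} (hI : I ∈ G.iso) (hAI : A ⊆ I) :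
    A.image (rank I) ∈ (G.res I).iso ↔ A ∈ G.iso := by
  have hI' := iso_subset hI
  have e := emb_res G hI'
  simp only [mem_iso] at *
  have mem : ∀ i ∈ I, (rank I i ∈ A.image (rank I) ↔ i ∈ A) := by
    intro i hi
    rw [mem_image]
    exact ⟨fun ⟨j, hj, h⟩ => rank_injOn I (hAI hj) hi h ▸ hj, fun h => ⟨i, h, rfl⟩⟩
  constructor
  · rintro ⟨-, h⟩
    refine ⟨hAI.trans hI', fun i p j q he => ?_⟩
    by_cases hi : i ∈ I
    · have hj := (hI.2 i p j q he).1 hi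
      rw [← mem i hi, ← mem j hj]
      exact h _ _ _ _ ((e.edges i hi j hj p q).2 he)
    · have hj := (hI.2 i p j q he).not.1 hi
      exact iff_of_false (fun h => hi (hAI h)) (fun h => hj (hAI h))
  · rintro ⟨-, h⟩
    constructor
    · rw [res_n G hI', ← image_rank]
      exact image_subset_image hAI
    · intro k p l q he
      obtain ⟨i, hi, rfl⟩ := e.surj k (edge_fst _ he)
      obtain ⟨j, hj, rfl⟩ := e.surj l (edge_snd _ he)
      rw [mem i hi, mem j hj]
      exact h _ _ _ _ ((e.edges i hi j hj p q).1 he)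

theorem sdiff_image_rank {I A : Finset ℕ} (hA : A ⊆ I) :
    Icc 1 #I \ A.image (rank I) = (I \ A).image (rank I) := by
  rw [← image_rank]
  ext k
  simp only [mem_sdiff, mem_image]
  constructor
  · rintro ⟨⟨i, hi, rfl⟩, h⟩
    exact ⟨i, ⟨hi, fun hA => h ⟨i, hA, rfl⟩⟩, rfl⟩
  · rintro ⟨i, ⟨hi, hiA⟩, rfl⟩
    refine ⟨⟨i, hi, rfl⟩, ?_⟩
    rintro ⟨j, hj, h⟩
    exact hiA (rank_injOn I (hA hj) hi h ▸ hj)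

theorem sum_iso_res {X : Type} [AddCommMonoid X] {G : BDiagram} {I : Finset ℕ} (hI : I ∈ G.iso)
    (F : BDiagram → BDiagram → X) :
    ∑ J ∈ (G.res I).iso, F ((G.res I).res J) ((G.res I).res (Icc 1 (G.res I).n \ J)) =
      ∑ A ∈ G.iso with A ⊆ I, F (G.res A) (G.res (I \ A)) := by
  have hI' := iso_subset hI
  symm
  refine sum_bij (fun A _ => A.image (rank I)) ?_ ?_ ?_ ?_
  · intro A hA
    rw [mem_filter] at hA
    exact (image_rank_mem_iso hI hA.2).2 hA.1
  · intro A hA B hB h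
    rw [mem_filter] at hA hB
    exact image_injOn_powerset_of_injOn (rank_injOn I) (mem_coe.2 (mem_powerset.2 hA.2))
      (mem_coe.2 (mem_powerset.2 hB.2)) h
  · intro J hJ
    have hJ' := iso_subset hJ
    rw [res_n G hI'] at hJ'
    have : ({i ∈ I | rank I i ∈ J}).image (rank I) = J := by
      ext k
      simp only [mem_image, mem_filter]
      constructor
      · rintro ⟨i, ⟨-, h⟩, rfl⟩
        exact h
      · intro hk
        obtain ⟨i, hi, rfl⟩ := exists_rank_eq (hJ' hk)
        exact ⟨i, ⟨hi, hk⟩, rfl⟩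
    refine ⟨{i ∈ I | rank I i ∈ J}, mem_filter.2 ⟨?_, filter_subset _ _⟩, this⟩
    rw [← image_rank_mem_iso hI (filter_subset _ _), this]
    exact hJ
  · intro A hA
    rw [mem_filter] at hA
    rw [res_n G hI', sdiff_image_rank hA.2, res_res' G hI' hA.2, res_res' G hI' sdiff_subset]

/-- Both sides run over the ordered decompositions of the vertices into three isolated sets. For a
fixed first part `A`, the set `I` on the left corresponds to the second part `I \ A`. -/
theorem sum_iso_coassoc {X : Type} [AddCommMonoid X] (G : BDiagram)
    (F : Finset ℕ → Finset ℕ → Finset ℕ → X) :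
    ∑ I ∈ G.iso, ∑ A ∈ G.iso with A ⊆ I, F A (I \ A) (Icc 1 G.n \ I) =
      ∑ I ∈ G.iso, ∑ A ∈ G.iso with A ⊆ Icc 1 G.n \ I, F I A ((Icc 1 G.n \ I) \ A) := by
  rw [sum_comm' (t' := G.iso) (s' := fun A => {I ∈ G.iso | A ⊆ I})]
  · refine sum_congr rfl fun A hA => ?_
    have hA' := iso_subset hA
    refine sum_bij (fun I _ => I \ A) ?_ ?_ ?_ ?_
    · intro I hI
      rw [mem_filter] at *
      exact ⟨sdiff_mem_iso hI.1 hA, sdiff_subset_sdiff (iso_subset hI.1) le_rfl⟩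
    · intro I hI J hJ h
      rw [mem_filter] at hI hJ
      rw [← sdiff_union_of_subset hI.2, h, sdiff_union_of_subset hJ.2]
    · intro B hB
      rw [mem_filter] at hB
      refine ⟨B ∪ A, mem_filter.2 ⟨union_mem_iso hB.1 hA, subset_union_right⟩, ?_⟩
      rw [union_sdiff_right, Finset.sdiff_eq_self_iff_disjoint]
      exact disjoint_of_subset_left hB.2 sdiff_disjoint
    · intro I hI
      rw [mem_filter] at hI
      congr 1
      rw [sdiff_sdiff_left, sup_eq_union, union_sdiff_of_subset hI.2]
  · intro I A
    simp only [mem_filter]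
    tauto

/-! ### Compatibility of the product and the coproduct -/

/-- The elements of `I` up to `n`. -/
def low (n : ℕ) (I : Finset ℕ) : Finset ℕ := {i ∈ I | i ≤ n}

/-- The elements of `I` beyond `n`, shifted. -/
def high (n m : ℕ) (I : Finset ℕ) : Finset ℕ := {j ∈ Icc 1 m | j + n ∈ I}

theorem mem_low {n i : ℕ} {I : Finset ℕ} : i ∈ low n I ↔ i ∈ I ∧ i ≤ n := mem_filter

theorem mem_high {n m j : ℕ} {I : Finset ℕ} : j ∈ high n m I ↔ j ∈ Icc 1 m ∧ j + n ∈ I :=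
  mem_filter

theorem low_subset {n m : ℕ} {I : Finset ℕ} (hI : I ⊆ Icc 1 (n + m)) : low n I ⊆ Icc 1 n := by
  intro i hi
  rw [low, mem_filter] at hi
  have := mem_Icc.1 (hI hi.1)
  exact mem_Icc.2 (by omega)

theorem high_subset (n m : ℕ) (I : Finset ℕ) : high n m I ⊆ Icc 1 m := filter_subset _ _

theorem rank_of_le {n : ℕ} {I : Finset ℕ} {i : ℕ} (hi : i ≤ n) : rank I i = rank (low n I) i := by
  rw [rank, rank, low, filter_filter]
  congr 1
  ext y
  simp only [mem_filter]
  exact and_congr_right fun _ => by omega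

theorem rank_add {n m : ℕ} {I : Finset ℕ} (hI : I ⊆ Icc 1 (n + m)) {j : ℕ} (hj : 1 ≤ j) :
    rank I (j + n) = #(low n I) + rank (high n m I) j := by
  rw [rank, rank, ← card_image_of_injective {y ∈ high n m I | y ≤ j} (add_left_injective n),
    ← card_union_of_disjoint]
  · congr 1
    ext y
    simp only [low, high, mem_union, mem_filter, mem_image, mem_Icc]
    constructor
    · rintro ⟨h1, h2⟩
      have := mem_Icc.1 (hI h1)
      by_cases hy : y ≤ n
      · exact Or.inl ⟨h1, hy⟩
      · refine Or.inr ⟨y - n, ⟨⟨by omega, ?_⟩, by omega⟩, by omega⟩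
        rwa [Nat.sub_add_cancel (by omega)]
    · rintro (⟨h1, h2⟩ | ⟨z, ⟨⟨h1, h2⟩, h3⟩, rfl⟩)
      · exact ⟨h1, by omega⟩
      · exact ⟨h2, by omega⟩
  · rw [disjoint_left]
    intro y hy hy'
    simp only [low, high, mem_filter, mem_image, mem_Icc] at hy hy'
    obtain ⟨z, hz, rfl⟩ := hy'
    omega

theorem rank_le_card {U : Finset ℕ} {x : ℕ} : rank U x ≤ #U := card_filter_le _ _

theorem card_low_add_card_high {n m : ℕ} {I : Finset ℕ} (hI : I ⊆ Icc 1 (n + m)) :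
    #I = #(low n I) + #(high n m I) := by
  have h1 : rank I ((m + 1) + n) = #I := by
    rw [rank, filter_true_of_mem]
    intro y hy
    have := mem_Icc.1 (hI hy)
    omega
  have h2 : rank (high n m I) (m + 1) = #(high n m I) := by
    rw [rank, filter_true_of_mem]
    intro y hy
    have := mem_Icc.1 (high_subset _ _ _ hy)
    omega
  rw [← h1, rank_add hI (by omega), h2]

theorem low_compl {n m : ℕ} {I : Finset ℕ} : low n (Icc 1 (n + m) \ I) = Icc 1 n \ low n I := by
  ext i
  simp only [low, mem_filter, mem_sdiff, mem_Icc, not_and]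
  constructor
  · exact fun h => ⟨by omega, fun h' => absurd h' h.1.2⟩
  · exact fun h => ⟨⟨by omega, fun h' => h.2 h' h.1.2⟩, h.1.2⟩

theorem high_compl {n m : ℕ} {I : Finset ℕ} :
    high n m (Icc 1 (n + m) \ I) = Icc 1 m \ high n m I := by
  ext i
  simp only [high, mem_filter, mem_sdiff, mem_Icc, not_and]
  constructor
  · exact fun h => ⟨h.1, fun _ => h.2.2⟩
  · exact fun h => ⟨h.1, by omega, h.2 h.1⟩

/-- Restriction commutes with cutting into two blocks, because the renumbering of `I` puts its lower
part before its upper part. -/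
theorem res_mem_prodSet {G G' K : BDiagram} (hK : K ∈ prodSet G G') {I : Finset ℕ}
    (hI : I ⊆ Icc 1 K.n) :
    K.res I ∈ prodSet (G.res (low G.n I)) (G'.res (high G.n G'.n I)) := by
  have hI' := hI
  rw [prodSet_n hK] at hI'
  have hl := low_subset hI'
  have hh := high_subset G.n G'.n I
  have hc := card_low_add_card_high hI'
  rw [mem_prodSet, res_n K hI, res_n G hl, res_n G' hh]
  -- After renumbering, the border between the blocks lies at the number of lower elements.
  have h1 : ∀ i ∈ I, rank I i ≤ #(low G.n I) ↔ i ≤ G.n := by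
    intro i hi
    have hi1 := mem_Icc.1 (hI' hi)
    by_cases h : i ≤ G.n
    · exact iff_of_true (rank_of_le (I := I) h ▸ rank_le_card) h
    · refine iff_of_false ?_ h
      have h2 : i - G.n ∈ high G.n G'.n I := by
        rw [high, mem_filter, mem_Icc, Nat.sub_add_cancel (by omega)]
        exact ⟨by omega, hi⟩
      have h3 := rank_add hI' (j := i - G.n) (by omega)
      rw [Nat.sub_add_cancel (by omega)] at h3
      have h4 : 1 ≤ rank (high G.n G'.n I) (i - G.n) := (mem_Icc.1 (rank_mem h2)).1
      omega
  refine ⟨hc, ?_, ?_⟩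
  · rw [res_res K hI (Icc_subset_Icc le_rfl (by omega))]
    have h2 := ((emb_left hK).comp (emb_res G hl)).res_eq
    rw [← h2]
    congr 1
    ext i
    simp only [mem_filter, mem_Icc, mem_low, id]
    constructor
    · rintro ⟨h3, h4, h5⟩
      have := mem_Icc.1 (hI' h3)
      have h6 := (h1 i h3).1 h5
      exact ⟨by omega, h3, h6⟩
    · rintro ⟨h3, h4, h5⟩
      exact ⟨h4, (mem_Icc.1 (rank_mem h4)).1, (h1 i h4).2 h5⟩
  · rw [res_res K hI (Icc_subset_Icc (by omega) (by omega))]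
    have h2 := ((emb_right hK).comp (emb_res G' hh)).res_eq
    rw [← h2]
    congr 1
    ext i
    simp only [mem_filter, mem_Icc, mem_high]
    constructor
    · rintro ⟨h3, h4, h5⟩
      have := mem_Icc.1 (hI' h3)
      have h6 := (h1 i h3).not.1 (by omega)
      exact ⟨by omega, by omega, by rwa [Nat.sub_add_cancel (by omega)]⟩
    · rintro ⟨h3, h4, h5⟩
      rw [Nat.sub_add_cancel (by omega)] at h5
      have := (h1 i h5).not.2 (by omega)
      have := mem_Icc.1 (rank_mem h5)
      exact ⟨h5, by omega, by omega⟩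

theorem low_mem_iso {G G' K : BDiagram} (hK : K ∈ prodSet G G') {I : Finset ℕ}
    (hI : I ∈ K.iso) : low G.n I ∈ G.iso := by
  rw [mem_iso] at *
  have hn := prodSet_n hK
  refine ⟨low_subset (hn ▸ hI.1), fun i p j q he => ?_⟩
  have hi := G.edge_fst he
  have hj := G.edge_snd he
  have := hI.2 i p j q (((emb_left hK).edges i hi j hj p q).1 he)
  rw [low, mem_filter, mem_filter, this, and_iff_left (mem_Icc.1 hi).2,
    and_iff_left (mem_Icc.1 hj).2]

theorem high_mem_iso {G G' K : BDiagram} (hK : K ∈ prodSet G G') {I : Finset ℕ}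
    (hI : I ∈ K.iso) : high G.n G'.n I ∈ G'.iso := by
  rw [mem_iso] at *
  have hn := prodSet_n hK
  refine ⟨high_subset _ _ _, fun i p j q he => ?_⟩
  have hi := G'.edge_fst he
  have hj := G'.edge_snd he
  rw [high, mem_filter, mem_filter, and_iff_right hi, and_iff_right hj]
  rw [mem_Icc] at hi hj
  refine hI.2 _ p _ q (((emb_right hK).edges (i + G.n) (mem_Icc.2 (by omega)) (j + G.n)
    (mem_Icc.2 (by omega)) p q).1 ?_)
  simpa using he

/-- Isolation is essential: restriction to an arbitrary set would free the half-edges of the edges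
that leave it. -/
theorem freeUp_res {G : BDiagram} {A : Finset ℕ} (hA : A ∈ G.iso) {i p : ℕ} (hi : i ∈ A) :
    (rank A i, p) ∈ (G.res A).freeUp ↔ (i, p) ∈ G.freeUp := by
  have e := emb_res G (iso_subset hA)
  rw [freeUp, freeUp, mem_sdiff, mem_sdiff, e.up i hi, mem_image, mem_image]
  refine and_congr_right fun _ => not_congr ⟨?_, ?_⟩
  · rintro ⟨⟨⟨k, p'⟩, ⟨l, q⟩⟩, h1, h2⟩
    obtain ⟨rfl, rfl⟩ := Prod.mk.inj h2
    obtain ⟨j, hj, rfl⟩ := e.surj l (edge_snd _ h1)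
    exact ⟨_, (e.edges i hi j hj _ _).1 h1, rfl⟩
  · rintro ⟨⟨⟨k, p'⟩, ⟨j, q⟩⟩, h1, h2⟩
    obtain ⟨rfl, rfl⟩ := Prod.mk.inj h2
    have hj := ((mem_iso.1 hA).2 _ _ _ _ h1).1 hi
    exact ⟨_, (e.edges _ hi j hj _ _).2 h1, rfl⟩

theorem freeDown_res {G : BDiagram} {A : Finset ℕ} (hA : A ∈ G.iso) {i p : ℕ} (hi : i ∈ A) :
    (rank A i, p) ∈ (G.res A).freeDown ↔ (i, p) ∈ G.freeDown := by
  have e := emb_res G (iso_subset hA)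
  rw [freeDown, freeDown, mem_sdiff, mem_sdiff, e.down i hi, mem_image, mem_image]
  refine and_congr_right fun _ => not_congr ⟨?_, ?_⟩
  · rintro ⟨⟨⟨l, q⟩, ⟨k, p'⟩⟩, h1, h2⟩
    obtain ⟨rfl, rfl⟩ := Prod.mk.inj h2
    obtain ⟨j, hj, rfl⟩ := e.surj l (edge_fst _ h1)
    exact ⟨_, (e.edges j hj i hi _ _).1 h1, rfl⟩
  · rintro ⟨⟨⟨j, q⟩, ⟨k, p'⟩⟩, h1, h2⟩
    obtain ⟨rfl, rfl⟩ := Prod.mk.inj h2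
    have hj := ((mem_iso.1 hA).2 _ _ _ _ h1).2 hi
    exact ⟨_, (e.edges j hj _ hi _ _).2 h1, rfl⟩

/-- The pairs of half-edges at the vertices in `A` and `A'` that become pairs of `N` when these
vertices are renumbered. -/
def unrank (A A' : Finset ℕ) (N : Finset ((ℕ × ℕ) × (ℕ × ℕ))) (e : (ℕ × ℕ) × (ℕ × ℕ)) : Prop :=
  e.1.1 ∈ A ∧ e.2.1 ∈ A' ∧ ((rank A e.1.1, e.1.2), (rank A' e.2.1, e.2.2)) ∈ N

theorem unrank_free {G G' : BDiagram} {A A' : Finset ℕ} (hA : A ∈ G.iso) (hA' : A' ∈ G'.iso)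
    {N} (hN : N ∈ matchings (G.res A) (G'.res A')) {e} (he : unrank A A' N e) :
    e ∈ G.freeUp ×ˢ G'.freeDown := by
  obtain ⟨h1, h2, h3⟩ := he
  obtain ⟨h4, h5⟩ := mem_matchings_free hN h3
  exact mem_product.2 ⟨(freeUp_res hA h1).1 h4, (freeDown_res hA' h2).1 h5⟩

theorem unrank_fst {G G' : BDiagram} {A A' : Finset ℕ}
    {N} (hN : N ∈ matchings (G.res A) (G'.res A')) {e f} (he : unrank A A' N e)
    (hf : unrank A A' N f) (h : e.1 = f.1) : e = f := by
  obtain ⟨h1, h2, h3⟩ := he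
  obtain ⟨h4, h5, h6⟩ := hf
  have := (mem_filter.1 hN).2.1 h3 h6 (by simp [h])
  simp only [Prod.mk.injEq] at this
  exact Prod.ext h (Prod.ext (rank_injOn _ h2 h5 this.2.1) this.2.2)

theorem unrank_snd {G G' : BDiagram} {A A' : Finset ℕ}
    {N} (hN : N ∈ matchings (G.res A) (G'.res A')) {e f} (he : unrank A A' N e)
    (hf : unrank A A' N f) (h : e.2 = f.2) : e = f := by
  obtain ⟨h1, h2, h3⟩ := he
  obtain ⟨h4, h5, h6⟩ := hf
  have := (mem_filter.1 hN).2.2 h3 h6 (by simp [h])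
  simp only [Prod.mk.injEq] at this
  exact Prod.ext (Prod.ext (rank_injOn _ h1 h4 this.1.1) this.1.2) h

/-- Both sides are compositions of the same two restrictions, so by `prodSet_ext` the crossing edges
decide. -/
theorem res_eq_of_unrank {G G' K : BDiagram} (hK : K ∈ prodSet G G') {I : Finset ℕ}
    (hI : I ⊆ Icc 1 K.n)
    {N} (hN : N ∈ matchings (G.res (low G.n I)) (G'.res (high G.n G'.n I)))
    (h : ∀ i ∈ low G.n I, ∀ j ∈ high G.n G'.n I, ∀ p q, ((i, p), (j + G.n, q)) ∈ K.edges ↔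
      ((rank (low G.n I) i, p), (rank (high G.n G'.n I) j, q)) ∈ N) :
    K.res I = comp _ _ N hN := by
  have hI' := hI
  rw [prodSet_n hK] at hI'
  have hl := low_subset hI'
  have hh := high_subset G.n G'.n I
  refine prodSet_ext (res_mem_prodSet hK hI) (mem_image.2 ⟨⟨N, hN⟩, mem_attach _ _, rfl⟩) ?_
  rw [res_n G hl, res_n G' hh]
  intro a ha b hb p q
  obtain ⟨i, hi, rfl⟩ := exists_rank_eq ha
  obtain ⟨j, hj, rfl⟩ := exists_rank_eq hb
  have h1 := mem_Icc.1 (hl hi)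
  have h2 := mem_Icc.1 (hh hj)
  have h3 := mem_Icc.1 (rank_mem hi)
  have h4 := mem_Icc.1 (rank_mem hj)
  rw [mem_comp_cross, res_n G hl, Nat.add_sub_cancel, ← h i hi j hj p q,
    ← rank_of_le h1.2, add_comm, ← rank_add hI' h2.1]
  · exact (emb_res K hI).edges i (mem_filter.1 hi).1 _ (mem_filter.1 hj).2 p q
  · rw [res_n G hl]
    exact h3.2
  · rw [res_n G hl]
    omega

/-- Two gluings, one on the chosen vertices and one on the remaining ones, combine into a gluing of
`G` and `G'`. They use disjoint sets of half-edges, and none of their pairs joins a chosen vertex to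
another one. -/
theorem exists_shuffle {G G' : BDiagram} {A A' : Finset ℕ} (hA : A ∈ G.iso) (hA' : A' ∈ G'.iso)
    {K₁ K₂ : BDiagram} (h₁ : K₁ ∈ prodSet (G.res A) (G'.res A'))
    (h₂ : K₂ ∈ prodSet (G.res (Icc 1 G.n \ A)) (G'.res (Icc 1 G'.n \ A'))) :
    ∃ K ∈ prodSet G G', ∃ I ∈ K.iso, low G.n I = A ∧ high G.n G'.n I = A' ∧ K.res I = K₁ ∧
      K.res (Icc 1 K.n \ I) = K₂ := by
  classical
  obtain ⟨⟨N₁, hN₁⟩, -, rfl⟩ := mem_image.1 h₁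
  obtain ⟨⟨N₂, hN₂⟩, -, rfl⟩ := mem_image.1 h₂
  have hB := compl_mem_iso hA
  have hB' := compl_mem_iso hA'
  -- The matching is the union of both given ones, transported back to the original numbering.
  obtain ⟨M, mem_M⟩ : ∃ M : Finset ((ℕ × ℕ) × (ℕ × ℕ)),
      ∀ e, e ∈ M ↔ unrank A A' N₁ e ∨ unrank (Icc 1 G.n \ A) (Icc 1 G'.n \ A') N₂ e := by
    refine ⟨{e ∈ G.freeUp ×ˢ G'.freeDown | unrank A A' N₁ e ∨
      unrank (Icc 1 G.n \ A) (Icc 1 G'.n \ A') N₂ e}, fun e => ?_⟩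
    rw [mem_filter, and_iff_right_iff_imp]
    rintro (h | h)
    · exact unrank_free hA hA' hN₁ h
    · exact unrank_free hB hB' hN₂ h
  have hM : M ∈ matchings G G' := by
    refine mem_filter.2 ⟨mem_powerset.2 fun e he => ?_, ?_, ?_⟩
    · rcases (mem_M e).1 he with h | h
      · exact unrank_free hA hA' hN₁ h
      · exact unrank_free hB hB' hN₂ h
    · intro e he f hf h
      rw [mem_coe, mem_M] at he hf
      rcases he with he | he <;> rcases hf with hf | hf
      · exact unrank_fst hN₁ he hf h
      · exact absurd (h ▸ he.1) (mem_sdiff.1 hf.1).2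
      · exact absurd (h ▸ hf.1) (mem_sdiff.1 he.1).2
      · exact unrank_fst hN₂ he hf h
    · intro e he f hf h
      rw [mem_coe, mem_M] at he hf
      rcases he with he | he <;> rcases hf with hf | hf
      · exact unrank_snd hN₁ he hf h
      · exact absurd (h ▸ he.2.1) (mem_sdiff.1 hf.2.1).2
      · exact absurd (h ▸ hf.2.1) (mem_sdiff.1 he.2.1).2
      · exact unrank_snd hN₂ he hf h
  have hK : G.comp G' M hM ∈ prodSet G G' := mem_image.2 ⟨⟨M, hM⟩, mem_attach _ _, rfl⟩
  have hAs := iso_subset hA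
  have hAs' := iso_subset hA'
  obtain ⟨I, mem_I⟩ : ∃ I, ∀ i, i ∈ I ↔ i ∈ A ∨ ∃ j ∈ A', j + G.n = i :=
    ⟨A ∪ A'.image (· + G.n), fun i => by rw [mem_union, mem_image]⟩
  have hlow : low G.n I = A := by
    ext i
    simp only [mem_low, mem_I]
    constructor
    · rintro ⟨h | ⟨j, hj, rfl⟩, h2⟩
      · exact h
      · have := mem_Icc.1 (hAs' hj)
        omega
    · exact fun h => ⟨Or.inl h, (mem_Icc.1 (hAs h)).2⟩
  have hhigh : high G.n G'.n I = A' := by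
    ext i
    simp only [mem_high, mem_I]
    constructor
    · rintro ⟨h1, h | ⟨j, hj, h⟩⟩
      · have := mem_Icc.1 (hAs h)
        have := mem_Icc.1 h1
        omega
      · obtain rfl : j = i := by omega
        exact hj
    · exact fun h => ⟨hAs' h, Or.inr ⟨i, h, rfl⟩⟩
  have hI : I ⊆ Icc 1 (G.n + G'.n) := by
    intro i hi
    rcases (mem_I i).1 hi with h | ⟨j, hj, rfl⟩
    · have := mem_Icc.1 (hAs h)
      exact mem_Icc.2 (by omega)
    · have := mem_Icc.1 (hAs' hj)
      exact mem_Icc.2 (by omega)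
  have hmem_low : ∀ i ≤ G.n, (i ∈ I ↔ i ∈ A) := by
    intro i hi
    rw [← hlow, mem_low, and_iff_left hi]
  have hmem_high : ∀ j ∈ Icc 1 G'.n, (j + G.n ∈ I ↔ j ∈ A') := by
    intro j hj
    rw [← hhigh, mem_high, and_iff_right hj]
  have hcross : ∀ i ∈ Icc 1 G.n, ∀ j ∈ Icc 1 G'.n, ∀ p q,
      ((i, p), (j + G.n, q)) ∈ (G.comp G' M hM).edges ↔
        unrank A A' N₁ ((i, p), (j, q)) ∨ unrank (Icc 1 G.n \ A) (Icc 1 G'.n \ A') N₂ ((i, p), (j, q)) := by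
    intro i hi j hj p q
    rw [mem_Icc] at hi hj
    rw [mem_comp_cross hM hi.2 (by omega), Nat.add_sub_cancel, mem_M]
  refine ⟨_, hK, I, ?_, hlow, hhigh, ?_, ?_⟩
  · rw [mem_iso]
    refine ⟨hI, fun i p j q he => ?_⟩
    rw [mem_comp_edges] at he
    rcases he with he | ⟨h1, he⟩ | ⟨h1, h2, he⟩
    · rw [hmem_low i (mem_Icc.1 (G.edge_fst he)).2, hmem_low j (mem_Icc.1 (G.edge_snd he)).2]
      exact (mem_iso.1 hA).2 _ _ _ _ he
    · have h3 := hmem_high _ (matching_snd hM he)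
      rw [Nat.sub_add_cancel h1.le] at h3
      rw [hmem_low i (mem_Icc.1 (matching_fst hM he)).2, h3]
      rcases (mem_M _).1 he with he | he
      · exact iff_of_true he.1 he.2.1
      · exact iff_of_false (mem_sdiff.1 he.1).2 (mem_sdiff.1 he.2.1).2
    · have h3 := hmem_high _ (G'.edge_fst he)
      have h4 := hmem_high _ (G'.edge_snd he)
      rw [Nat.sub_add_cancel h1.le] at h3
      rw [Nat.sub_add_cancel h2.le] at h4
      rw [h3, h4]
      exact (mem_iso.1 hA').2 _ _ _ _ he
  · have key := res_eq_of_unrank hK (I := I) hI (N := N₁)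
    simp only [hlow, hhigh] at key
    refine key hN₁ fun i hi j hj p q => ?_
    rw [hcross i (hAs hi) j (hAs' hj) p q, or_iff_left fun h => (mem_sdiff.1 h.1).2 hi]
    exact ⟨fun h => h.2.2, fun h => ⟨hi, hj, h⟩⟩
  · have key := res_eq_of_unrank hK (I := Icc 1 (G.n + G'.n) \ I) sdiff_subset (N := N₂)
    simp only [low_compl, high_compl, hlow, hhigh] at key
    refine key hN₂ fun i hi j hj p q => ?_
    rw [hcross i (iso_subset hB hi) j (iso_subset hB' hj) p q,
      or_iff_right fun h => (mem_sdiff.1 hi).2 h.1]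
    exact ⟨fun h => h.2.2, fun h => ⟨hi, hj, h⟩⟩

/-- The pair `(K, I)` corresponds to the two traces of `I` on the blocks and to the two restrictions
of `K`; `exists_shuffle` is the surjectivity. This is the multiplicativity of the coproduct, freed
from linear algebra. -/
theorem sum_prodSet_iso {X : Type} [AddCommMonoid X] (G G' : BDiagram)
    (F : BDiagram → BDiagram → X) :
    ∑ K ∈ prodSet G G', ∑ I ∈ K.iso, F (K.res I) (K.res (Icc 1 K.n \ I)) =
      ∑ A ∈ G.iso, ∑ A' ∈ G'.iso, ∑ K₁ ∈ prodSet (G.res A) (G'.res A'),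
        ∑ K₂ ∈ prodSet (G.res (Icc 1 G.n \ A)) (G'.res (Icc 1 G'.n \ A')), F K₁ K₂ := by
  have hR : ∑ A ∈ G.iso, ∑ A' ∈ G'.iso, ∑ K₁ ∈ prodSet (G.res A) (G'.res A'),
      ∑ K₂ ∈ prodSet (G.res (Icc 1 G.n \ A)) (G'.res (Icc 1 G'.n \ A')), F K₁ K₂ =
      ∑ x ∈ (G.iso ×ˢ G'.iso).sigma fun x => prodSet (G.res x.1) (G'.res x.2) ×ˢ
        prodSet (G.res (Icc 1 G.n \ x.1)) (G'.res (Icc 1 G'.n \ x.2)), F x.2.1 x.2.2 := by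
    rw [sum_sigma, sum_product]
    refine sum_congr rfl fun A _ => sum_congr rfl fun A' _ => ?_
    rw [sum_product]
  rw [hR, sum_sigma']
  refine sum_bij (fun x _ => ⟨(low G.n x.2, high G.n G'.n x.2),
    (x.1.res x.2, x.1.res (Icc 1 x.1.n \ x.2))⟩) ?_ ?_ ?_ ?_
  · rintro ⟨K, I⟩ h
    obtain ⟨hK, hI⟩ := mem_sigma.1 h
    simp only at hK hI
    refine mem_sigma.2 ⟨mem_product.2 ⟨low_mem_iso hK hI, high_mem_iso hK hI⟩,
      mem_product.2 ⟨res_mem_prodSet hK (iso_subset hI), ?_⟩⟩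
    have := res_mem_prodSet hK (I := Icc 1 K.n \ I) sdiff_subset
    rwa [prodSet_n hK, low_compl, high_compl, ← prodSet_n hK] at this
  · rintro ⟨K, I⟩ h ⟨L, J⟩ h' heq
    obtain ⟨hK, hI⟩ := mem_sigma.1 h
    obtain ⟨hL, hJ⟩ := mem_sigma.1 h'
    simp only at hK hI hL hJ
    simp only [Sigma.mk.injEq, Prod.mk.injEq, heq_eq_eq] at heq
    obtain ⟨⟨h1, h2⟩, h3, h4⟩ := heq
    have hKn := prodSet_n hK
    have hLn := prodSet_n hL
    have hIs := iso_subset hI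
    have hJs := iso_subset hJ
    have sub : ∀ I J : Finset ℕ, I ⊆ Icc 1 (G.n + G'.n) → low G.n I = low G.n J →
        high G.n G'.n I = high G.n G'.n J → I ⊆ J := by
      intro I J hI h1 h2 i hi
      have := mem_Icc.1 (hI hi)
      by_cases h : i ≤ G.n
      · have : i ∈ low G.n I := mem_filter.2 ⟨hi, h⟩
        rw [h1] at this
        exact (mem_filter.1 this).1
      · have : i - G.n ∈ high G.n G'.n I :=
          mem_filter.2 ⟨mem_Icc.2 (by omega), by rwa [Nat.sub_add_cancel (by omega)]⟩
        rw [h2] at this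
        have := (mem_filter.1 this).2
        rwa [Nat.sub_add_cancel (by omega)] at this
    obtain rfl : I = J := subset_antisymm (sub I J (hKn ▸ hIs) h1 h2)
      (sub J I (hLn ▸ hJs) h1.symm h2.symm)
    have hnn : K.n = L.n := hKn.trans hLn.symm
    rw [← hnn] at h4
    -- A crossing edge has both ends in `I` or both outside, as `I` is isolated in both diagrams; so
    -- one of the two restrictions shows it.
    obtain rfl : K = L := by
      refine prodSet_ext hK hL fun i hi j hj p q => ?_
      have hi' : i ∈ Icc 1 K.n := by
        rw [mem_Icc] at *
        omega
      have hj' : j + G.n ∈ Icc 1 K.n := by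
        rw [mem_Icc] at *
        omega
      have a1 := (agree_of_res_eq hIs hJs h3).2.2.2
      have a2 := (agree_of_res_eq sdiff_subset (hnn ▸ sdiff_subset) h4).2.2.2
      by_cases hiI : i ∈ I <;> by_cases hjI : j + G.n ∈ I
      · exact a1 i hiI _ hjI p q
      · exact iff_of_false (fun h => hjI (((mem_iso.1 hI).2 _ _ _ _ h).1 hiI))
          (fun h => hjI (((mem_iso.1 hJ).2 _ _ _ _ h).1 hiI))
      · exact iff_of_false (fun h => hiI (((mem_iso.1 hI).2 _ _ _ _ h).2 hjI))
          (fun h => hiI (((mem_iso.1 hJ).2 _ _ _ _ h).2 hjI))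
      · exact a2 i (mem_sdiff.2 ⟨hi', hiI⟩) _ (mem_sdiff.2 ⟨hj', hjI⟩) p q
    rfl
  · rintro ⟨⟨A, A'⟩, ⟨K₁, K₂⟩⟩ h
    simp only [mem_sigma, mem_product] at h
    obtain ⟨K, hK, I, hI, h1, h2, h3, h4⟩ := exists_shuffle h.1.1 h.1.2 h.2.1 h.2.2
    exact ⟨⟨K, I⟩, mem_sigma.2 ⟨hK, hI⟩, by simp only [h1, h2, h3, h4]⟩
  · rintro ⟨K, I⟩ h
    rfl

end BDiagram

/-- Two linear maps that agree on the basis are equal. -/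
theorem linearMap_ext_single {ι X : Type} [AddCommMonoid X] [Module ℂ X]
    {f g : (ι →₀ ℂ) →ₗ[ℂ] X} (h : ∀ i, f (Finsupp.single i 1) = g (Finsupp.single i 1)) :
    f = g :=
  Finsupp.lhom_ext' fun i => LinearMap.ext_ring (h i)

/-! ### The bialgebra axioms and the antipode for B-diagrams -/

theorem hopfB_comul_single (G : BDiagram) : hopfB.comul (Finsupp.single G 1) =
    ∑ I ∈ G.iso, (Finsupp.single (G.res I) 1 : BSpace) ⊗ₜ[ℂ]
      (Finsupp.single (G.res (Icc 1 G.n \ I)) 1 : BSpace) := by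
  rw [← sum_attach]
  simp only [hopfB, Finsupp.linearCombination_single, one_smul]
  refine sum_congr rfl fun I _ => ?_
  rw [G.res_eq_sub (BDiagram.iso_subset I.2), G.res_eq_sub sdiff_subset]

theorem hopfB_counit_single (G : BDiagram) :
    hopfB.counit (Finsupp.single G 1) = if G.n = 0 then 1 else 0 := by
  change (Finsupp.single G 1 : BSpace) BDiagram.empty = _
  rw [Finsupp.single_apply]
  refine if_congr ⟨?_, BDiagram.eq_empty⟩ rfl rfl
  rintro rfl
  rfl

theorem mul_assoc_of_single {ι : Type} {m : (ι →₀ ℂ) →ₗ[ℂ] (ι →₀ ℂ) →ₗ[ℂ] (ι →₀ ℂ)}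
    (h : ∀ i j k, m (m (Finsupp.single i 1) (Finsupp.single j 1)) (Finsupp.single k 1) =
      m (Finsupp.single i 1) (m (Finsupp.single j 1) (Finsupp.single k 1)))
    (x y z : ι →₀ ℂ) : m (m x y) z = m x (m y z) := by
  have h1 : ∀ x : ι →₀ ℂ, x ∈ Submodule.span ℂ (Set.range fun i => Finsupp.single i (1 : ℂ)) := by
    intro x
    have := Finsupp.basisSingleOne.mem_span (R := ℂ) x
    rwa [Finsupp.coe_basisSingleOne] at this
  induction h1 x using Submodule.span_induction with
  | zero => simp only [map_zero, LinearMap.zero_apply]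
  | add x x' _ _ h h' => simp only [map_add, LinearMap.add_apply, h, h']
  | smul c x _ h => simp only [map_smul, LinearMap.smul_apply, h]
  | mem x hx =>
  induction h1 y using Submodule.span_induction with
  | zero => simp only [map_zero, LinearMap.zero_apply]
  | add x x' _ _ h h' => simp only [map_add, LinearMap.add_apply, h, h']
  | smul c x _ h => simp only [map_smul, LinearMap.smul_apply, h]
  | mem y hy =>
  induction h1 z using Submodule.span_induction with
  | zero => simp only [map_zero]
  | add x x' _ _ h h' => simp only [map_add, h, h']
  | smul c x _ h => simp only [map_smul, h]
  | mem z hz =>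
  obtain ⟨i, rfl⟩ := hx
  obtain ⟨j, rfl⟩ := hy
  obtain ⟨k, rfl⟩ := hz
  exact h i j k

theorem hopfB_one : hopfB.one = Finsupp.single BDiagram.empty 1 := rfl

theorem hopfB_coassoc : TensorProduct.assoc ℂ BSpace BSpace BSpace ∘ₗ
    hopfB.comul.rTensor BSpace ∘ₗ hopfB.comul = hopfB.comul.lTensor BSpace ∘ₗ hopfB.comul := by
  refine linearMap_ext_single fun G => ?_
  have h1 : ∀ I ∈ G.iso, TensorProduct.assoc ℂ BSpace BSpace BSpace (hopfB.comul.rTensor BSpace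
      ((Finsupp.single (G.res I) 1 : BSpace) ⊗ₜ[ℂ]
        (Finsupp.single (G.res (Icc 1 G.n \ I)) 1 : BSpace))) =
      ∑ A ∈ G.iso with A ⊆ I, (Finsupp.single (G.res A) 1 : BSpace) ⊗ₜ[ℂ]
        ((Finsupp.single (G.res (I \ A)) 1 : BSpace) ⊗ₜ[ℂ]
          (Finsupp.single (G.res (Icc 1 G.n \ I)) 1 : BSpace)) := by
    intro I hI
    rw [LinearMap.rTensor_tmul, hopfB_comul_single, BDiagram.sum_iso_res hI fun K L =>
      (Finsupp.single K 1 : BSpace) ⊗ₜ[ℂ] (Finsupp.single L 1 : BSpace), TensorProduct.sum_tmul,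
      map_sum]
    rfl
  have h2 : ∀ I ∈ G.iso, hopfB.comul.lTensor BSpace
      ((Finsupp.single (G.res I) 1 : BSpace) ⊗ₜ[ℂ]
        (Finsupp.single (G.res (Icc 1 G.n \ I)) 1 : BSpace)) =
      ∑ A ∈ G.iso with A ⊆ Icc 1 G.n \ I, (Finsupp.single (G.res I) 1 : BSpace) ⊗ₜ[ℂ]
        ((Finsupp.single (G.res A) 1 : BSpace) ⊗ₜ[ℂ]
          (Finsupp.single (G.res ((Icc 1 G.n \ I) \ A)) 1 : BSpace)) := by
    intro I hI
    rw [LinearMap.lTensor_tmul, hopfB_comul_single,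
      BDiagram.sum_iso_res (BDiagram.compl_mem_iso hI) fun K L =>
      (Finsupp.single K 1 : BSpace) ⊗ₜ[ℂ] (Finsupp.single L 1 : BSpace), TensorProduct.tmul_sum]
  rw [LinearMap.comp_apply, LinearMap.comp_apply, LinearMap.comp_apply, hopfB_comul_single,
    map_sum, map_sum, map_sum, LinearEquiv.coe_coe, sum_congr rfl h1, sum_congr rfl h2]
  exact BDiagram.sum_iso_coassoc G fun A B C => (Finsupp.single (G.res A) 1 : BSpace) ⊗ₜ[ℂ]
    ((Finsupp.single (G.res B) 1 : BSpace) ⊗ₜ[ℂ] (Finsupp.single (G.res C) 1 : BSpace))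

theorem hopfB_comul_mul (x y : BSpace) : hopfB.comul (hopfB.mul x y) =
    TensorProduct.map₂ hopfB.mul hopfB.mul (hopfB.comul x) (hopfB.comul y) := by
  suffices h : hopfB.mul.compr₂ hopfB.comul =
      (TensorProduct.map₂ hopfB.mul hopfB.mul).compl₁₂ hopfB.comul hopfB.comul from
    LinearMap.congr_fun₂ h x y
  refine linearMap_ext_single fun G => linearMap_ext_single fun G' => ?_
  rw [LinearMap.compr₂_apply, LinearMap.compl₁₂_apply, hopfB_mul_single, map_sum,
    hopfB_comul_single, hopfB_comul_single, map_sum, map_sum, sum_congr rfl fun K _ => hopfB_comul_single K]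
  rw [BDiagram.sum_prodSet_iso G G' fun K L =>
    (Finsupp.single K 1 : BSpace) ⊗ₜ[ℂ] (Finsupp.single L 1 : BSpace)]
  simp only [LinearMap.sum_apply]
  rw [sum_comm]
  refine sum_congr rfl fun A' _ => sum_congr rfl fun A _ => ?_
  rw [TensorProduct.map₂_apply_tmul, TensorProduct.map_tmul, hopfB_mul_single, hopfB_mul_single,
    TensorProduct.sum_tmul]
  refine sum_congr rfl fun K _ => ?_
  rw [TensorProduct.tmul_sum]

theorem hopfB_isBialgebra : hopfB.IsBialgebra where
  mul_assoc := mul_assoc_of_single fun G G' G'' => by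
    simp only [hopfB_mul_single, map_sum, LinearMap.sum_apply, BDiagram.sum_prodSet_assoc]
  one_mul x := by
    suffices hopfB.mul hopfB.one = LinearMap.id from LinearMap.congr_fun this x
    refine linearMap_ext_single fun G => ?_
    rw [hopfB_one, hopfB_mul_single, BDiagram.prodSet_empty_left, sum_singleton,
      LinearMap.id_apply]
  mul_one x := by
    suffices hopfB.mul.flip hopfB.one = LinearMap.id from LinearMap.congr_fun this x
    refine linearMap_ext_single fun G => ?_
    rw [LinearMap.flip_apply, hopfB_one, hopfB_mul_single, BDiagram.prodSet_empty_right,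
      sum_singleton, LinearMap.id_apply]
  coassoc := hopfB_coassoc
  rTensor_counit := by
    refine linearMap_ext_single fun G => ?_
    simp only [LinearMap.comp_apply, hopfB_comul_single, map_sum, LinearMap.rTensor_tmul,
      hopfB_counit_single]
    rw [sum_eq_single_of_mem ∅ G.empty_mem_iso]
    · rw [sdiff_empty, BDiagram.res_self, BDiagram.res_n G (empty_subset _), card_empty,
        if_pos rfl]
      rfl
    · intro I hI hne
      rw [if_neg, TensorProduct.zero_tmul]
      rwa [BDiagram.res_n G (BDiagram.iso_subset hI), card_eq_zero]
  lTensor_counit := by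
    refine linearMap_ext_single fun G => ?_
    simp only [LinearMap.comp_apply, hopfB_comul_single, map_sum, LinearMap.lTensor_tmul,
      hopfB_counit_single]
    have hmem := BDiagram.compl_mem_iso G.empty_mem_iso
    rw [sdiff_empty] at hmem
    rw [sum_eq_single_of_mem _ hmem]
    · rw [Finset.sdiff_self, BDiagram.res_self, BDiagram.res_n G (empty_subset _), card_empty,
        if_pos rfl]
      rfl
    · intro I hI hne
      rw [if_neg, TensorProduct.tmul_zero]
      rw [BDiagram.res_n G sdiff_subset, card_eq_zero, sdiff_eq_empty_iff_subset]
      exact fun h => hne (subset_antisymm (BDiagram.iso_subset hI) h)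
  counit_one := (hopfB_counit_single BDiagram.empty).trans (if_pos rfl)
  counit_mul x y := by
    suffices h : hopfB.mul.compr₂ hopfB.counit =
        (LinearMap.mul ℂ ℂ).compl₁₂ hopfB.counit hopfB.counit from
      LinearMap.congr_fun₂ h x y
    refine linearMap_ext_single fun G => linearMap_ext_single fun G' => ?_
    simp only [LinearMap.compr₂_apply, LinearMap.compl₁₂_apply, LinearMap.mul_apply',
      hopfB_mul_single, map_sum, hopfB_counit_single]
    by_cases h : G.n + G'.n = 0
    · obtain ⟨h1, h2⟩ := Nat.add_eq_zero_iff.1 h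
      rw [BDiagram.eq_empty h1, BDiagram.prodSet_empty_left, sum_singleton]
      simp [BDiagram.empty]
    · rw [sum_eq_zero]
      · by_cases h1 : G.n = 0
        · have h2 : G'.n ≠ 0 := by omega
          simp [h2]
        · simp [h1]
      · intro K hK
        rw [if_neg]
        rwa [BDiagram.prodSet_n hK]
  comul_one := by
    have : BDiagram.empty.iso = {∅} := by
      ext I
      rw [BDiagram.mem_iso, mem_singleton]
      constructor
      · exact fun h => subset_empty.1 h.1
      · rintro rfl
        simp
    rw [hopfB_one, hopfB_comul_single, this, sum_singleton, sdiff_empty, BDiagram.res_self,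
      BDiagram.res_empty]
  comul_mul := hopfB_comul_mul

/-- The grading is the number of vertices; the empty diagram is the only one in degree zero. -/
theorem hopfB_exists_antipode : ∃ S, hopfB.IsAntipode S ∧ ∀ W : Submodule ℂ BSpace,
    hopfB.one ∈ W → (∀ x ∈ W, ∀ y ∈ W, hopfB.mul x y ∈ W) →
      (∀ x ∈ W, hopfB.comul x ∈ LinearMap.range (TensorProduct.map W.subtype W.subtype)) →
      ∀ x ∈ W, S x ∈ W := by
  refine hopfB_isBialgebra.exists_antipode Finsupp.basisSingleOne BDiagram.n ?_ ?_
  · intro G hG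
    rw [Finsupp.coe_basisSingleOne, BDiagram.eq_empty hG]
    rfl
  · intro G
    rw [Finsupp.coe_basisSingleOne]
    simp only [hopfB_comul_single]
    refine Submodule.sum_mem _ fun I hI => Submodule.subset_span ⟨_, _, ?_, rfl⟩
    have hI' := BDiagram.iso_subset hI
    rw [BDiagram.res_n G hI', BDiagram.res_n G sdiff_subset, card_sdiff_of_subset hI',
      Nat.card_Icc]
    have := card_le_card hI'
    rw [Nat.card_Icc] at this
    omega

theorem hopfB_isHopf : hopfB.IsHopf :=
  hopfB_isBialgebra.isHopf (hopfB_exists_antipode.imp fun _ h => h.1)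

/-! ### Children in an increasing binary tree -/

/-- The left child of `i` is `j`, for the set `S` of vertices placed at the positions `p`. -/
def Child (p : ℕ → ℤ) (S : Set ℕ) (i j : ℕ) : Prop :=
  i ∈ S ∧ i < j ∧ IsLeast {k | k ∈ S ∧ (∀ l ∈ S, l < i → p l < p i → p l < p k) ∧ p k < p i} j

/-- The positions of the integers in a list. -/
def pos (L : List ℕ) (k : ℕ) : ℤ := L.idxOf k

theorem leftChild_iff {L : List ℕ} {i j : ℕ} : LeftChild L i j ↔ Child (pos L) {k | k ∈ L} i j := by
  simp only [LeftChild, Child, pos, Set.mem_ofPred_eq, Nat.cast_lt]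

/-- Reading a word backwards exchanges left and right. Positions are taken in `ℤ` so that the
reversal is a change of sign and each fact about `Child` serves both sides. -/
theorem rightChild_iff {L : List ℕ} {i j : ℕ} :
    RightChild L i j ↔ Child (fun k => -pos L k) {k | k ∈ L} i j := by
  have : ∀ k, (L.idxOf i < L.idxOf k ∧ ∀ l ∈ L, l < i → L.idxOf i < L.idxOf l →
      L.idxOf k < L.idxOf l) ↔ (∀ l ∈ L, l < i → -(L.idxOf l : ℤ) < -(L.idxOf i : ℤ) →
        -(L.idxOf l : ℤ) < -(L.idxOf k : ℤ)) ∧ -(L.idxOf k : ℤ) < -(L.idxOf i : ℤ) := by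
    intro k
    simp only [neg_lt_neg_iff, Nat.cast_lt]
    tauto
  simp only [RightChild, Child, pos, Set.mem_ofPred_eq, this]

theorem pos_injOn (L : List ℕ) : Set.InjOn (pos L) {k | k ∈ L} := fun _ hi _ _ h =>
  (List.idxOf_inj hi).1 (Int.ofNat.inj h)

namespace Child

variable {p q : ℕ → ℤ} {S T : Set ℕ} {x i j : ℕ}

/-- The bound on the positions of children of `i` involves only vertices below `i`, and a candidate
larger than `j` does not affect the minimum. So a new largest vertex changes nothing among the old
ones, and only their relative positions matter. -/
theorem insert_max (hx : ∀ k ∈ S, k < x) (hpq : ∀ k ∈ S, ∀ l ∈ S, p k < p l ↔ q k < q l)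
    (hi : i ∈ S) (hj : j ∈ S) : Child p (insert x S) i j ↔ Child q S i j := by
  have key : ∀ k ∈ S, ((∀ l ∈ insert x S, l < i → p l < p i → p l < p k) ∧ p k < p i) ↔
      ((∀ l ∈ S, l < i → q l < q i → q l < q k) ∧ q k < q i) := by
    intro k hk
    rw [hpq k hk i hi]
    refine and_congr_left fun _ => ⟨fun h l hl h1 h2 => ?_, fun h l hl h1 h2 => ?_⟩
    · exact (hpq l hl k hk).1 (h l (Or.inr hl) h1 ((hpq l hl i hi).2 h2))
    · rcases hl with rfl | hl
      · exact absurd (hx i hi) (by omega)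
      · exact (hpq l hl k hk).2 (h l hl h1 ((hpq l hl i hi).1 h2))
  constructor
  · rintro ⟨-, h1, h2, h3⟩
    refine ⟨hi, h1, ⟨hj, (key j hj).1 h2.2⟩, fun k hk => ?_⟩
    exact h3 ⟨Or.inr hk.1, (key k hk.1).2 hk.2⟩
  · rintro ⟨-, h1, h2, h3⟩
    refine ⟨Or.inr hi, h1, ⟨Or.inr hj, (key j hj).2 h2.2⟩, fun k hk => ?_⟩
    rcases hk.1 with rfl | hk'
    · exact (hx j hj).le
    · exact h3 ⟨hk', (key k hk').1 hk.2⟩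

/-- A vertex between `x` and its parent would be an admissible candidate smaller than `x`. -/
theorem not_between_max (hx : ∀ k ∈ S, k < x) (h : Child p (insert x S) i x) :
    ∀ k ∈ S, p x < p k → ¬ p k < p i := by
  intro k hk h1 h2
  have := h.2.2.2 ⟨Or.inr hk, fun l hl h3 h4 => (h.2.2.1.2.1 l hl h3 h4).trans h1, h2⟩
  exact absurd (hx k hk) (by omega)

/-- A partial converse of `not_between_max`: if the slot of `i` was free and `x` stands next to `i`,
then `x` fills the slot. -/
theorem of_not_between (hx : ∀ k ∈ S, k < x) (hpq : ∀ k ∈ S, ∀ l ∈ S, p k < p l ↔ q k < q l)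
    (hp : Set.InjOn p (insert x S)) (hi : i ∈ S) (hno : ∀ j, ¬ Child q S i j) (hlt : p x < p i)
    (hb : ∀ k ∈ S, p x < p k → ¬ p k < p i) : Child p (insert x S) i x := by
  refine ⟨Or.inr hi, hx i hi, ⟨Or.inl rfl, fun l hl h1 h2 => ?_, hlt⟩, fun k hk => ?_⟩
  · rcases hl with rfl | hl
    · exact absurd (hx i hi) (by omega)
    · have h3 := hb l hl
      have h4 : p l ≠ p x := fun h => (hx l hl).ne (hp (Or.inr hl) (Or.inl rfl) h)
      omega
  · by_contra hc
    have hkS : k ∈ S := hk.1.resolve_left fun h => hc h.ge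
    -- A candidate below `x` would be an old vertex, and the least old candidate would already be a
    -- child of `i`.
    let X : Set ℕ := {k | k ∈ S ∧ (∀ l ∈ S, l < i → q l < q i → q l < q k) ∧ q k < q i}
    have hX : X.Nonempty := ⟨k, hkS, fun l hl h1 h2 => (hpq l hl k hkS).1
      (hk.2.1 l (Or.inr hl) h1 ((hpq l hl i hi).2 h2)), (hpq k hkS i hi).1 hk.2.2⟩
    have hmem := Nat.sInf_mem hX
    refine hno (sInf X) ⟨hi, ?_, hmem, fun k hk => Nat.sInf_le hk⟩
    -- The least candidate automatically exceeds `i`: it differs from `i` by its position, and a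
    -- candidate below `i` would be one of the vertices that bound its own position strictly.
    by_contra hle
    rcases (not_lt.1 hle).eq_or_lt with he | hlt
    · have := hmem.2.2
      rw [he] at this
      exact lt_irrefl _ this
    · exact lt_irrefl _ (hmem.2.1 _ hmem.1 hlt hmem.2.2)

theorem map_iff {f : ℕ → ℕ} (hf : ∀ k ∈ S, ∀ l ∈ S, f k < f l ↔ k < l)
    (hT : ∀ k, k ∈ T ↔ ∃ l ∈ S, f l = k) (hpq : ∀ k ∈ S, q (f k) = p k) (hi : i ∈ S)
    (hj : j ∈ S) : Child q T (f i) (f j) ↔ Child p S i j := by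
  have hfT : ∀ k ∈ S, f k ∈ T := fun k hk => (hT _).2 ⟨k, hk, rfl⟩
  have key : ∀ k ∈ S, ((∀ l ∈ T, l < f i → q l < q (f i) → q l < q (f k)) ∧ q (f k) < q (f i)) ↔
      ((∀ l ∈ S, l < i → p l < p i → p l < p k) ∧ p k < p i) := by
    intro k hk
    rw [hpq k hk, hpq i hi]
    refine and_congr_left fun _ => ⟨fun h l hl h1 h2 => ?_, fun h l hl h1 h2 => ?_⟩
    · have := h (f l) (hfT l hl) ((hf l hl i hi).2 h1)
      rw [hpq l hl] at this
      exact this h2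
    · obtain ⟨m, hm, rfl⟩ := (hT l).1 hl
      rw [hpq m hm] at h2 ⊢
      exact h m hm ((hf m hm i hi).1 h1) h2
  constructor
  · rintro ⟨-, h1, h2, h3⟩
    refine ⟨hi, (hf i hi j hj).1 h1, ⟨hj, (key j hj).1 h2.2⟩, fun k hk => ?_⟩
    have := h3 ⟨hfT k hk.1, (key k hk.1).2 hk.2⟩
    have := hf k hk.1 j hj
    omega
  · rintro ⟨-, h1, h2, h3⟩
    refine ⟨hfT i hi, (hf i hi j hj).2 h1, ⟨hfT j hj, (key j hj).2 h2.2⟩, fun k hk => ?_⟩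
    obtain ⟨m, hm, rfl⟩ := (hT k).1 hk.1
    have := h3 ⟨hm, (key m hm).1 hk.2⟩
    have := hf m hm j hj
    omega

/-- The nearest smaller vertex to the left is the parent, if it is larger than the nearest
smaller vertex to the right. -/
theorem of_nearest (hp : Set.InjOn p S) {v a : ℕ} (hv : v ∈ S) (ha : a ∈ S) (hav : a < v)
    (hpav : p v < p a) (hnear : ∀ l ∈ S, l < v → p v < p l → p a ≤ p l)
    (hother : (∃ l ∈ S, l < v ∧ p l < p v) → ∃ r ∈ S, r < a ∧ p r < p v ∧
      ∀ l ∈ S, l < v → p l < p v → p l ≤ p r) : Child p S a v := by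
  refine ⟨ha, hav, ⟨hv, fun l hl h1 h2 => ?_, hpav⟩, fun k hk => ?_⟩
  · by_contra hc
    have : p l ≠ p v := fun h => (h1.trans hav).ne (hp hl hv h)
    have := hnear l hl (h1.trans hav) (by omega)
    omega
  · obtain ⟨hkS, hk1, hk2⟩ := hk
    by_contra hc
    have hkv : p k ≠ p v := fun h => (not_le.1 hc).ne (hp hkS hv h)
    by_cases h : p k < p v
    · obtain ⟨r, hr, hra, hrv, hrmax⟩ := hother ⟨k, hkS, by omega, h⟩
      have := hrmax k hkS (by omega) h
      have := hk1 r hr hra (by omega)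
      omega
    · have := hnear k hkS (by omega) (by omega)
      omega

/-- The parent of `v` is the larger of its nearest smaller vertices on the two sides, or the only
one that exists. The vertex `u` ensures that there is at least one. -/
theorem exists_parent (hS : S.Finite) (hp : Set.InjOn p S) {u v : ℕ} (hu : u ∈ S) (hv : v ∈ S)
    (huv : u < v) : ∃ i ∈ S, Child p S i v ∨ Child (fun k => -p k) S i v := by
  have hn : Set.InjOn (fun k => -p k) S := fun i hi j hj h => hp hi hj (neg_injective h)
  let R : Set ℕ := {l | l ∈ S ∧ l < v ∧ p v < p l}
  let A : Set ℕ := {l | l ∈ S ∧ l < v ∧ p l < p v}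
  have hR : R.Nonempty → ∃ r ∈ R, ∀ l ∈ R, p r ≤ p l := fun h =>
    Set.exists_min_image R p (hS.subset fun l hl => hl.1) h
  have hA : A.Nonempty → ∃ r ∈ A, ∀ l ∈ A, p l ≤ p r := fun h =>
    Set.exists_max_image A p (hS.subset fun l hl => hl.1) h
  by_cases hRn : R.Nonempty <;> by_cases hAn : A.Nonempty
  · obtain ⟨r, hr, hr'⟩ := hR hRn
    obtain ⟨a, ha, ha'⟩ := hA hAn
    rcases lt_trichotomy a r with har | rfl | har
    · exact ⟨r, hr.1, Or.inl (of_nearest hp hv hr.1 hr.2.1 hr.2.2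
        (fun l h1 h2 h3 => hr' l ⟨h1, h2, h3⟩)
        fun _ => ⟨a, ha.1, har, ha.2.2, fun l h1 h2 h3 => ha' l ⟨h1, h2, h3⟩⟩)⟩
    · exact absurd ha.2.2 hr.2.2.not_gt
    · refine ⟨a, ha.1, Or.inr (of_nearest hn hv ha.1 ha.2.1 (neg_lt_neg ha.2.2)
        (fun l h1 h2 h3 => neg_le_neg (ha' l ⟨h1, h2, neg_lt_neg_iff.1 h3⟩))
        fun _ => ⟨r, hr.1, har, neg_lt_neg hr.2.2, fun l h1 h2 h3 =>
          neg_le_neg (hr' l ⟨h1, h2, neg_lt_neg_iff.1 h3⟩)⟩)⟩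
  · obtain ⟨r, hr, hr'⟩ := hR hRn
    exact ⟨r, hr.1, Or.inl (of_nearest hp hv hr.1 hr.2.1 hr.2.2
      (fun l h1 h2 h3 => hr' l ⟨h1, h2, h3⟩) fun ⟨l, hl⟩ => absurd ⟨l, hl⟩ hAn)⟩
  · obtain ⟨a, ha, ha'⟩ := hA hAn
    exact ⟨a, ha.1, Or.inr (of_nearest hn hv ha.1 ha.2.1 (neg_lt_neg ha.2.2)
      (fun l h1 h2 h3 => neg_le_neg (ha' l ⟨h1, h2, neg_lt_neg_iff.1 h3⟩))
      fun ⟨l, h1, h2, h3⟩ => absurd ⟨l, h1, h2, neg_lt_neg_iff.1 h3⟩ hRn)⟩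
  · have h1 : p u ≠ p v := fun h => huv.ne (hp hu hv h)
    rcases h1.lt_or_gt with h | h
    · exact absurd ⟨u, hu, huv, h⟩ hAn
    · exact absurd ⟨u, hu, huv, h⟩ hRn

end Child

/-! ### The edges of a list -/

theorem mem_listEdges_iff {L : List ℕ} {i c j d : ℕ} : ((i, c), (j, d)) ∈ listEdges L ↔
    d = 1 ∧ ((c = 1 ∧ LeftChild L i j) ∨ (c = 2 ∧ RightChild L i j)) := by
  rw [mem_listEdges]
  simp only [mem_product, List.mem_toFinset, mem_insert, mem_singleton]
  constructor
  · rintro ⟨⟨-, -, h1⟩, h2⟩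
    exact ⟨h1, h2⟩
  · rintro ⟨rfl, ⟨rfl, h⟩ | ⟨rfl, h⟩⟩
    · exact ⟨⟨⟨h.1, Or.inl rfl⟩, h.2.2.1.1, rfl⟩, Or.inl ⟨rfl, h⟩⟩
    · exact ⟨⟨⟨h.1, Or.inr rfl⟩, h.2.2.1.1, rfl⟩, Or.inr ⟨rfl, h⟩⟩

theorem exists_parent_listEdges {L : List ℕ} {u v : ℕ} (hu : u ∈ L) (hv : v ∈ L) (huv : u < v) :
    ∃ i ∈ L, ∃ c, ((i, c), (v, 1)) ∈ listEdges L := by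
  obtain ⟨i, hi, h | h⟩ := Child.exists_parent (S := {k | k ∈ L}) (List.finite_toSet L)
    (pos_injOn L) hu hv huv
  · exact ⟨i, hi, 1, mem_listEdges_iff.2 ⟨rfl, Or.inl ⟨rfl, leftChild_iff.2 h⟩⟩⟩
  · exact ⟨i, hi, 2, mem_listEdges_iff.2 ⟨rfl, Or.inr ⟨rfl, rightChild_iff.2 h⟩⟩⟩

/-- The edges of a list form a tree: each integer except the smallest is the target of exactly one
edge. -/
theorem card_listEdges {L : List ℕ} (hL : L.Nodup) (h0 : L ≠ []) :
    #(listEdges L) + 1 = L.length := by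
  have hne : L.toFinset.Nonempty := by simpa using h0
  have himg : (listEdges L).image (fun e => e.2.1) = L.toFinset.erase (L.toFinset.min' hne) := by
    ext v
    rw [mem_image, mem_erase]
    constructor
    · rintro ⟨e, he, rfl⟩
      obtain ⟨h1, -, h3, -, h5⟩ := listEdges_valid he
      have := min'_le L.toFinset e.1.1 (List.mem_toFinset.2 h1)
      exact ⟨by omega, List.mem_toFinset.2 h3⟩
    · rintro ⟨h1, h2⟩
      have h3 := min'_mem L.toFinset hne
      have h4 := min'_le L.toFinset v h2
      obtain ⟨i, -, c, h⟩ := exists_parent_listEdges (List.mem_toFinset.1 h3)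
        (List.mem_toFinset.1 h2) (by omega)
      exact ⟨_, h, rfl⟩
  rw [← card_image_of_injOn (s := listEdges L) (f := fun e => e.2.1), himg,
    card_erase_add_one (min'_mem _ _), List.toFinset_card_of_nodup hL]
  intro e he f hf h
  exact listEdges_in he hf
    (Prod.ext h ((listEdges_valid he).2.2.2.1.trans (listEdges_valid hf).2.2.2.1.symm))

theorem idxOf_map_of_injOn {f : ℕ → ℕ} {L : List ℕ} (hf : Set.InjOn f {k | k ∈ L}) {k : ℕ}
    (hk : k ∈ L) : (L.map f).idxOf (f k) = L.idxOf k := by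
  induction L with
  | nil => simp at hk
  | cons a L ih =>
    rw [List.map_cons]
    by_cases h : a = k
    · rw [h, List.idxOf_cons_self, List.idxOf_cons_self]
    · have h' : f a ≠ f k := fun he => h (hf (by simp) hk he)
      have hk' : k ∈ L := (List.mem_cons.1 hk).resolve_left (Ne.symm h)
      rw [List.idxOf_cons_ne _ h, List.idxOf_cons_ne _ h',
        ih (hf.mono fun x hx => List.mem_cons_of_mem _ hx) hk']

/-- Only the order of the integers and their positions enter, and an increasing relabelling keeps
both. Applied to standardization and to shifts. -/
theorem mem_listEdges_map {f : ℕ → ℕ} {L : List ℕ} (hf : ∀ k ∈ L, ∀ l ∈ L, f k < f l ↔ k < l)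
    {i c j d : ℕ} (hi : i ∈ L) (hj : j ∈ L) :
    ((f i, c), (f j, d)) ∈ listEdges (L.map f) ↔ ((i, c), (j, d)) ∈ listEdges L := by
  have hinj : Set.InjOn f {k | k ∈ L} := by
    intro k hk l hl h
    have := hf k hk l hl
    have := hf l hl k hk
    omega
  rw [mem_listEdges_iff, mem_listEdges_iff, leftChild_iff, leftChild_iff, rightChild_iff,
    rightChild_iff, Child.map_iff (S := {k | k ∈ L}) (p := pos L) (T := {k | k ∈ L.map f}) hf,
    Child.map_iff (S := {k | k ∈ L}) (p := fun k => - pos L k) (T := {k | k ∈ L.map f}) hf]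
  · simp
  · intro k hk
    simp only [pos, idxOf_map_of_injOn hinj hk]
  · exact hi
  · exact hj
  · simp
  · intro k hk
    simp only [pos, idxOf_map_of_injOn hinj hk]
  · exact hi
  · exact hj

/-! ### Insertion of a largest integer in a list -/

section InsertMax

variable {A B : List ℕ} {x : ℕ}

theorem pos_insert {k : ℕ} (hk : k ≠ x) :
    (pos (A ++ x :: B) k = pos (A ++ B) k ∧ k ∈ A ∧ pos (A ++ B) k < A.length) ∨
      (pos (A ++ x :: B) k = pos (A ++ B) k + 1 ∧ k ∉ A ∧ A.length ≤ pos (A ++ B) k) := by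
  simp only [pos, List.idxOf_append]
  by_cases h : k ∈ A
  · have := List.idxOf_lt_length_of_mem h
    simpa [h] using this
  · rw [List.idxOf_cons_ne _ hk.symm]
    simp [h]
    omega

theorem pos_inserted (hx : x ∉ A) : pos (A ++ x :: B) x = A.length := by
  simp [pos, List.idxOf_append, hx]

theorem pos_insert_lt_iff {k l : ℕ} (hk : k ≠ x) (hl : l ≠ x) :
    pos (A ++ x :: B) k < pos (A ++ x :: B) l ↔ pos (A ++ B) k < pos (A ++ B) l := by
  have := pos_insert (A := A) (B := B) hk
  have := pos_insert (A := A) (B := B) hl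
  omega

theorem setOf_mem_insert : {k | k ∈ A ++ x :: B} = insert x {k | k ∈ A ++ B} := by
  ext k
  simp only [List.mem_append, List.mem_cons, Set.mem_ofPred_eq, Set.mem_insert_iff]
  tauto

theorem mem_listEdges_insert (hx : ∀ k ∈ A ++ B, k < x) {i c j d : ℕ} :
    ((i, c), (j, d)) ∈ listEdges (A ++ B) ↔
      ((i, c), (j, d)) ∈ listEdges (A ++ x :: B) ∧ j ≠ x := by
  have hxA : x ∉ A := fun h => lt_irrefl x (hx x (List.mem_append_left _ h))
  have key : i ∈ A ++ B → j ∈ A ++ B → (((i, c), (j, d)) ∈ listEdges (A ++ B) ↔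
      ((i, c), (j, d)) ∈ listEdges (A ++ x :: B)) := by
    intro hi hj
    rw [mem_listEdges_iff, mem_listEdges_iff, leftChild_iff, leftChild_iff, rightChild_iff,
      rightChild_iff, setOf_mem_insert,
      Child.insert_max (S := {k | k ∈ A ++ B}) (q := pos (A ++ B)) hx _ hi hj,
      Child.insert_max (S := {k | k ∈ A ++ B}) (q := fun k => -pos (A ++ B) k) hx _ hi hj]
    · intro k hk l hl
      rw [neg_lt_neg_iff, neg_lt_neg_iff]
      exact pos_insert_lt_iff (hx l hl).ne (hx k hk).ne
    · intro k hk l hl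
      exact pos_insert_lt_iff (hx k hk).ne (hx l hl).ne
  have hmem : ∀ k ∈ A ++ x :: B, k ≠ x → k ∈ A ++ B := by
    intro k hk hne
    simp only [List.mem_append, List.mem_cons] at hk ⊢
    tauto
  constructor
  · intro h
    obtain ⟨h1, -, h3, -, -⟩ := listEdges_valid h
    exact ⟨(key h1 h3).1 h, (hx j h3).ne⟩
  · rintro ⟨h, hne⟩
    obtain ⟨h1, -, h3, -, h5⟩ := listEdges_valid h
    have hj := hmem j h3 hne
    have hi := hmem i h1 (h5.trans (hx j hj)).ne
    exact (key hi hj).2 h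

/-- If another integer came first in `B`, it would stand between `x` and its parent. So the edge
into `x` tells where `x` stands in the word. -/
theorem leftChild_max (hx : ∀ k ∈ A ++ B, k < x) (hB : B.Nodup) (hAB : A.Disjoint B) {i : ℕ}
    (h : LeftChild (A ++ x :: B) i x) : ∃ B', B = i :: B' := by
  have hxA : x ∉ A := fun h => lt_irrefl x (hx x (List.mem_append_left _ h))
  rw [leftChild_iff, setOf_mem_insert] at h
  have hb := Child.not_between_max (S := {k | k ∈ A ++ B}) hx h
  have hlt := h.2.2.1.2.2
  have hix : i ≠ x := h.2.1.ne
  have hi := pos_insert (A := A) (B := B) hix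
  have hiAB : i ∈ A ++ B := h.1.resolve_left hix
  rw [pos_inserted hxA] at hlt hb
  have hiA : i ∉ A := by
    rcases hi with hi | hi
    · omega
    · exact hi.2.1
  have hiB : i ∈ B := (List.mem_append.1 hiAB).resolve_left hiA
  cases B with
  | nil => simp at hiB
  | cons b B =>
    refine ⟨B, ?_⟩
    by_contra hne
    have hbi : b ≠ i := fun h => hne (by rw [h])
    have hbmem : b ∈ A ++ b :: B := by simp
    have hbA : b ∉ A := fun h => hAB h (by simp)
    have h2 := pos_insert (A := A) (B := b :: B) (hx b hbmem).ne
    have h3 : pos (A ++ b :: B) b = A.length := pos_inserted hbA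
    have h4 : pos (A ++ b :: B) i ≠ pos (A ++ b :: B) b := fun h =>
      hbi ((pos_injOn _ hiAB hbmem h).symm)
    have := hb b hbmem
    omega

theorem rightChild_max (hx : ∀ k ∈ A ++ B, k < x) (hA : A.Nodup) (hAB : A.Disjoint B) {i : ℕ}
    (h : RightChild (A ++ x :: B) i x) : ∃ A', A = A' ++ [i] := by
  have hxA : x ∉ A := fun h => lt_irrefl x (hx x (List.mem_append_left _ h))
  rw [rightChild_iff, setOf_mem_insert] at h
  have hb := Child.not_between_max (S := {k | k ∈ A ++ B}) hx h
  have hlt := h.2.2.1.2.2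
  have hix : i ≠ x := h.2.1.ne
  have hi := pos_insert (A := A) (B := B) hix
  have hiAB : i ∈ A ++ B := h.1.resolve_left hix
  simp only [pos_inserted hxA, neg_lt_neg_iff] at hlt hb
  have hiA : i ∈ A := by
    rcases hi with hi | hi
    · exact hi.2.1
    · omega
  rcases List.eq_nil_or_concat' A with rfl | ⟨A, b, rfl⟩
  · simp at hiA
  · refine ⟨A, ?_⟩
    by_contra hne
    have hbi : b ≠ i := fun h => hne (by rw [h])
    have hbmem : b ∈ A ++ [b] ++ B := by simp
    have hbA : b ∉ A := by
      rw [List.nodup_append] at hA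
      exact fun h => hA.2.2 b h b (by simp) rfl
    have h2 := pos_insert (A := A ++ [b]) (B := B) (hx b hbmem).ne
    have h3 : pos (A ++ [b] ++ B) b = A.length := by
      rw [List.append_assoc]
      exact pos_inserted hbA
    have h4 : pos (A ++ [b] ++ B) i ≠ pos (A ++ [b] ++ B) b := fun h =>
      hbi ((pos_injOn _ hiAB hbmem h).symm)
    have := hb b hbmem
    simp only [List.length_append, List.length_singleton, Nat.cast_add, Nat.cast_one] at *
    omega

theorem leftChild_insert {i : ℕ} (hx : ∀ k ∈ A ++ i :: B, k < x) (hiA : i ∉ A)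
    (hno : ∀ j, ¬ LeftChild (A ++ i :: B) i j) : LeftChild (A ++ x :: i :: B) i x := by
  have hxA : x ∉ A := fun h => lt_irrefl x (hx x (List.mem_append_left _ h))
  have hi : i ∈ A ++ i :: B := by simp
  have h1 := pos_insert (A := A) (B := i :: B) (hx i hi).ne
  have h2 : pos (A ++ i :: B) i = A.length := pos_inserted hiA
  rw [leftChild_iff, setOf_mem_insert]
  refine Child.of_not_between (S := {k | k ∈ A ++ i :: B}) (q := pos (A ++ i :: B)) hx ?_ ?_ hi
    (fun j h => hno j (leftChild_iff.2 h)) ?_ ?_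
  · exact fun k hk l hl => pos_insert_lt_iff (hx k hk).ne (hx l hl).ne
  · rw [← setOf_mem_insert]
    exact pos_injOn _
  · rw [pos_inserted hxA]
    omega
  · intro k hk
    have := pos_insert (A := A) (B := i :: B) (hx k hk).ne
    rw [pos_inserted hxA]
    omega

theorem rightChild_insert {i : ℕ} (hx : ∀ k ∈ A ++ i :: B, k < x) (hiA : i ∉ A)
    (hno : ∀ j, ¬ RightChild (A ++ i :: B) i j) : RightChild (A ++ i :: x :: B) i x := by
  have e1 : A ++ i :: B = (A ++ [i]) ++ B := by simp
  have e2 : A ++ i :: x :: B = (A ++ [i]) ++ x :: B := by simp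
  have h2 : pos (A ++ i :: B) i = A.length := pos_inserted hiA
  have hi : i ∈ A ++ i :: B := by simp
  rw [e1] at hx hno h2 hi
  rw [e2]
  have hxA : x ∉ A ++ [i] := fun h => lt_irrefl x (hx x (List.mem_append_left _ h))
  have h1 := pos_insert (A := A ++ [i]) (B := B) (hx i hi).ne
  rw [rightChild_iff, setOf_mem_insert]
  refine Child.of_not_between (S := {k | k ∈ (A ++ [i]) ++ B})
    (q := fun k => -pos ((A ++ [i]) ++ B) k) hx ?_ ?_ hi
    (fun j h => hno j (rightChild_iff.2 h)) ?_ ?_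
  · intro k hk l hl
    rw [neg_lt_neg_iff, neg_lt_neg_iff]
    exact pos_insert_lt_iff (hx l hl).ne (hx k hk).ne
  · rw [← setOf_mem_insert]
    exact fun k hk l hl h => pos_injOn _ hk hl (neg_injective h)
  · rw [pos_inserted hxA]
    simp only [List.length_append, List.length_singleton, Nat.cast_add, Nat.cast_one] at *
    omega
  · intro k hk
    have := pos_insert (A := A ++ [i]) (B := B) (hx k hk).ne
    rw [pos_inserted hxA]
    simp only [List.length_append, List.length_singleton, Nat.cast_add, Nat.cast_one] at *
    omega

end InsertMax

theorem append_cons_inj {A B A' B' : List ℕ} {i : ℕ} (h : (A ++ i :: B).Nodup)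
    (he : A ++ i :: B = A' ++ i :: B') : A = A' ∧ B = B' := by
  induction A generalizing A' with
  | nil =>
    cases A' with
    | nil => simpa using he
    | cons a A' =>
      simp only [List.nil_append, List.cons_append, List.cons.injEq] at he h
      rw [he.2, List.nodup_cons] at h
      simp at h
  | cons a A ih =>
    cases A' with
    | nil =>
      simp only [List.nil_append, List.cons_append, List.cons.injEq] at he h
      rw [he.1, List.nodup_cons] at h
      simp at h
    | cons a' A' =>
      simp only [List.cons_append, List.cons.injEq] at he h
      obtain ⟨h1, h2⟩ := ih (List.nodup_cons.1 h).2 he.2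
      exact ⟨by rw [he.1, h1], h2⟩

/-- Induction on the length: without their common largest integer the two lists have equal edges, so
they coincide, and the edge into this integer determines the place of insertion. -/
theorem listEdges_injective {L L' : List ℕ} (hL : L.Nodup) (hL' : L'.Nodup)
    (hmem : ∀ k, k ∈ L ↔ k ∈ L') (he : listEdges L = listEdges L') : L = L' := by
  induction hn : L.length generalizing L L' with
  | zero =>
    rw [List.length_eq_zero_iff] at hn
    subst hn
    symm
    rw [List.eq_nil_iff_forall_not_mem]
    exact fun k hk => List.not_mem_nil ((hmem k).2 hk)
  | succ n ih =>
    have hne : L.toFinset.Nonempty := by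
      rw [List.toFinset_nonempty_iff]
      rintro rfl
      simp at hn
    obtain ⟨x, hx⟩ : ∃ x, x = L.toFinset.max' hne := ⟨_, rfl⟩
    have hxL : x ∈ L := List.mem_toFinset.1 (hx ▸ max'_mem _ hne)
    have hmax : ∀ k ∈ L, k ≤ x := fun k hk => hx ▸ le_max' _ _ (List.mem_toFinset.2 hk)
    clear hx
    obtain ⟨A, B, rfl⟩ := List.append_of_mem hxL
    obtain ⟨A', B', rfl⟩ := List.append_of_mem ((hmem x).1 hxL)
    have d1 := List.nodup_middle.1 hL
    have d2 := List.nodup_middle.1 hL'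
    rw [List.nodup_cons] at d1 d2
    have m1 : ∀ k ∈ A ++ B, k < x := fun k hk => by
      have h1 : k ≠ x := fun h => d1.1 (h ▸ hk)
      have := hmax k (by
        simp only [List.mem_append, List.mem_cons] at hk ⊢
        tauto)
      omega
    have hmem' : ∀ k, k ∈ A ++ B ↔ k ∈ A' ++ B' := by
      intro k
      by_cases hk : k = x
      · subst hk
        exact iff_of_false d1.1 d2.1
      · have := hmem k
        simp only [List.mem_append, List.mem_cons, hk, false_or] at this ⊢
        exact this
    have m2 : ∀ k ∈ A' ++ B', k < x := fun k hk => m1 k ((hmem' k).2 hk)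
    have hAB : A ++ B = A' ++ B' := by
      refine ih d1.2 d2.2 hmem' ?_ ?_
      · ext ⟨⟨i, c⟩, ⟨j, d⟩⟩
        rw [mem_listEdges_insert m1, mem_listEdges_insert m2, he]
      · simp only [List.length_append, List.length_cons] at hn ⊢
        omega
    have n1 := d1.2
    have n2 := d2.2
    rw [List.nodup_append'] at n1 n2
    by_cases h0 : A ++ B = []
    · rw [h0] at hAB
      obtain ⟨rfl, rfl⟩ := List.append_eq_nil_iff.1 h0
      obtain ⟨rfl, rfl⟩ := List.append_eq_nil_iff.1 hAB.symm
      rfl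
    · obtain ⟨u, hu⟩ := List.exists_mem_of_ne_nil _ h0
      have hu' : u ∈ A ++ x :: B := by
        simp only [List.mem_append, List.mem_cons] at hu ⊢
        tauto
      -- The same edge ends at `x` in both lists, so `x` stands on the same side of the same
      -- neighbour `i` in both.
      obtain ⟨i, hi, c, h⟩ := exists_parent_listEdges hu' hxL (m1 u hu)
      have h' := h
      rw [he] at h'
      rw [mem_listEdges_iff] at h h'
      obtain ⟨-, ⟨rfl, h⟩ | ⟨rfl, h⟩⟩ := h
      · obtain ⟨B, rfl⟩ := leftChild_max m1 n1.2.1 n1.2.2 h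
        obtain ⟨B', rfl⟩ := leftChild_max m2 n2.2.1 n2.2.2 (by simpa using h')
        obtain ⟨rfl, rfl⟩ := append_cons_inj d1.2 hAB
        rfl
      · obtain ⟨A, rfl⟩ := rightChild_max m1 n1.1 n1.2.2 h
        obtain ⟨A', rfl⟩ := rightChild_max m2 n2.1 n2.2.2 (by simpa using h')
        rw [List.append_assoc, List.append_assoc, List.singleton_append,
          List.singleton_append] at hAB
        have d3 := d1.2
        rw [List.append_assoc, List.singleton_append] at d3
        obtain ⟨rfl, rfl⟩ := append_cons_inj d3 hAB
        rfl

theorem listEdges_singleton (x : ℕ) : listEdges [x] = ∅ := by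
  rw [eq_empty_iff_forall_notMem]
  intro e he
  obtain ⟨h1, -, h2, -, h3⟩ := listEdges_valid he
  rw [List.mem_singleton] at h1 h2
  omega

/-- Insertion of a new largest integer `x` in a list, as a child of `i`. -/
theorem exists_insert {L : List ℕ} (hL : L.Nodup) {x i c : ℕ} (hx : ∀ k ∈ L, k < x) (hi : i ∈ L)
    (hc : c = 1 ∨ c = 2) (hno : ∀ j, ((i, c), (j, 1)) ∉ listEdges L) :
    ∃ L' : List ℕ, L'.Nodup ∧ (∀ k, k ∈ L' ↔ k = x ∨ k ∈ L) ∧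
      listEdges L' = insert ((i, c), (x, 1)) (listEdges L) := by
  obtain ⟨A, B, rfl⟩ := List.append_of_mem hi
  have hxL : x ∉ A ++ i :: B := fun h => lt_irrefl x (hx x h)
  have hiA : i ∉ A := fun h => (List.nodup_cons.1 (List.nodup_middle.1 hL)).1
    (List.mem_append_left _ h)
  have key : ∀ A' B' : List ℕ, A' ++ B' = A ++ i :: B →
      ((i, c), (x, 1)) ∈ listEdges (A' ++ x :: B') → ∃ L' : List ℕ, L'.Nodup ∧
        (∀ k, k ∈ L' ↔ k = x ∨ k ∈ A ++ i :: B) ∧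
        listEdges L' = insert ((i, c), (x, 1)) (listEdges (A ++ i :: B)) := by
    intro A' B' h he
    rw [← h] at hx hL hxL ⊢
    refine ⟨A' ++ x :: B', List.nodup_middle.2 (List.nodup_cons.2 ⟨hxL, hL⟩), fun k => ?_, ?_⟩
    · simp only [List.mem_append, List.mem_cons]
      tauto
    · ext ⟨⟨i', c'⟩, ⟨j, d⟩⟩
      rw [mem_insert, mem_listEdges_insert hx]
      constructor
      · intro h
        by_cases hj : j = x
        · left
          have hd : d = 1 := (mem_listEdges_iff.1 h).1
          subst hj hd
          exact listEdges_in h he rfl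
        · exact Or.inr ⟨h, hj⟩
      · rintro (h | h)
        · rw [h]
          exact he
        · exact h.1
  rcases hc with rfl | rfl
  · exact key A (i :: B) rfl (mem_listEdges_iff.2 ⟨rfl, Or.inl ⟨rfl, leftChild_insert hx hiA
      fun j h => hno j (mem_listEdges_iff.2 ⟨rfl, Or.inl ⟨rfl, h⟩⟩)⟩⟩)
  · refine key (A ++ [i]) B (by simp) (mem_listEdges_iff.2 ⟨rfl, Or.inr ⟨rfl, ?_⟩⟩)
    have := rightChild_insert hx hiA
      fun j h => hno j (mem_listEdges_iff.2 ⟨rfl, Or.inr ⟨rfl, h⟩⟩)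
    simpa using this

/-- A set of edges in which each half-edge occurs at most once comes from a set of lists. -/
theorem exists_lists (U : Finset ℕ) : ∀ E : Finset ((ℕ × ℕ) × (ℕ × ℕ)),
    (∀ e ∈ E, e.1.1 ∈ U ∧ (e.1.2 = 1 ∨ e.1.2 = 2) ∧ e.2.1 ∈ U ∧ e.2.2 = 1 ∧ e.1.1 < e.2.1) →
    (∀ e ∈ E, ∀ f ∈ E, e.1 = f.1 → e = f) → (∀ e ∈ E, ∀ f ∈ E, e.2 = f.2 → e = f) →
    ∃ S : Finset (List ℕ), (∀ L ∈ S, L ≠ []) ∧ (∀ L ∈ S, L.Nodup) ∧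
      (∀ L ∈ S, ∀ L' ∈ S, ∀ x, x ∈ L → x ∈ L' → L = L') ∧ (∀ x, (∃ L ∈ S, x ∈ L) ↔ x ∈ U) ∧
      S.biUnion listEdges = E := by
  induction U using Finset.induction_on_max with
  | empty =>
    intro E h _ _
    refine ⟨∅, by simp, by simp, by simp, by simp, ?_⟩
    rw [biUnion_empty, eq_comm, eq_empty_iff_forall_notMem]
    exact fun e he => notMem_empty _ (h e he).1
  | insert x U hx ih =>
    intro E hE h1 h2
    -- As `x` is the largest vertex, no edge starts there; dropping the edge that ends at `x` leaves
    -- edges inside `U`.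
    have hsub : filter (fun e => e.2.1 ≠ x) E ⊆ E := filter_subset _ _
    obtain ⟨S, s1, s2, s3, s4, s5⟩ := ih {e ∈ E | e.2.1 ≠ x} (fun e he => by
        obtain ⟨he, hne⟩ := mem_filter.1 he
        obtain ⟨a1, a2, a3, a4, a5⟩ := hE e he
        have a6 := (mem_insert.1 a3).resolve_left hne
        have := hx _ a6
        exact ⟨(mem_insert.1 a1).resolve_left (by omega), a2, a6, a4, a5⟩)
      (fun e he f hf => h1 e (hsub he) f (hsub hf)) (fun e he f hf => h2 e (hsub he) f (hsub hf))
    have hxS : ∀ L ∈ S, x ∉ L := fun L hL h => lt_irrefl x (hx x ((s4 x).1 ⟨L, hL, h⟩))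
    -- If `x` has a parent `i`, it is inserted beside `i` in the list of `i`. The slot `c` is free
    -- there, since `E` has no second edge with the same outer half-edge.
    by_cases hex : ∃ i c, ((i, c), (x, 1)) ∈ E
    · obtain ⟨i, c, he⟩ := hex
      obtain ⟨a1, a2, -, -, a5⟩ := hE _ he
      obtain ⟨L, hL, hiL⟩ := (s4 i).2 ((mem_insert.1 a1).resolve_left a5.ne)
      obtain ⟨L', l1, l2, l3⟩ := exists_insert (s2 L hL) (fun k hk => hx k ((s4 k).1 ⟨L, hL, hk⟩))
        hiL a2 (fun j h => by
          have h3 : ((i, c), (j, 1)) ∈ S.biUnion listEdges := mem_biUnion.2 ⟨L, hL, h⟩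
          rw [s5, mem_filter] at h3
          exact h3.2 (congrArg (fun e => e.2.1) (h1 _ h3.1 _ he rfl)))
      have hother : ∀ K ∈ S.erase L, ∀ y ∈ K, y ∉ L' := by
        intro K hK y hy hyL
        rw [mem_erase] at hK
        rcases (l2 y).1 hyL with rfl | h
        · exact hxS K hK.2 hy
        · exact hK.1 (s3 K hK.2 L hL y hy h)
      refine ⟨insert L' (S.erase L), ?_, ?_, ?_, ?_, ?_⟩
      · intro K hK
        rcases mem_insert.1 hK with rfl | hK
        · exact List.ne_nil_of_mem ((l2 x).2 (Or.inl rfl))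
        · exact s1 K (mem_of_mem_erase hK)
      · intro K hK
        rcases mem_insert.1 hK with rfl | hK
        · exact l1
        · exact s2 K (mem_of_mem_erase hK)
      · intro K hK K' hK' y hy hy'
        rcases mem_insert.1 hK with h | hK <;> rcases mem_insert.1 hK' with h' | hK'
        · rw [h, h']
        · exact absurd (h ▸ hy) (hother _ hK' y hy')
        · exact absurd (h' ▸ hy') (hother _ hK y hy)
        · exact s3 K (mem_of_mem_erase hK) K' (mem_of_mem_erase hK') y hy hy'
      · intro y
        rw [mem_insert, ← s4 y]
        constructor
        · rintro ⟨K, hK, hy⟩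
          rcases mem_insert.1 hK with rfl | hK
          · exact ((l2 y).1 hy).imp_right fun h => ⟨L, hL, h⟩
          · exact Or.inr ⟨K, mem_of_mem_erase hK, hy⟩
        · rintro (rfl | ⟨K, hK, hy⟩)
          · exact ⟨L', mem_insert_self _ _, (l2 y).2 (Or.inl rfl)⟩
          · by_cases hKL : K = L
            · subst hKL
              exact ⟨L', mem_insert_self _ _, (l2 y).2 (Or.inr hy)⟩
            · exact ⟨K, mem_insert_of_mem (mem_erase.2 ⟨hKL, hK⟩), hy⟩
      · rw [biUnion_insert, l3, insert_union, ← biUnion_insert, insert_erase hL, s5]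
        ext e
        rw [mem_insert, mem_filter]
        constructor
        · rintro (rfl | h)
          · exact he
          · exact h.1
        · intro h
          by_cases hx : e.2.1 = x
          · exact Or.inl (h2 _ h _ he (Prod.ext hx (hE e h).2.2.2.1))
          · exact Or.inr ⟨h, hx⟩
    -- Without a parent `x` is an isolated vertex, and it becomes a list of its own.
    · refine ⟨insert [x] S, ?_, ?_, ?_, ?_, ?_⟩
      · intro K hK
        rcases mem_insert.1 hK with rfl | hK
        · simp
        · exact s1 K hK
      · intro K hK
        rcases mem_insert.1 hK with rfl | hK
        · simp
        · exact s2 K hK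
      · intro K hK K' hK' y hy hy'
        rcases mem_insert.1 hK with rfl | hK <;> rcases mem_insert.1 hK' with rfl | hK'
        · rfl
        · rw [List.mem_singleton] at hy
          exact absurd (hy ▸ hy') (hxS K' hK')
        · rw [List.mem_singleton] at hy'
          exact absurd (hy' ▸ hy) (hxS K hK)
        · exact s3 K hK K' hK' y hy hy'
      · intro y
        rw [mem_insert, ← s4 y]
        constructor
        · rintro ⟨K, hK, hy⟩
          rcases mem_insert.1 hK with rfl | hK
          · exact Or.inl (List.mem_singleton.1 hy)
          · exact Or.inr ⟨K, hK, hy⟩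
        · rintro (rfl | ⟨K, hK, hy⟩)
          · exact ⟨[y], mem_insert_self _ _, List.mem_singleton.2 rfl⟩
          · exact ⟨K, mem_insert_of_mem hK, hy⟩
      · rw [biUnion_insert, listEdges_singleton, empty_union, s5, filter_true_of_mem]
        intro e he hx
        refine hex ⟨e.1.1, e.1.2, ?_⟩
        have : e = ((e.1.1, e.1.2), (x, 1)) := Prod.ext rfl (Prod.ext hx (hE e he).2.2.2.1)
        exact this ▸ he

/-! ### The diagram of a set partition into lists -/

/-- A set that no edge of the list leaves contains all integers of the list or none. -/
theorem mem_iff_of_closed {L : List ℕ} {S : Set ℕ}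
    (hS : ∀ i c j d, ((i, c), (j, d)) ∈ listEdges L → (i ∈ S ↔ j ∈ S)) {u v : ℕ} (hu : u ∈ L)
    (hv : v ∈ L) : u ∈ S ↔ v ∈ S := by
  have hne : L.toFinset.Nonempty := ⟨u, List.mem_toFinset.2 hu⟩
  have hm := min'_mem L.toFinset hne
  suffices h : ∀ v ∈ L, v ∈ S ↔ L.toFinset.min' hne ∈ S from (h u hu).trans (h v hv).symm
  intro v
  induction v using Nat.strong_induction_on with
  | _ v ih =>
    intro hv
    rcases (min'_le L.toFinset v (List.mem_toFinset.2 hv)).eq_or_lt with h | h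
    · rw [h]
    · obtain ⟨i, hi, c, he⟩ := exists_parent_listEdges (List.mem_toFinset.1 hm) hv h
      rw [← hS i c v 1 he]
      exact ih i (listEdges_valid he).2.2.2.2 hi

namespace ListPartition

theorem mem_support_iff {E : Finset (List ℕ)} {x : ℕ} : x ∈ support E ↔ ∃ L ∈ E, x ∈ L := by
  simp [support]

theorem support_lists (P : ListPartition) : support P.lists = Icc 1 P.n := by
  ext x
  rw [mem_support_iff, P.mem_iff]

theorem support_mono {E F : Finset (List ℕ)} (h : E ⊆ F) : support E ⊆ support F :=
  biUnion_subset_biUnion_of_subset_left _ h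

theorem support_subset {P : ListPartition} {E : Finset (List ℕ)} (h : E ⊆ P.lists) :
    support E ⊆ Icc 1 P.n := P.support_lists ▸ support_mono h

theorem mem_of_mem_support {P : ListPartition} {E : Finset (List ℕ)} (hE : E ⊆ P.lists)
    {L : List ℕ} (hL : L ∈ P.lists) {x : ℕ} (hx : x ∈ L) (h : x ∈ support E) : L ∈ E := by
  obtain ⟨K, hK, hxK⟩ := mem_support_iff.1 h
  exact P.disjoint K (hE hK) L hL x hxK hx ▸ hK

theorem support_sdiff (P : ListPartition) {E : Finset (List ℕ)} (hE : E ⊆ P.lists) :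
    support (P.lists \ E) = Icc 1 P.n \ support E := by
  ext x
  rw [mem_sdiff, mem_support_iff, ← P.mem_iff]
  constructor
  · rintro ⟨L, hL, hx⟩
    rw [mem_sdiff] at hL
    exact ⟨⟨L, hL.1, hx⟩, fun h => hL.2 (mem_of_mem_support hE hL.1 hx h)⟩
  · rintro ⟨⟨L, hL, hx⟩, h⟩
    exact ⟨L, mem_sdiff.2 ⟨hL, fun hLE => h (mem_support hLE hx)⟩, hx⟩

theorem eq_of_lists {P Q : ListPartition} (h : P.lists = Q.lists) : P = Q := by
  refine ListPartition.ext ?_ h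
  have h1 := P.support_lists
  rw [h, Q.support_lists] at h1
  have := congrArg card h1
  simpa using this.symm

/-- The standardization, with a default value if `E` is not a set of lists of `P`. -/
def restr (P : ListPartition) (E : Finset (List ℕ)) : ListPartition :=
  if h : E ⊆ P.lists then P.std E h else empty

theorem restr_eq_std (P : ListPartition) {E : Finset (List ℕ)} (h : E ⊆ P.lists) :
    P.restr E = P.std E h := dif_pos h

theorem restr_n (P : ListPartition) {E : Finset (List ℕ)} (h : E ⊆ P.lists) :
    (P.restr E).n = #(support E) := by
  rw [restr_eq_std P h]
  rfl

theorem restr_lists (P : ListPartition) {E : Finset (List ℕ)} (h : E ⊆ P.lists) :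
    (P.restr E).lists = E.image (List.map (rank (support E))) := by
  rw [restr_eq_std P h]
  rfl

theorem restr_card (P : ListPartition) {E : Finset (List ℕ)} (h : E ⊆ P.lists) :
    #(P.restr E).lists = #E := by
  rw [restr_lists P h, card_image_of_injOn]
  intro L hL K hK he
  obtain ⟨x, hx⟩ := List.exists_mem_of_ne_nil _ (P.ne_nil L (h hL))
  have h1 : rank (support E) x ∈ K.map (rank (support E)) := by
    rw [← he]
    exact List.mem_map_of_mem hx
  obtain ⟨y, hy, hxy⟩ := List.mem_map.1 h1
  obtain rfl := rank_injOn _ (mem_support hK hy) (mem_support hL hx) hxy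
  exact P.disjoint L (h hL) K (h hK) y hx hy

theorem eq_empty {P : ListPartition} (h : P.n = 0) : P = empty := by
  refine ListPartition.ext h ?_
  refine (Finset.eq_empty_iff_forall_notMem.2 fun L hL => ?_ : P.lists = ∅)
  obtain ⟨x, hx⟩ := List.exists_mem_of_ne_nil _ (P.ne_nil L hL)
  have := (P.mem_iff x).1 ⟨L, hL, hx⟩
  rw [h] at this
  simp at this

theorem restr_self (P : ListPartition) : P.restr P.lists = P := by
  refine eq_of_lists ?_
  rw [restr_lists P subset_rfl, support_lists]
  conv_rhs => rw [← image_id (s := P.lists)]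
  refine image_congr fun L hL => ?_
  rw [id]
  conv_rhs => rw [← List.map_id L]
  refine List.map_congr_left fun x hx => ?_
  rw [rank_Icc ((P.mem_iff x).1 ⟨L, hL, hx⟩)]
  rfl

theorem restr_empty (P : ListPartition) : P.restr ∅ = empty :=
  eq_empty (P.restr_n (empty_subset _))

end ListPartition

open ListPartition BDiagram

theorem mem_mDiag_edges {P : ListPartition} {e} : e ∈ (mDiag P).edges ↔
    ∃ L ∈ P.lists, e ∈ listEdges L := mem_biUnion

theorem mDiag_n (P : ListPartition) : (mDiag P).n = P.n := rfl

theorem mem_listEdges_of_fst {P : ListPartition} {e} (he : e ∈ (mDiag P).edges) {L : List ℕ}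
    (hL : L ∈ P.lists) (h : e.1.1 ∈ L) : e ∈ listEdges L := by
  obtain ⟨K, hK, heK⟩ := mem_mDiag_edges.1 he
  exact P.disjoint K hK L hL _ (listEdges_valid heK).1 h ▸ heK

theorem mem_listEdges_of_snd {P : ListPartition} {e} (he : e ∈ (mDiag P).edges) {L : List ℕ}
    (hL : L ∈ P.lists) (h : e.2.1 ∈ L) : e ∈ listEdges L := by
  obtain ⟨K, hK, heK⟩ := mem_mDiag_edges.1 he
  exact P.disjoint K hK L hL _ (listEdges_valid heK).2.2.1 h ▸ heK

theorem mem_list_iff {P : ListPartition} {i c j d : ℕ} (he : ((i, c), (j, d)) ∈ (mDiag P).edges)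
    {L : List ℕ} (hL : L ∈ P.lists) : i ∈ L ↔ j ∈ L :=
  ⟨fun h => (listEdges_valid (mem_listEdges_of_fst he hL h)).2.2.1,
    fun h => (listEdges_valid (mem_listEdges_of_snd he hL h)).1⟩

/-- No edge leaves the integers of a list, and those of one list are connected. So equal diagrams
force the same blocks, and inside a block `listEdges_injective` applies. -/
theorem mDiag_injective : Function.Injective mDiag := by
  have sub : ∀ P Q : ListPartition, mDiag P = mDiag Q → ∀ L ∈ P.lists, ∃ K ∈ Q.lists,
      ∀ x ∈ L, x ∈ K := by
    intro P Q h L hL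
    obtain ⟨u, hu⟩ := List.exists_mem_of_ne_nil _ (P.ne_nil L hL)
    have hn : P.n = Q.n := congrArg BDiagram.n h
    obtain ⟨K, hK, huK⟩ := (Q.mem_iff u).2 (hn ▸ (P.mem_iff u).1 ⟨L, hL, hu⟩)
    refine ⟨K, hK, fun x hx => ?_⟩
    refine (mem_iff_of_closed (S := {k | k ∈ K}) (fun i c j d he => ?_) hu hx).1 huK
    have he' : ((i, c), (j, d)) ∈ (mDiag Q).edges := h ▸ mem_mDiag_edges.2 ⟨L, hL, he⟩
    exact mem_list_iff he' hK
  have key : ∀ P Q : ListPartition, mDiag P = mDiag Q → P.lists ⊆ Q.lists := by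
    intro P Q h L hL
    obtain ⟨K, hK, h1⟩ := sub P Q h L hL
    obtain ⟨L', hL', h2⟩ := sub Q P h.symm K hK
    obtain ⟨u, hu⟩ := List.exists_mem_of_ne_nil _ (P.ne_nil L hL)
    obtain rfl := P.disjoint L hL L' hL' u hu (h2 u (h1 u hu))
    have : L = K := by
      refine listEdges_injective (P.nodup L hL) (Q.nodup K hK) (fun k => ⟨h1 k, h2 k⟩) ?_
      ext e
      constructor
      · intro he
        exact mem_listEdges_of_fst (h ▸ mem_mDiag_edges.2 ⟨L, hL, he⟩) hK
          (h1 _ (listEdges_valid he).1)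
      · intro he
        exact mem_listEdges_of_fst (h.symm ▸ mem_mDiag_edges.2 ⟨K, hK, he⟩) hL
          (h2 _ (listEdges_valid he).1)
    exact this ▸ hK
  intro P Q h
  exact eq_of_lists (subset_antisymm (key P Q h) (key Q P h.symm))

theorem mDiag_mem_G21 (P : ListPartition) : mDiag P ∈ G21 := ⟨fun _ hi => if_pos hi, rfl, rfl⟩

theorem ext_G21 {G K : BDiagram} (hG : G ∈ G21) (hK : K ∈ G21) (hn : G.n = K.n)
    (he : G.edges = K.edges) : G = K := by
  obtain ⟨g1, g2, g3⟩ := hG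
  obtain ⟨k1, k2, k3⟩ := hK
  refine ext_of_agree hn (fun i hi => (g1 i hi).trans (k1 i (hn ▸ hi)).symm) ?_ ?_ ?_
  · intro i _ p
    rw [g2, k2, hn]
  · intro i _ p
    rw [g3, k3, hn]
  · intro i _ j _ _ p q
    rw [he]

theorem exists_mDiag_eq {G : BDiagram} (hG : G ∈ G21) : ∃ P, mDiag P = G := by
  have hG' := hG
  obtain ⟨g1, g2, g3⟩ := hG
  obtain ⟨S, s1, s2, s3, s4, s5⟩ := exists_lists (Icc 1 G.n) G.edges (fun e he => by
    obtain ⟨h1, h2, h3⟩ := G.edges_valid e he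
    rw [g2, mem_product, mem_insert, mem_singleton] at h1
    rw [g3, mem_product, mem_singleton] at h2
    exact ⟨h1.1, h1.2, h2.1, h2.2, h3⟩) G.out_unique G.in_unique
  let P : ListPartition := ⟨G.n, S, s1, s2, s3, s4⟩
  exact ⟨P, ext_G21 (mDiag_mem_G21 P) hG' rfl s5⟩

theorem bijOn_mDiag : Set.BijOn mDiag Set.univ G21 :=
  ⟨fun P _ => mDiag_mem_G21 P, mDiag_injective.injOn, fun _ hG => by
    obtain ⟨P, hP⟩ := exists_mDiag_eq hG
    exact ⟨P, Set.mem_univ _, hP⟩⟩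

/-! ### The diagram of a permutation -/

theorem mem_permWord_iff {n : ℕ} {s : Equiv.Perm (Fin n)} {x : ℕ} :
    x ∈ permWord s ↔ x ∈ Icc 1 n := by
  refine ⟨mem_permWord, fun hx => ?_⟩
  rw [mem_Icc] at hx
  refine List.mem_ofFn.2 ⟨s.symm ⟨x - 1, by omega⟩, ?_⟩
  simp
  omega

theorem permWord_nodup {n : ℕ} (s : Equiv.Perm (Fin n)) : (permWord s).Nodup := by
  refine List.nodup_ofFn.2 fun a b h => ?_
  simpa [Fin.val_inj] using h

theorem exists_permWord_eq {n : ℕ} {L : List ℕ} (hL : L.Nodup) (hmem : ∀ x, x ∈ L ↔ x ∈ Icc 1 n) :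
    ∃ s : Equiv.Perm (Fin n), permWord s = L := by
  have hlen : L.length = n := by
    have : L.toFinset = Icc 1 n := by
      ext x
      rw [List.mem_toFinset, hmem]
    rw [← List.toFinset_card_of_nodup hL, this, Nat.card_Icc]
    omega
  have hval : ∀ k : Fin n, L[(k : ℕ)]'(by omega) ∈ Icc 1 n := fun k =>
    (hmem _).1 (List.getElem_mem _)
  let f : Fin n → Fin n := fun k => ⟨L[(k : ℕ)]'(by omega) - 1, by
    have := mem_Icc.1 (hval k)
    omega⟩
  have hf : Function.Injective f := by
    intro a b hab
    have h1 := mem_Icc.1 (hval a)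
    have h2 := mem_Icc.1 (hval b)
    have h3 : L[(a : ℕ)]'(by omega) - 1 = L[(b : ℕ)]'(by omega) - 1 := congrArg Fin.val hab
    have h4 : L[(a : ℕ)]'(by omega) = L[(b : ℕ)]'(by omega) := by omega
    exact Fin.ext ((List.Nodup.getElem_inj_iff hL).1 h4)
  refine ⟨Equiv.ofBijective f (Finite.injective_iff_bijective.1 hf), ?_⟩
  refine List.ext_getElem (by simp [permWord, hlen]) fun k h1 h2 => ?_
  have := mem_Icc.1 (hval ⟨k, by omega⟩)
  simp only [permWord, List.getElem_ofFn, Equiv.ofBijective_apply, f]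
  simp only at this
  omega

theorem mPerm_mem_G21 {n : ℕ} (s : Equiv.Perm (Fin n)) : mPerm s ∈ G21 :=
  ⟨fun _ hi => if_pos hi, rfl, rfl⟩

theorem mPerm_edges {n : ℕ} (s : Equiv.Perm (Fin n)) : (mPerm s).edges = listEdges (permWord s) :=
  rfl

theorem mPerm_connected {n : ℕ} (s : Equiv.Perm (Fin n)) : (mPerm s).Connected := by
  intro i hi j hj
  refine (mem_iff_of_closed (L := permWord s)
    (S := {v | Relation.ReflTransGen (mPerm s).Adj i v}) (fun a c b d he => ?_)
    (mem_permWord_iff.2 hi) (mem_permWord_iff.2 hj)).1 Relation.ReflTransGen.refl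
  exact ⟨fun h => h.tail ⟨_, he, Or.inl ⟨rfl, rfl⟩⟩, fun h => h.tail ⟨_, he, Or.inr ⟨rfl, rfl⟩⟩⟩

/-- A connected non-empty diagram comes from a partition whose list containing `1` is closed under
adjacency, hence contains all vertices; this list is the word of the permutation. -/
theorem bijOn_mPerm (n : ℕ) : Set.BijOn (fun s : Equiv.Perm (Fin n) => mPerm s) Set.univ
    {G | G ∈ G21 ∧ G.Connected ∧ G.n = n} := by
  refine ⟨fun s _ => ⟨mPerm_mem_G21 s, mPerm_connected s, rfl⟩, fun s _ t _ h => ?_, ?_⟩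
  · have h1 : permWord s = permWord t := listEdges_injective (permWord_nodup s) (permWord_nodup t)
      (fun k => mem_permWord_iff.trans mem_permWord_iff.symm) (congrArg BDiagram.edges h)
    have h2 := List.ofFn_injective h1
    refine Equiv.ext fun k => Fin.ext ?_
    simpa using congrFun h2 k
  · rintro G ⟨hG, hc, rfl⟩
    -- The empty diagram counts as connected, but its partition has no list, so it is treated apart.
    rcases Nat.eq_zero_or_pos G.n with h0 | h0
    · exact ⟨1, Set.mem_univ _, (BDiagram.eq_empty (K := mPerm 1) h0).trans (BDiagram.eq_empty h0).symm⟩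
    · obtain ⟨P, rfl⟩ := exists_mDiag_eq hG
      have h1 : 1 ∈ Icc 1 P.n := mem_Icc.2 ⟨le_rfl, h0⟩
      obtain ⟨L, hL, h1L⟩ := (P.mem_iff 1).2 h1
      have hall : ∀ v ∈ Icc 1 P.n, v ∈ L := by
        intro v hv
        have := hc 1 h1 v hv
        induction this with
        | refl => exact h1L
        | tail _ h ih =>
          obtain ⟨⟨⟨i, c⟩, ⟨j, d⟩⟩, he, ⟨rfl, rfl⟩ | ⟨rfl, rfl⟩⟩ := h
          · exact (mem_list_iff he hL).1 (ih (BDiagram.edge_fst _ he))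
          · exact (mem_list_iff he hL).2 (ih (BDiagram.edge_snd _ he))
      obtain ⟨s, hs⟩ := exists_permWord_eq (n := P.n) (P.nodup L hL)
        fun x => ⟨fun hx => (P.mem_iff x).1 ⟨L, hL, hx⟩, hall x⟩
      refine ⟨s, Set.mem_univ _, ext_G21 (mPerm_mem_G21 s) hG rfl ?_⟩
      change (mPerm s).edges = _
      rw [mPerm_edges]
      ext e
      rw [hs, mem_mDiag_edges]
      exact ⟨fun h => ⟨L, hL, h⟩, fun ⟨K, hK, he⟩ => mem_listEdges_of_fst
        (mem_mDiag_edges.2 ⟨K, hK, he⟩) hL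
        (hall _ ((P.mem_iff _).1 ⟨K, hK, (listEdges_valid he).1⟩))⟩

/-! ### The coproduct of the diagram of a set partition into lists -/

/-- Restriction renumbers vertices by rank just as standardization relabels integers, and edges
depend only on relative order. -/
theorem mDiag_res (P : ListPartition) {E : Finset (List ℕ)} (hE : E ⊆ P.lists) :
    (mDiag P).res (support E) = mDiag (P.restr E) := by
  have hU := support_subset hE
  have hn := P.restr_n hE
  refine Emb.res_eq (f := rank (support E)) ⟨?_, ?_, ?_, ?_, ?_, ?_, ?_⟩
  · exact fun i hi j hj => rank_lt_iff hi hj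
  · intro i hi
    rw [mDiag_n, hn]
    exact rank_mem hi
  · intro k hk
    rw [mDiag_n, hn] at hk
    exact exists_rank_eq hk
  · intro i hi
    rw [(mDiag_mem_G21 P).1 i (hU hi), (mDiag_mem_G21 (P.restr E)).1]
    rw [mDiag_n, hn]
    exact rank_mem hi
  · intro i hi p
    rw [(mDiag_mem_G21 P).2.1, (mDiag_mem_G21 (P.restr E)).2.1, mem_product, mem_product, mDiag_n,
      hn, mDiag_n]
    exact and_congr_left fun _ => iff_of_true (rank_mem hi) (hU hi)
  · intro i hi p
    rw [(mDiag_mem_G21 P).2.2, (mDiag_mem_G21 (P.restr E)).2.2, mem_product, mem_product, mDiag_n,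
      hn, mDiag_n]
    exact and_congr_left fun _ => iff_of_true (rank_mem hi) (hU hi)
  · intro i hi j hj p q
    rw [mem_mDiag_edges, mem_mDiag_edges, restr_lists P hE]
    have hlt : ∀ K ∈ E, ∀ k ∈ K, ∀ l ∈ K, rank (support E) k < rank (support E) l ↔ k < l :=
      fun K hK k hk l hl => rank_lt_iff (mem_support hK hk) (mem_support hK hl)
    have hmem : ∀ K ∈ E, ∀ k ∈ support E, rank (support E) k ∈ K.map (rank (support E)) →
        k ∈ K := by
      intro K hK k hk h
      obtain ⟨l, hl, hkl⟩ := List.mem_map.1 h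
      exact rank_injOn _ (mem_support hK hl) hk hkl ▸ hl
    constructor
    · rintro ⟨L, hL, he⟩
      obtain ⟨K, hK, rfl⟩ := mem_image.1 hL
      obtain ⟨h1, -, h2, -, -⟩ := listEdges_valid he
      exact ⟨K, hE hK, (mem_listEdges_map (hlt K hK) (hmem K hK i hi h1) (hmem K hK j hj h2)).1 he⟩
    · rintro ⟨K, hK, he⟩
      obtain ⟨h1, -, h2, -, -⟩ := listEdges_valid he
      have hKE := mem_of_mem_support hE hK h1 hi
      exact ⟨_, mem_image_of_mem _ hKE, (mem_listEdges_map (hlt K hKE) h1 h2).2 he⟩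

theorem support_mem_iso (P : ListPartition) {E : Finset (List ℕ)} (hE : E ⊆ P.lists) :
    support E ∈ (mDiag P).iso := by
  refine mem_iso.2 ⟨support_subset hE, fun i p j q he => ?_⟩
  rw [mem_support_iff, mem_support_iff]
  exact exists_congr fun L => and_congr_right fun hL => mem_list_iff he (hE hL)

/-- The isolated sets are the unions of lists: a list is connected, so an isolated set contains all
of it or nothing. Hence the two coproducts have the same terms. -/
theorem sum_mDiag_iso {X : Type} [AddCommMonoid X] (P : ListPartition)
    (F : BDiagram → BDiagram → X) :
    ∑ I ∈ (mDiag P).iso, F ((mDiag P).res I) ((mDiag P).res (Icc 1 (mDiag P).n \ I)) =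
      ∑ E ∈ P.lists.powerset, F (mDiag (P.restr E)) (mDiag (P.restr (P.lists \ E))) := by
  symm
  refine sum_bij (fun E _ => support E) ?_ ?_ ?_ ?_
  · exact fun E hE => support_mem_iso P (mem_powerset.1 hE)
  · intro E hE F hF h
    rw [mem_powerset] at hE hF
    have key : ∀ E F : Finset (List ℕ), E ⊆ P.lists → F ⊆ P.lists → support E = support F →
        E ⊆ F := by
      intro E F hE hF h L hL
      obtain ⟨x, hx⟩ := List.exists_mem_of_ne_nil _ (P.ne_nil L (hE hL))
      exact mem_of_mem_support hF (hE hL) hx (h ▸ mem_support hL hx)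
    exact subset_antisymm (key E F hE hF h) (key F E hF hE h.symm)
  · intro I hI
    rw [mem_iso] at hI
    have hconn : ∀ L ∈ P.lists, ∀ u ∈ L, ∀ v ∈ L, u ∈ I → v ∈ I := by
      intro L hL u hu v hv h
      refine (mem_iff_of_closed (S := {k | k ∈ I}) (fun i c j d he => ?_) hu hv).1 h
      exact hI.2 _ _ _ _ (mem_mDiag_edges.2 ⟨L, hL, he⟩)
    refine ⟨{L ∈ P.lists | ∀ x ∈ L, x ∈ I}, mem_powerset.2 (filter_subset _ _), ?_⟩
    ext x
    rw [mem_support_iff]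
    constructor
    · rintro ⟨L, hL, hx⟩
      exact (mem_filter.1 hL).2 x hx
    · intro hx
      obtain ⟨L, hL, hxL⟩ := (P.mem_iff x).2 (hI.1 hx)
      exact ⟨L, mem_filter.2 ⟨hL, fun y hy => hconn L hL x hxL y hy hx⟩, hxL⟩
  · intro E hE
    rw [mem_powerset] at hE
    rw [mDiag_res P hE, mDiag_n, ← support_sdiff P hE, mDiag_res P sdiff_subset]

/-! ### The product of the diagrams of set partitions into lists -/

/-- The diagram is a forest with one tree for each list, so more edges mean fewer lists. -/
theorem card_edges_add_card_lists (P : ListPartition) :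
    #(mDiag P).edges + #P.lists = P.n := by
  have hdis : Set.PairwiseDisjoint (P.lists : Set (List ℕ)) listEdges := by
    intro L hL K hK hne
    refine disjoint_left.2 fun e he he' => hne ?_
    exact P.disjoint L hL K hK _ (listEdges_valid he).1 (listEdges_valid he').1
  have hdis' : Set.PairwiseDisjoint (P.lists : Set (List ℕ)) List.toFinset := by
    intro L hL K hK hne
    refine disjoint_left.2 fun x hx hx' => hne ?_
    exact P.disjoint L hL K hK x (List.mem_toFinset.1 hx) (List.mem_toFinset.1 hx')
  change #(P.lists.biUnion listEdges) + _ = _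
  have h1 : #(support P.lists) = P.n := by
    rw [support_lists, Nat.card_Icc, Nat.add_sub_cancel]
  rw [card_biUnion hdis, card_eq_sum_ones, ← sum_add_distrib, ← h1, support, card_biUnion hdis']
  refine sum_congr rfl fun L hL => ?_
  rw [card_listEdges (P.nodup L hL) (P.ne_nil L hL), List.toFinset_card_of_nodup (P.nodup L hL)]

theorem mem_shiftedUnion_lists {P Q : ListPartition} {L : List ℕ} :
    L ∈ (P.shiftedUnion Q).lists ↔ L ∈ P.lists ∨ ∃ K ∈ Q.lists, K.map (· + P.n) = L := by
  rw [shiftedUnion, mem_union, mem_image]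

theorem le_of_mem {P : ListPartition} {L : List ℕ} (hL : L ∈ P.lists) {x : ℕ} (hx : x ∈ L) :
    1 ≤ x ∧ x ≤ P.n := mem_Icc.1 ((P.mem_iff x).1 ⟨L, hL, hx⟩)

theorem mem_shiftedUnion_edges {P Q : ListPartition} {i c j d : ℕ} :
    ((i, c), (j, d)) ∈ (mDiag (P.shiftedUnion Q)).edges ↔ ((i, c), (j, d)) ∈ (mDiag P).edges ∨
      P.n < i ∧ P.n < j ∧ ((i - P.n, c), (j - P.n, d)) ∈ (mDiag Q).edges := by
  simp only [mem_mDiag_edges, mem_shiftedUnion_lists, or_and_right, exists_or]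
  refine or_congr_right ⟨?_, ?_⟩
  · rintro ⟨L, ⟨K, hK, rfl⟩, he⟩
    obtain ⟨h1, -, h2, -, -⟩ := listEdges_valid he
    obtain ⟨k, hk, rfl⟩ := List.mem_map.1 h1
    obtain ⟨l, hl, rfl⟩ := List.mem_map.1 h2
    have := le_of_mem hK hk
    have := le_of_mem hK hl
    refine ⟨by omega, by omega, K, hK, ?_⟩
    rw [Nat.add_sub_cancel, Nat.add_sub_cancel]
    exact (mem_listEdges_map (f := (· + P.n)) (fun _ _ _ _ => by omega) hk hl).1 he
  · rintro ⟨hi, hj, K, hK, he⟩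
    obtain ⟨h1, -, h2, -, -⟩ := listEdges_valid he
    have := (mem_listEdges_map (f := (· + P.n)) (fun _ _ _ _ => by omega) h1 h2).2 he
    simp only [Nat.sub_add_cancel hi.le, Nat.sub_add_cancel hj.le] at this
    exact ⟨_, ⟨K, hK, rfl⟩, this⟩

/-- The shifted union is the composition along the empty matching: it has no crossing edges. -/
theorem mDiag_shiftedUnion_mem (P Q : ListPartition) :
    mDiag (P.shiftedUnion Q) ∈ prodSet (mDiag P) (mDiag Q) := by
  have g := mDiag_mem_G21 (P.shiftedUnion Q)
  have gP := mDiag_mem_G21 P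
  have gQ := mDiag_mem_G21 Q
  have hn : (mDiag (P.shiftedUnion Q)).n = P.n + Q.n := rfl
  rw [mem_prodSet]
  refine ⟨rfl, Emb.res_eq (f := id) ⟨fun _ _ _ _ => Iff.rfl, fun _ h => h, fun k hk => ⟨k, hk, rfl⟩,
    ?_, ?_, ?_, ?_⟩, Emb.res_eq (f := (· - P.n)) ⟨?_, ?_, ?_, ?_, ?_, ?_, ?_⟩⟩
  · intro i hi
    rw [id, gP.1 i hi, g.1 i (Icc_subset_Icc le_rfl (by rw [hn]; exact Nat.le_add_right _ _) hi)]
  · intro i hi p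
    rw [gP.2.1, g.2.1, mem_product, mem_product]
    exact and_congr_left fun _ => iff_of_true hi
      (Icc_subset_Icc le_rfl (by rw [hn]; exact Nat.le_add_right _ _) hi)
  · intro i hi p
    rw [gP.2.2, g.2.2, mem_product, mem_product]
    exact and_congr_left fun _ => iff_of_true hi
      (Icc_subset_Icc le_rfl (by rw [hn]; exact Nat.le_add_right _ _) hi)
  · intro i hi j hj p q
    rw [mem_shiftedUnion_edges]
    have := mem_Icc.1 hi
    rw [mDiag_n] at this
    refine ⟨Or.inl, fun h => h.resolve_right fun h => ?_⟩
    omega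
  all_goals simp only [mDiag_n]
  · intro i hi j hj
    rw [mem_Icc] at hi hj
    omega
  · intro i hi
    rw [mem_Icc] at *
    omega
  · intro k hk
    rw [mem_Icc] at hk
    exact ⟨k + P.n, mem_Icc.2 (by omega), by omega⟩
  · intro i hi
    rw [mem_Icc] at hi
    rw [gQ.1 _ (mem_Icc.2 (by simp only [mDiag_n]; omega)),
      g.1 _ (mem_Icc.2 (by simp only [hn]; omega))]
  · intro i hi p
    rw [mem_Icc] at hi
    rw [gQ.2.1, g.2.1, mem_product, mem_product]
    exact and_congr_left fun _ => iff_of_true (mem_Icc.2 (by simp only [mDiag_n]; omega))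
      (mem_Icc.2 (by simp only [hn]; omega))
  · intro i hi p
    rw [mem_Icc] at hi
    rw [gQ.2.2, g.2.2, mem_product, mem_product]
    exact and_congr_left fun _ => iff_of_true (mem_Icc.2 (by simp only [mDiag_n]; omega))
      (mem_Icc.2 (by simp only [hn]; omega))
  · intro i hi j hj p q
    rw [mem_Icc] at hi hj
    rw [mem_shiftedUnion_edges, or_iff_right fun h => ?_]
    · exact ⟨fun h => ⟨by omega, by omega, h⟩, fun h => h.2.2⟩
    · have := mem_Icc.1 (BDiagram.edge_fst _ h)
      simp only [mDiag_n] at this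
      omega

theorem shiftedUnion_edges_subset {P Q : ListPartition} {K : BDiagram}
    (hK : K ∈ prodSet (mDiag P) (mDiag Q)) : (mDiag (P.shiftedUnion Q)).edges ⊆ K.edges := by
  rintro ⟨⟨i, c⟩, ⟨j, d⟩⟩ he
  rcases mem_shiftedUnion_edges.1 he with h | ⟨h1, h2, h⟩
  · exact ((emb_left hK).edges i (BDiagram.edge_fst _ h) j (BDiagram.edge_snd _ h) c d).1 h
  · have h3 := mem_Icc.1 (BDiagram.edge_fst _ h)
    have h4 := mem_Icc.1 (BDiagram.edge_snd _ h)
    simp only [mDiag_n] at h3 h4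
    exact ((emb_right hK).edges i (mem_Icc.2 (by simp only [mDiag_n]; omega)) j
      (mem_Icc.2 (by simp only [mDiag_n]; omega)) c d).1 h

theorem prodSet_subset_G21 {G G' K : BDiagram} (hG : G ∈ G21) (hG' : G' ∈ G21)
    (hK : K ∈ prodSet G G') : K ∈ G21 := by
  have c1 := emb_left hK
  have c2 := emb_right hK
  have hn := prodSet_n hK
  have split : ∀ i ∈ Icc 1 K.n, i ∈ Icc 1 G.n ∨ i ∈ Icc (G.n + 1) (G.n + G'.n) := by
    intro i hi
    rw [mem_Icc] at *
    rw [mem_Icc]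
    omega
  refine ⟨fun i hi => ?_, ?_, ?_⟩
  · rcases split i hi with hi | hi
    · exact (c1.lam i hi).symm.trans (hG.1 i hi)
    · exact (c2.lam i hi).symm.trans (hG'.1 _ (c2.mem i hi))
  · ext ⟨i, p⟩
    rw [mem_product]
    by_cases hi : i ∈ Icc 1 K.n
    · rw [and_iff_right hi]
      rcases split i hi with hi | hi
      · rw [← c1.up i hi, hG.2.1, mem_product]
        exact and_iff_right hi
      · rw [← c2.up i hi, hG'.2.1, mem_product]
        exact and_iff_right (c2.mem i hi)
    · exact iff_of_false (fun h => hi (K.up_vertex h)) fun h => hi h.1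
  · ext ⟨i, p⟩
    rw [mem_product]
    by_cases hi : i ∈ Icc 1 K.n
    · rw [and_iff_right hi]
      rcases split i hi with hi | hi
      · rw [← c1.down i hi, hG.2.2, mem_product]
        exact and_iff_right hi
      · rw [← c2.down i hi, hG'.2.2, mem_product]
        exact and_iff_right (c2.mem i hi)
    · exact iff_of_false (fun h => hi (K.down_vertex h)) fun h => hi h.1

theorem card_shiftedUnion_lists (P Q : ListPartition) :
    #(P.shiftedUnion Q).lists = #P.lists + #Q.lists := by
  rw [shiftedUnion, card_union_of_disjoint,
    card_image_of_injective _ (List.map_injective_iff.2 (add_left_injective P.n))]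
  rw [disjoint_left]
  intro L hL hL'
  obtain ⟨K, hK, rfl⟩ := mem_image.1 hL'
  obtain ⟨x, hx⟩ := List.exists_mem_of_ne_nil _ (Q.ne_nil K hK)
  have := le_of_mem hL (List.mem_map_of_mem hx)
  have := le_of_mem hK hx
  omega

/-- The product of `m_Π` and `m_Π'` is `m_(Π ⊎ Π')` up to diagrams with fewer components. -/
theorem mul_mDiag_sub_mem (P Q : ListPartition) :
    hopfB.mul (Finsupp.single (mDiag P) 1) (Finsupp.single (mDiag Q) 1) -
      Finsupp.single (mDiag (P.shiftedUnion Q)) 1 ∈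
      Submodule.span ℂ {x : BSpace | ∃ R : ListPartition, R.n = P.n + Q.n ∧
        #R.lists < #P.lists + #Q.lists ∧ x = Finsupp.single (mDiag R) 1} := by
  have hmem := mDiag_shiftedUnion_mem P Q
  rw [hopfB_mul_single, ← add_sum_erase _ _ hmem, add_sub_cancel_left]
  refine Submodule.sum_mem _ fun K hK => ?_
  obtain ⟨hne, hK⟩ := mem_erase.1 hK
  obtain ⟨R, rfl⟩ := exists_mDiag_eq (prodSet_subset_G21 (mDiag_mem_G21 P) (mDiag_mem_G21 Q) hK)
  refine Submodule.subset_span ⟨R, prodSet_n hK, ?_, rfl⟩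
  -- Every other term keeps the edges inside the blocks and adds at least one crossing edge, so the
  -- forest count yields fewer lists.
  have hss : (mDiag (P.shiftedUnion Q)).edges ⊂ (mDiag R).edges := by
    refine (shiftedUnion_edges_subset hK).ssubset_of_ne fun h => hne ?_
    exact ext_G21 (mDiag_mem_G21 R) (mDiag_mem_G21 _)
      ((prodSet_n hK).trans (prodSet_n hmem).symm) h.symm
  have h1 := card_lt_card hss
  have h2 := card_edges_add_card_lists R
  have h3 := card_edges_add_card_lists (P.shiftedUnion Q)
  rw [card_shiftedUnion_lists] at h3
  have h4 : R.n = (P.shiftedUnion Q).n := prodSet_n hK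
  omega

namespace ListPartition

/-! ### The monoid of set partitions into lists -/

instance : Monoid ListPartition where
  mul := shiftedUnion
  one := empty
  mul_assoc P Q R := by
    refine eq_of_lists ?_
    change P.lists ∪ Q.lists.image _ ∪ R.lists.image (List.map (· + (P.n + Q.n))) =
      P.lists ∪ (Q.lists ∪ R.lists.image _).image _
    rw [image_union, image_image, union_assoc]
    congr 3
    funext L
    simp [Function.comp_def, add_assoc, add_comm P.n]
  one_mul P := by
    refine eq_of_lists ?_
    change ∅ ∪ P.lists.image (List.map (· + 0)) = P.lists
    simp
  mul_one P := by
    refine eq_of_lists ?_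
    change P.lists ∪ image _ ∅ = P.lists
    simp

theorem mul_def (P Q : ListPartition) : P * Q = P.shiftedUnion Q := rfl

theorem mul_n (P Q : ListPartition) : (P * Q).n = P.n + Q.n := rfl

theorem one_n : (1 : ListPartition).n = 0 := rfl

theorem n_eq_zero {P : ListPartition} : P.n = 0 ↔ P = 1 := ⟨eq_empty, fun h => h ▸ rfl⟩

theorem card_mul_lists (P Q : ListPartition) : #(P * Q).lists = #P.lists + #Q.lists :=
  card_shiftedUnion_lists P Q

theorem mem_mul_lists {P Q : ListPartition} {L : List ℕ} :
    L ∈ (P * Q).lists ↔ L ∈ P.lists ∨ ∃ K ∈ Q.lists, K.map (· + P.n) = L :=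
  mem_shiftedUnion_lists

theorem map_add_injective (n : ℕ) : Function.Injective (List.map (· + n)) :=
  List.map_injective_iff.2 (add_left_injective n)

theorem map_notMem_lists {P Q : ListPartition} {K : List ℕ} (hK : K ∈ Q.lists) :
    K.map (· + P.n) ∉ P.lists := by
  intro h
  obtain ⟨x, hx⟩ := List.exists_mem_of_ne_nil _ (Q.ne_nil K hK)
  have h1 := le_of_mem hK hx
  have h2 := le_of_mem h (List.mem_map_of_mem hx)
  omega

theorem map_mem_mul_lists {P Q : ListPartition} {K : List ℕ} :
    K.map (· + P.n) ∈ (P * Q).lists ↔ K.map (· + P.n) ∈ P.lists ∨ K ∈ Q.lists := by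
  rw [mem_mul_lists]
  refine or_congr_right ⟨?_, fun h => ⟨K, h, rfl⟩⟩
  rintro ⟨K', h, he⟩
  exact map_add_injective _ he ▸ h

theorem left_cancel {P Q R : ListPartition} (h : P * Q = P * R) : Q = R := by
  have key : ∀ {Q R : ListPartition}, P * Q = P * R → Q.lists ⊆ R.lists := by
    intro Q R h K hK
    have h1 : K.map (· + P.n) ∈ (P * R).lists := h ▸ map_mem_mul_lists.2 (Or.inr hK)
    exact (map_mem_mul_lists.1 h1).resolve_left (map_notMem_lists hK)
  exact eq_of_lists (subset_antisymm (key h) (key h.symm))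

/-- Levi's property, the key to freeness: of two left factors of one partition, the shorter divides
the longer on the left. -/
theorem exists_of_mul_eq_mul {Q R Q' R' : ListPartition} (h : Q * R = Q' * R') (hn : Q.n ≤ Q'.n) :
    ∃ T, Q' = Q * T ∧ R = T * R' := by
  have hle : ∀ L ∈ (Q * R).lists, ∀ x ∈ L, x ≤ Q'.n → L ∈ Q'.lists := by
    intro L hL x hx hxn
    rw [h, mem_mul_lists] at hL
    refine hL.resolve_right ?_
    rintro ⟨K, hK, rfl⟩
    obtain ⟨y, hy, rfl⟩ := List.mem_map.1 hx
    have := le_of_mem hK hy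
    omega
  have hsub : ∀ L ∈ Q'.lists, L ∈ (Q * R).lists := fun L hL => h ▸ mem_mul_lists.2 (Or.inl hL)
  -- The middle part consists of the lists of `R` whose shift by `Q.n` belongs to `Q'`.
  let T : ListPartition :=
    { n := Q'.n - Q.n
      lists := {K ∈ R.lists | K.map (· + Q.n) ∈ Q'.lists}
      ne_nil := fun L hL => R.ne_nil L (mem_filter.1 hL).1
      nodup := fun L hL => R.nodup L (mem_filter.1 hL).1
      disjoint := fun L hL K hK => R.disjoint L (mem_filter.1 hL).1 K (mem_filter.1 hK).1
      mem_iff := by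
        intro x
        constructor
        · rintro ⟨K, hK, hx⟩
          rw [mem_filter] at hK
          have h1 := le_of_mem hK.1 hx
          have h2 := le_of_mem hK.2 (List.mem_map_of_mem hx)
          rw [mem_Icc]
          omega
        · intro hx
          rw [mem_Icc] at hx
          obtain ⟨L, hL, hxL⟩ := (Q'.mem_iff (x + Q.n)).2 (mem_Icc.2 (by omega))
          rcases mem_mul_lists.1 (hsub L hL) with h1 | ⟨K, hK, rfl⟩
          · have := le_of_mem h1 hxL
            omega
          · obtain ⟨y, hy, hyx⟩ := List.mem_map.1 hxL
            obtain rfl : y = x := by omega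
            exact ⟨K, mem_filter.2 ⟨hK, hL⟩, hy⟩ }
  have hT : Q' = Q * T := by
    refine eq_of_lists (Finset.ext fun L => ?_)
    rw [mem_mul_lists]
    constructor
    · intro hL
      refine (mem_mul_lists.1 (hsub L hL)).imp_right ?_
      rintro ⟨K, hK, rfl⟩
      exact ⟨K, mem_filter.2 ⟨hK, hL⟩, rfl⟩
    · rintro (hL | ⟨K, hK, rfl⟩)
      · obtain ⟨x, hx⟩ := List.exists_mem_of_ne_nil _ (Q.ne_nil L hL)
        exact hle L (mem_mul_lists.2 (Or.inl hL)) x hx ((le_of_mem hL hx).2.trans hn)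
      · exact (mem_filter.1 hK).2
  refine ⟨T, hT, left_cancel (P := Q) ?_⟩
  rw [h, hT, mul_assoc]

/-! ### Unique factorization -/

/-- The non-empty indivisible set partitions into lists. -/
def Atom : Type := {P : ListPartition // P.Indivisible ∧ P ≠ 1}

/-- The product of a word of non-empty indivisible partitions. -/
def ofWord : FreeMonoid Atom →* ListPartition := FreeMonoid.lift Subtype.val

theorem ofWord_surjective : Function.Surjective ofWord := by
  intro P
  induction hn : P.n using Nat.strong_induction_on generalizing P with
  | _ n ih =>
    subst hn
    by_cases h1 : P = 1
    · exact ⟨1, h1 ▸ map_one _⟩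
    by_cases h2 : P.Indivisible
    · exact ⟨FreeMonoid.of ⟨P, h2, h1⟩, FreeMonoid.lift_eval_of _ _⟩
    simp only [Indivisible, not_forall, not_or] at h2
    obtain ⟨Q, R, rfl, hQ, hR⟩ := h2
    rw [← mul_def] at *
    have hQ1 : Q.n ≠ 0 := fun h => hR (by rw [n_eq_zero.1 h, one_mul])
    have hR1 : R.n ≠ 0 := fun h => hQ (by rw [n_eq_zero.1 h, mul_one])
    obtain ⟨u, rfl⟩ := ih Q.n (by rw [mul_n]; omega) Q rfl
    obtain ⟨v, rfl⟩ := ih R.n (by rw [mul_n]; omega) R rfl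
    exact ⟨u * v, map_mul _ _ _⟩

/-- The shorter of the two first factors divides the longer one, and indivisibility leaves no room
for a proper factor. Thus a word can be recovered letter by letter. -/
theorem Atom.eq_of_mul_eq_mul (a b : Atom) {R R' : ListPartition} (h : a.1 * R = b.1 * R') :
    a = b ∧ R = R' := by
  have key : ∀ (a b : Atom) {R R' : ListPartition}, a.1 * R = b.1 * R' → a.1.n ≤ b.1.n →
      a = b := by
    intro a b R R' h hn
    obtain ⟨T, hT, -⟩ := exists_of_mul_eq_mul h hn
    rcases b.2.1 _ _ hT with h1 | h1
    · exact Subtype.ext h1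
    · refine absurd (n_eq_zero.1 ?_) a.2.2
      have := congrArg ListPartition.n hT
      rw [mul_n, h1] at this
      omega
  have hab : a = b := (le_total a.1.n b.1.n).elim (key a b h) fun hn => (key b a h.symm hn).symm
  exact ⟨hab, left_cancel (hab ▸ h)⟩

theorem ofWord_injective : Function.Injective ofWord := by
  intro u
  induction u using FreeMonoid.inductionOn' with
  | one =>
    intro v
    induction v using FreeMonoid.inductionOn' with
    | one => exact fun _ => rfl
    | of_mul a v _ =>
      intro h
      refine absurd (n_eq_zero.1 ?_) a.2.2
      have := congrArg ListPartition.n h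
      rw [map_one, map_mul, mul_n, one_n] at this
      have h2 : ofWord (FreeMonoid.of a) = a.1 := FreeMonoid.lift_eval_of _ _
      rw [h2] at this
      omega
  | of_mul a u ih =>
    intro v
    induction v using FreeMonoid.inductionOn' with
    | one =>
      intro h
      refine absurd (n_eq_zero.1 ?_) a.2.2
      have := congrArg ListPartition.n h
      rw [map_one, map_mul, mul_n, one_n] at this
      have h2 : ofWord (FreeMonoid.of a) = a.1 := FreeMonoid.lift_eval_of _ _
      rw [h2] at this
      omega
    | of_mul b v _ =>
      intro h
      rw [map_mul, map_mul] at h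
      obtain ⟨rfl, h2⟩ := Atom.eq_of_mul_eq_mul a b h
      rw [ih h2]

/-- Every set partition into lists is in exactly one way a product of non-empty indivisible
ones. -/
def wordEquiv : FreeMonoid Atom ≃* ListPartition :=
  MulEquiv.ofBijective ofWord ⟨ofWord_injective, ofWord_surjective⟩

/-- The number of indivisible factors. -/
def len (P : ListPartition) : ℕ := (wordEquiv.symm P).length

theorem len_mul (P Q : ListPartition) : len (P * Q) = len P + len Q := by
  rw [len, map_mul, FreeMonoid.length_mul]
  rfl

theorem len_one : len 1 = 0 := by
  rw [len, map_one, FreeMonoid.length_one]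

theorem wordEquiv_symm_atom (a : Atom) : wordEquiv.symm a.1 = FreeMonoid.of a :=
  wordEquiv.symm_apply_eq.2 (FreeMonoid.lift_eval_of _ _).symm

theorem len_atom (a : Atom) : len a.1 = 1 := by
  rw [len, wordEquiv_symm_atom, FreeMonoid.length_of]

/-- Induction on the number of indivisible factors. -/
theorem induction_atom {p : ListPartition → Prop} (one : p 1)
    (mul : ∀ (a : Atom) (P : ListPartition), p P → p (a.1 * P)) (P : ListPartition) : p P := by
  obtain ⟨u, rfl⟩ := ofWord_surjective P
  induction u using FreeMonoid.inductionOn' with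
  | one => exact one
  | of_mul a u ih =>
    rw [map_mul]
    exact mul a _ ih

theorem len_le (P : ListPartition) : len P ≤ P.n := by
  induction P using induction_atom with
  | one => exact len_one.le
  | mul a P ih =>
    rw [len_mul, len_atom, mul_n]
    have : a.1.n ≠ 0 := fun h => a.2.2 (n_eq_zero.1 h)
    omega

/-- The multiplicative map with given values at the non-empty indivisible partitions. -/
def lift {M : Type} [Monoid M] (f : Atom → M) : ListPartition →* M :=
  (FreeMonoid.lift f).comp wordEquiv.symm.toMonoidHom

theorem lift_atom {M : Type} [Monoid M] (f : Atom → M) (a : Atom) : lift f a.1 = f a :=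
  (congrArg _ (wordEquiv_symm_atom a)).trans (FreeMonoid.lift_eval_of _ _)

end ListPartition

/-! ### The Hopf algebra `BWSym` -/

theorem hopfBWSym_one : hopfBWSym.one = Finsupp.single (1 : ListPartition) 1 := rfl

theorem hopfBWSym_mul_single (P Q : ListPartition) :
    hopfBWSym.mul (Finsupp.single P 1) (Finsupp.single Q 1) = Finsupp.single (P * Q) 1 := by
  simp only [hopfBWSym, Finsupp.linearCombination_single, one_smul, mul_def]

theorem hopfBWSym_comul_single (P : ListPartition) : hopfBWSym.comul (Finsupp.single P 1) =
    ∑ E ∈ P.lists.powerset, (Finsupp.single (P.restr E) 1 : BWSymSpace) ⊗ₜ[ℂ]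
      (Finsupp.single (P.restr (P.lists \ E)) 1 : BWSymSpace) := by
  rw [← sum_attach]
  simp only [hopfBWSym, Finsupp.linearCombination_single, one_smul]
  refine sum_congr rfl fun E _ => ?_
  rw [P.restr_eq_std (mem_powerset.1 E.2), P.restr_eq_std sdiff_subset]

theorem hopfBWSym_counit_single (P : ListPartition) :
    hopfBWSym.counit (Finsupp.single P 1) = if P.n = 0 then 1 else 0 := by
  change (Finsupp.single P 1 : BWSymSpace) 1 = _
  classical
  rw [Finsupp.single_apply]
  exact if_congr n_eq_zero.symm rfl rfl

/-- The linear map that sends `Φ^Π` to `m_Π`. -/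
def toBSpace : BWSymSpace →ₗ[ℂ] BSpace := Finsupp.lmapDomain ℂ ℂ mDiag

theorem toBSpace_single (P : ListPartition) :
    toBSpace (Finsupp.single P 1) = Finsupp.single (mDiag P) 1 := Finsupp.mapDomain_single

theorem toBSpace_injective : Function.Injective toBSpace :=
  Finsupp.mapDomain_injective mDiag_injective

theorem map_toBSpace_comul (x : BWSymSpace) :
    TensorProduct.map toBSpace toBSpace (hopfBWSym.comul x) = hopfB.comul (toBSpace x) := by
  suffices h : TensorProduct.map toBSpace toBSpace ∘ₗ hopfBWSym.comul =
      hopfB.comul ∘ₗ toBSpace from LinearMap.congr_fun h x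
  refine linearMap_ext_single fun P => ?_
  rw [LinearMap.comp_apply, LinearMap.comp_apply, toBSpace_single, hopfB_comul_single,
    hopfBWSym_comul_single, map_sum, sum_mDiag_iso P fun K L =>
      (Finsupp.single K 1 : BSpace) ⊗ₜ[ℂ] (Finsupp.single L 1 : BSpace)]
  simp only [TensorProduct.map_tmul, toBSpace_single]

theorem counit_toBSpace (x : BWSymSpace) : hopfBWSym.counit x = hopfB.counit (toBSpace x) := by
  suffices h : hopfBWSym.counit = hopfB.counit ∘ₗ toBSpace from LinearMap.congr_fun h x
  refine linearMap_ext_single fun P => ?_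
  rw [LinearMap.comp_apply, toBSpace_single, hopfB_counit_single, hopfBWSym_counit_single,
    mDiag_n]

namespace ListPartition

/-- The ranks in a union of two blocks split as they do for diagrams, so `low` and `high` of the
support are the supports of the two parts. -/
theorem restr_mul (P Q : ListPartition) {A B : Finset (List ℕ)} (hA : A ⊆ P.lists)
    (hB : B ⊆ Q.lists) :
    (P * Q).restr (A ∪ B.image (List.map (· + P.n))) = P.restr A * Q.restr B := by
  have hU : A ∪ B.image (List.map (· + P.n)) ⊆ (P * Q).lists :=
    union_subset_union hA (image_subset_image hB)
  have hlow : BDiagram.low P.n (support (A ∪ B.image (List.map (· + P.n)))) = support A := by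
    ext x
    simp only [BDiagram.mem_low, mem_support_iff, mem_union, mem_image]
    constructor
    · rintro ⟨⟨L, hL | ⟨K, hK, rfl⟩, hx⟩, hn⟩
      · exact ⟨L, hL, hx⟩
      · obtain ⟨y, hy, rfl⟩ := List.mem_map.1 hx
        have := le_of_mem (hB hK) hy
        omega
    · rintro ⟨L, hL, hx⟩
      exact ⟨⟨L, Or.inl hL, hx⟩, (le_of_mem (hA hL) hx).2⟩
  have hhigh : BDiagram.high P.n Q.n (support (A ∪ B.image (List.map (· + P.n)))) = support B := by
    ext x
    simp only [BDiagram.mem_high, mem_support_iff, mem_union, mem_image]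
    constructor
    · rintro ⟨h1, L, hL | ⟨K, hK, rfl⟩, hx⟩
      · have := le_of_mem (hA hL) hx
        rw [mem_Icc] at h1
        omega
      · obtain ⟨y, hy, hyx⟩ := List.mem_map.1 hx
        obtain rfl : y = x := by omega
        exact ⟨K, hK, hy⟩
    · rintro ⟨L, hL, hx⟩
      exact ⟨mem_Icc.2 (le_of_mem (hB hL) hx), _, Or.inr ⟨L, hL, rfl⟩, List.mem_map_of_mem hx⟩
  refine eq_of_lists ?_
  rw [restr_lists _ hU, image_union, image_image]
  change _ = (P.restr A).lists ∪ (Q.restr B).lists.image (List.map (· + (P.restr A).n))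
  rw [restr_lists _ hA, restr_lists _ hB, restr_n _ hA, image_image]
  congr 1
  · refine image_congr fun L hL => List.map_congr_left fun x hx => ?_
    rw [BDiagram.rank_of_le (le_of_mem (hA hL) hx).2, hlow]
  · refine image_congr fun L hL => ?_
    simp only [Function.comp_apply, List.map_map]
    refine List.map_congr_left fun x hx => ?_
    rw [Function.comp_apply, Function.comp_apply, BDiagram.rank_add (support_subset hU)
      (le_of_mem (hB hL) hx).1, hlow, hhigh, add_comm]

theorem mul_lists_sdiff (P Q : ListPartition) {A B : Finset (List ℕ)} (hA : A ⊆ P.lists)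
    (hB : B ⊆ Q.lists) : (P * Q).lists \ (A ∪ B.image (List.map (· + P.n))) =
      (P.lists \ A) ∪ (Q.lists \ B).image (List.map (· + P.n)) := by
  have hinj := map_add_injective P.n
  ext L
  rw [mem_sdiff, mem_mul_lists, mem_union, mem_union, mem_sdiff, mem_image, mem_image]
  constructor
  · rintro ⟨h | ⟨K, hK, rfl⟩, h2⟩
    · exact Or.inl ⟨h, fun h3 => h2 (Or.inl h3)⟩
    · exact Or.inr ⟨K, mem_sdiff.2 ⟨hK, fun h3 => h2 (Or.inr ⟨K, h3, rfl⟩)⟩, rfl⟩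
  · rintro (⟨h1, h2⟩ | ⟨K, hK, rfl⟩)
    · refine ⟨Or.inl h1, ?_⟩
      rintro (h3 | ⟨K, hK, rfl⟩)
      · exact h2 h3
      · exact map_notMem_lists (hB hK) h1
    · rw [mem_sdiff] at hK
      refine ⟨Or.inr ⟨K, hK.1, rfl⟩, ?_⟩
      rintro (h3 | ⟨K', hK', he⟩)
      · exact map_notMem_lists hK.1 (hA h3)
      · exact hK.2 (hinj he ▸ hK')

theorem sum_mul_lists {X : Type} [AddCommMonoid X] (P Q : ListPartition)
    (F : ListPartition → ListPartition → X) :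
    ∑ E ∈ (P * Q).lists.powerset, F ((P * Q).restr E) ((P * Q).restr ((P * Q).lists \ E)) =
      ∑ A ∈ P.lists.powerset, ∑ B ∈ Q.lists.powerset, F (P.restr A * Q.restr B)
        (P.restr (P.lists \ A) * Q.restr (Q.lists \ B)) := by
  rw [← sum_product']
  symm
  have hinj := map_add_injective P.n
  refine sum_nbij (fun x => x.1 ∪ x.2.image (List.map (· + P.n))) ?_ ?_ ?_ ?_
  · rintro ⟨A, B⟩ h
    rw [mem_product, mem_powerset, mem_powerset] at h
    exact mem_powerset.2 (union_subset_union h.1 (image_subset_image h.2))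
  · rintro ⟨A, B⟩ h ⟨A', B'⟩ h' he
    simp only [mem_coe, mem_product, mem_powerset] at h h'
    have key : ∀ {A B A' B' : Finset (List ℕ)}, A ⊆ P.lists → B ⊆ Q.lists → A' ⊆ P.lists →
        B' ⊆ Q.lists → A ∪ B.image (List.map (· + P.n)) = A' ∪ B'.image (List.map (· + P.n)) →
        A ⊆ A' ∧ B ⊆ B' := by
      intro A B A' B' hA hB hA' hB' he
      refine ⟨fun L hL => ?_, fun L hL => ?_⟩
      · rcases mem_union.1 (he ▸ mem_union_left _ hL) with h1 | h1
        · exact h1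
        · obtain ⟨K, hK, rfl⟩ := mem_image.1 h1
          exact absurd (hA hL) (map_notMem_lists (hB' hK))
      · rcases mem_union.1 (he ▸ mem_union_right _ (mem_image_of_mem _ hL)) with h1 | h1
        · exact absurd (hA' h1) (map_notMem_lists (hB hL))
        · obtain ⟨K, hK, hKL⟩ := mem_image.1 h1
          exact hinj hKL ▸ hK
    obtain ⟨h1, h2⟩ := key h.1 h.2 h'.1 h'.2 he
    obtain ⟨h3, h4⟩ := key h'.1 h'.2 h.1 h.2 he.symm
    exact Prod.ext (subset_antisymm h1 h3) (subset_antisymm h2 h4)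
  · intro E hE
    have hE : E ⊆ (P * Q).lists := mem_powerset.1 hE
    refine ⟨(E ∩ P.lists, {K ∈ Q.lists | K.map (· + P.n) ∈ E}), ?_, ?_⟩
    · exact mem_coe.2 (mem_product.2 ⟨mem_powerset.2 inter_subset_right,
        mem_powerset.2 (filter_subset _ _)⟩)
    · ext L
      simp only [mem_union, mem_inter, mem_image, mem_filter]
      constructor
      · rintro (h | ⟨K, hK, rfl⟩)
        · exact h.1
        · exact hK.2
      · intro h
        rcases mem_mul_lists.1 (hE h) with h1 | ⟨K, hK, rfl⟩
        · exact Or.inl ⟨h, h1⟩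
        · exact Or.inr ⟨K, ⟨hK, h⟩, rfl⟩
  · rintro ⟨A, B⟩ h
    rw [mem_product, mem_powerset, mem_powerset] at h
    dsimp only
    rw [mul_lists_sdiff P Q h.1 h.2, restr_mul P Q h.1 h.2, restr_mul P Q sdiff_subset sdiff_subset]

theorem restr_n_add_compl (P : ListPartition) {E : Finset (List ℕ)} (hE : E ⊆ P.lists) :
    (P.restr E).n + (P.restr (P.lists \ E)).n = P.n := by
  have h1 := support_subset hE
  have h2 := card_le_card h1
  rw [Nat.card_Icc] at h2
  rw [restr_n P hE, restr_n P sdiff_subset, support_sdiff P hE, card_sdiff_of_subset h1,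
    Nat.card_Icc]
  omega

end ListPartition

theorem hopfBWSym_comul_mul (x y : BWSymSpace) : hopfBWSym.comul (hopfBWSym.mul x y) =
    TensorProduct.map₂ hopfBWSym.mul hopfBWSym.mul (hopfBWSym.comul x) (hopfBWSym.comul y) := by
  suffices h : hopfBWSym.mul.compr₂ hopfBWSym.comul =
      (TensorProduct.map₂ hopfBWSym.mul hopfBWSym.mul).compl₁₂ hopfBWSym.comul hopfBWSym.comul from
    LinearMap.congr_fun₂ h x y
  refine linearMap_ext_single fun P => linearMap_ext_single fun Q => ?_
  rw [LinearMap.compr₂_apply, LinearMap.compl₁₂_apply, hopfBWSym_mul_single,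
    hopfBWSym_comul_single, hopfBWSym_comul_single, hopfBWSym_comul_single,
    sum_mul_lists P Q fun K L =>
      (Finsupp.single K 1 : BWSymSpace) ⊗ₜ[ℂ] (Finsupp.single L 1 : BWSymSpace), map_sum, map_sum]
  simp only [LinearMap.sum_apply]
  rw [sum_comm]
  refine sum_congr rfl fun B _ => sum_congr rfl fun A _ => ?_
  rw [TensorProduct.map₂_apply_tmul, TensorProduct.map_tmul, hopfBWSym_mul_single,
    hopfBWSym_mul_single]

theorem hopfBWSym_isBialgebra : hopfBWSym.IsBialgebra where
  mul_assoc := mul_assoc_of_single fun P Q R => by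
    simp only [hopfBWSym_mul_single, mul_assoc]
  one_mul x := by
    suffices hopfBWSym.mul hopfBWSym.one = LinearMap.id from LinearMap.congr_fun this x
    refine linearMap_ext_single fun P => ?_
    rw [hopfBWSym_one, hopfBWSym_mul_single, one_mul, LinearMap.id_apply]
  mul_one x := by
    suffices hopfBWSym.mul.flip hopfBWSym.one = LinearMap.id from LinearMap.congr_fun this x
    refine linearMap_ext_single fun P => ?_
    rw [LinearMap.flip_apply, hopfBWSym_one, hopfBWSym_mul_single, mul_one, LinearMap.id_apply]
  -- The coalgebra axioms come from the B-diagrams, because `toBSpace` is injective and respects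
  -- coproduct and counit.
  coassoc := HopfOps.coassoc_of_injective toBSpace_injective map_toBSpace_comul hopfB_coassoc
  rTensor_counit := HopfOps.rTensor_counit_of_injective toBSpace_injective map_toBSpace_comul
    counit_toBSpace hopfB_isBialgebra.rTensor_counit
  lTensor_counit := HopfOps.lTensor_counit_of_injective toBSpace_injective map_toBSpace_comul
    counit_toBSpace hopfB_isBialgebra.lTensor_counit
  counit_one := (hopfBWSym_counit_single 1).trans (if_pos rfl)
  counit_mul x y := by
    suffices h : hopfBWSym.mul.compr₂ hopfBWSym.counit =
        (LinearMap.mul ℂ ℂ).compl₁₂ hopfBWSym.counit hopfBWSym.counit from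
      LinearMap.congr_fun₂ h x y
    refine linearMap_ext_single fun P => linearMap_ext_single fun Q => ?_
    simp only [LinearMap.compr₂_apply, LinearMap.compl₁₂_apply, LinearMap.mul_apply',
      hopfBWSym_mul_single, hopfBWSym_counit_single, mul_n, Nat.add_eq_zero_iff]
    split_ifs <;> simp_all
  comul_one := by
    rw [hopfBWSym_one, hopfBWSym_comul_single]
    change ∑ E ∈ (∅ : Finset (List ℕ)).powerset, _ = _
    rw [powerset_empty, sum_singleton, restr_empty, sdiff_empty, restr_self]
    rfl
  comul_mul := hopfBWSym_comul_mul

theorem hopfBWSym_isHopf : hopfBWSym.IsHopf := by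
  refine hopfBWSym_isBialgebra.isHopf ?_
  refine (hopfBWSym_isBialgebra.exists_antipode Finsupp.basisSingleOne ListPartition.n
    ?_ ?_).imp fun _ h => h.1
  · intro P hP
    rw [Finsupp.coe_basisSingleOne, n_eq_zero.1 hP]
    rfl
  · intro P
    rw [Finsupp.coe_basisSingleOne]
    simp only [hopfBWSym_comul_single]
    exact Submodule.sum_mem _ fun E hE => Submodule.subset_span
      ⟨_, _, P.restr_n_add_compl (mem_powerset.1 hE), rfl⟩

/-! ### The sub-Hopf algebra `B21` -/

theorem range_toBSpace : LinearMap.range toBSpace = B21 := by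
  rw [LinearMap.range_eq_map, ← Finsupp.basisSingleOne.span_eq (R := ℂ) (M := BWSymSpace),
    Submodule.map_span, B21, ← bijOn_mDiag.image_eq, Set.image_univ, ← Set.range_comp,
    ← Set.range_comp]
  congr 2
  funext P
  simp only [Function.comp_apply, Finsupp.coe_basisSingleOne, toBSpace_single]

theorem toBSpace_mem (x : BWSymSpace) : toBSpace x ∈ B21 := range_toBSpace ▸ ⟨x, rfl⟩

/-- The subspace is the image of `BWSym` under a map that respects coproducts, so coproducts lie in
the tensor square of the image. -/
theorem B21_comul_mem : ∀ x ∈ B21,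
    hopfB.comul x ∈ LinearMap.range (TensorProduct.map B21.subtype B21.subtype) := by
  intro x hx
  rw [← range_toBSpace] at hx
  obtain ⟨y, rfl⟩ := hx
  have : toBSpace = B21.subtype ∘ₗ toBSpace.codRestrict B21 toBSpace_mem := rfl
  rw [← map_toBSpace_comul]
  conv => arg 2; rw [this]
  rw [TensorProduct.map_comp]
  exact ⟨_, rfl⟩

theorem B21_mul_mem : ∀ x ∈ B21, ∀ y ∈ B21, hopfB.mul x y ∈ B21 := by
  have : Submodule.map₂ hopfB.mul B21 B21 ≤ B21 := by
    rw [B21, Submodule.map₂_span_span, Submodule.span_le]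
    rintro _ ⟨_, ⟨G, hG, rfl⟩, _, ⟨G', hG', rfl⟩, rfl⟩
    change hopfB.mul (Finsupp.single G 1) (Finsupp.single G' 1) ∈ _
    rw [hopfB_mul_single]
    exact Submodule.sum_mem _ fun K hK =>
      Submodule.subset_span ⟨K, prodSet_subset_G21 hG hG' hK, rfl⟩
  exact fun x hx y hy => this (Submodule.apply_mem_map₂ _ hx hy)

theorem B21_one_mem : hopfB.one ∈ B21 := by
  have := mDiag_mem 1
  rwa [BDiagram.eq_empty (mDiag_n 1)] at this

theorem B21_isSubHopf : hopfB.IsSubHopf B21 where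
  one_mem := B21_one_mem
  mul_mem := B21_mul_mem
  comul_mem := B21_comul_mem
  antipode_mem := hopfB_exists_antipode.imp fun _ h =>
    ⟨h.1, h.2 B21 B21_one_mem B21_mul_mem B21_comul_mem⟩

theorem hopfB21_isHopf : (hopfB.restrict B21 B21_isSubHopf).IsHopf :=
  HopfOps.IsSubHopf.isHopf_restrict B21_isSubHopf hopfB_isHopf

/-! ### Algebras with a basis indexed by set partitions into lists -/

theorem Module.Basis.bijective_of_unitriangular {ι V : Type} [AddCommGroup V] [Module ℂ V]
    (b : Module.Basis ι ℂ V) (T : V →ₗ[ℂ] V) (w : ι → ℕ)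
    (h : ∀ i, T (b i) - b i ∈ Submodule.span ℂ (b '' {j | w j < w i})) :
    Function.Bijective T := by
  have h1 := _root_.bijective_of_unitriangular
    (b.repr.toLinearMap ∘ₗ T ∘ₗ b.repr.symm.toLinearMap) w fun i => by
      have h2 := Submodule.mem_map_of_mem (f := b.repr.toLinearMap) (h i)
      rw [Submodule.map_span, ← Set.image_comp] at h2
      have h3 : (b.repr.toLinearMap ∘ₗ T ∘ₗ b.repr.symm.toLinearMap) (Finsupp.single i 1) -
          Finsupp.single i 1 = b.repr.toLinearMap (T (b i) - b i) := by
        simp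
      rw [h3]
      refine Submodule.span_mono ?_ h2
      rintro _ ⟨j, hj, rfl⟩
      exact ⟨j, hj, by simp⟩
  have h4 : (T : V → V) = b.repr.symm ∘
      (b.repr.toLinearMap ∘ₗ T ∘ₗ b.repr.symm.toLinearMap) ∘ b.repr := by
    funext x
    simp
  rw [h4]
  exact b.repr.symm.bijective.comp (h1.comp b.repr.bijective)

section Span

variable {V : Type} [AddCommGroup V] [Module ℂ V] (b : Module.Basis ListPartition ℂ V)

/-- The span of the basis elements with index in `p`. -/
def spanOf (p : Set ListPartition) : Submodule ℂ V := Submodule.span ℂ (b '' p)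

variable {b}

theorem basis_mem_spanOf {p : Set ListPartition} {P : ListPartition} (h : P ∈ p) :
    b P ∈ spanOf b p := Submodule.subset_span ⟨P, h, rfl⟩

theorem spanOf_mono {p q : Set ListPartition} (h : p ⊆ q) : spanOf b p ≤ spanOf b q :=
  Submodule.span_mono (Set.image_mono h)

variable {X : Type} [AddCommGroup X] [Module ℂ X]

theorem map_mem_of_mem_spanOf {p : Set ListPartition} (f : V →ₗ[ℂ] X) {S : Submodule ℂ X}
    (h : ∀ P ∈ p, f (b P) ∈ S) {x : V} (hx : x ∈ spanOf b p) : f x ∈ S := by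
  have : spanOf b p ≤ S.comap f := by
    rw [spanOf, Submodule.span_le]
    rintro _ ⟨P, hP, rfl⟩
    exact h P hP
  exact this hx

theorem map₂_mem_of_mem_spanOf {V' : Type} [AddCommGroup V'] [Module ℂ V']
    {b' : Module.Basis ListPartition ℂ V'} {p q : Set ListPartition} (f : V →ₗ[ℂ] V' →ₗ[ℂ] X)
    {S : Submodule ℂ X} (h : ∀ P ∈ p, ∀ Q ∈ q, f (b P) (b' Q) ∈ S) {x : V} {y : V'}
    (hx : x ∈ spanOf b p) (hy : y ∈ spanOf b' q) : f x y ∈ S :=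
  map_mem_of_mem_spanOf (f.flip y)
    (fun P hP => map_mem_of_mem_spanOf (f (b P)) (h P hP) hy) hx

variable (b)

/-- The span of the basis elements of degree `n` with less than `k` lists. -/
def fil (n k : ℕ) : Submodule ℂ V := spanOf b {R | R.n = n ∧ #R.lists < k}

/-- The span of the basis elements of the same degree as `P` with at most as many lists as `P`
and with more than `l` indivisible factors. -/
def refined (P : ListPartition) (l : ℕ) : Submodule ℂ V :=
  spanOf b {R | R.n = P.n ∧ #R.lists ≤ #P.lists ∧ l < len R}

variable {b}

theorem basis_mem_fil {n k : ℕ} {R : ListPartition} (h1 : R.n = n) (h2 : #R.lists < k) :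
    b R ∈ fil b n k := basis_mem_spanOf ⟨h1, h2⟩

theorem refined_le_fil (P : ListPartition) (l : ℕ) :
    refined b P l ≤ fil b P.n (#P.lists + 1) :=
  spanOf_mono fun _ h => ⟨h.1, Nat.lt_succ_of_le h.2.1⟩

theorem fil_mono {n k l : ℕ} (h : k ≤ l) : fil b n k ≤ fil b n l :=
  spanOf_mono fun _ hR => ⟨hR.1, hR.2.trans_le h⟩

end Span

/-! ### Algebra maps that are unitriangular for the number of lists -/

section Filtered

variable {A : Type} [Ring A] [Algebra ℂ A]

/-- The unit is the basis element of the empty partition, and the product of basis elements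
is given by the shifted union, up to terms with fewer lists. -/
structure IsFiltered (c : Module.Basis ListPartition ℂ A) : Prop where
  one : c 1 = 1
  mul_sub_mem : ∀ P Q, c P * c Q - c (P * Q) ∈ fil c (P.n + Q.n) (#P.lists + #Q.lists)

/-- The unit is the basis element of the empty partition, and the product of basis elements
is given by the shifted union. -/
structure IsMultiplicative (b : Module.Basis ListPartition ℂ A) : Prop where
  one : b 1 = 1
  mul : ∀ P Q, b P * b Q = b (P * Q)

variable {c : Module.Basis ListPartition ℂ A}

/-- As `fil` bounds the number of lists strictly, `l + 1` stands for at most `l` lists: fewer than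
`k` plus at most `l` is fewer than `k + l`. -/
theorem IsFiltered.mul_mem (hc : IsFiltered c) {n m k l : ℕ} {x y : A} (hx : x ∈ fil c n k)
    (hy : y ∈ fil c m (l + 1)) : x * y ∈ fil c (n + m) (k + l) := by
  refine map₂_mem_of_mem_spanOf (LinearMap.mul ℂ A) ?_ hx hy
  rintro P ⟨rfl, hP⟩ Q ⟨rfl, hQ⟩
  rw [LinearMap.mul_apply', ← sub_add_cancel (c P * c Q) (c (P * Q))]
  exact add_mem (fil_mono (by omega) (hc.mul_sub_mem P Q))
    (basis_mem_fil (mul_n P Q) (by rw [card_mul_lists]; omega))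

theorem IsFiltered.mul_mem' (hc : IsFiltered c) {n m k l : ℕ} {x y : A}
    (hx : x ∈ fil c n (k + 1)) (hy : y ∈ fil c m l) : x * y ∈ fil c (n + m) (k + l) := by
  refine map₂_mem_of_mem_spanOf (LinearMap.mul ℂ A) ?_ hx hy
  rintro P ⟨rfl, hP⟩ Q ⟨rfl, hQ⟩
  rw [LinearMap.mul_apply', ← sub_add_cancel (c P * c Q) (c (P * Q))]
  exact add_mem (fil_mono (by omega) (hc.mul_sub_mem P Q))
    (basis_mem_fil (mul_n P Q) (by rw [card_mul_lists]; omega))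

variable {W : Type} [Ring W] [Algebra ℂ W] {b : Module.Basis ListPartition ℂ W}

/-- The linear bijection between the bases. -/
def basisMap (b : Module.Basis ListPartition ℂ W) (c : Module.Basis ListPartition ℂ A) :
    W ≃ₗ[ℂ] A := b.equiv c (Equiv.refl _)

theorem basisMap_apply (P : ListPartition) : basisMap b c (b P) = c P := by
  simp [basisMap]

theorem basisMap_symm_apply (P : ListPartition) : (basisMap b c).symm (c P) = b P := by
  simp [basisMap]

theorem basisMap_mem_fil {n k : ℕ} {x : W} (hx : x ∈ fil b n k) :
    basisMap b c x ∈ fil c n k := by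
  refine map_mem_of_mem_spanOf (basisMap b c).toLinearMap (fun P hP => ?_) hx
  rw [LinearEquiv.coe_coe, basisMap_apply]
  exact basis_mem_spanOf hP

theorem basisMap_mul_sub_mem (hb : IsMultiplicative b) (hc : IsFiltered c) {n m k l : ℕ} {x y : W}
    (hx : x ∈ fil b n (k + 1)) (hy : y ∈ fil b m (l + 1)) :
    basisMap b c x * basisMap b c y - basisMap b c (x * y) ∈ fil c (n + m) (k + l) := by
  refine map₂_mem_of_mem_spanOf ((LinearMap.mul ℂ A).compl₁₂ (basisMap b c).toLinearMap
    (basisMap b c).toLinearMap - (LinearMap.mul ℂ W).compr₂ (basisMap b c).toLinearMap) ?_ hx hy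
  rintro P ⟨rfl, hP⟩ Q ⟨rfl, hQ⟩
  simp only [LinearMap.sub_apply, LinearMap.compl₁₂_apply, LinearMap.compr₂_apply,
    LinearMap.mul_apply', LinearEquiv.coe_coe, hb.mul, basisMap_apply]
  exact fil_mono (by omega) (hc.mul_sub_mem P Q)

/-- The algebra map with given values at the basis elements of the non-empty indivisible
partitions. -/
def liftHom (hb : IsMultiplicative b) (f : Atom → A) : W →ₐ[ℂ] A :=
  AlgHom.ofLinearMap (b.constr ℂ (lift f)) (by rw [← hb.one, b.constr_basis, map_one]) (by
    have : (LinearMap.mul ℂ W).compr₂ (b.constr ℂ (lift f)) =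
        (LinearMap.mul ℂ A).compl₁₂ (b.constr ℂ (lift f)) (b.constr ℂ (lift f)) :=
      b.ext fun P => b.ext fun Q => by
        simp only [LinearMap.compl₁₂_apply, LinearMap.compr₂_apply, LinearMap.mul_apply', hb.mul,
          b.constr_basis, map_mul]
    exact fun x y => LinearMap.congr_fun₂ this x y)

theorem liftHom_apply (hb : IsMultiplicative b) (f : Atom → A) (P : ListPartition) :
    liftHom hb f (b P) = lift f P := b.constr_basis ℂ _ _

variable {q : Atom → W} {p : Atom → A}

theorem mul_mem_refined (hb : IsMultiplicative b) {P Q : ListPartition} {k l : ℕ} {x y : W}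
    (hx : x ∈ refined b P k) (hy : y ∈ refined b Q l) : x * y ∈ refined b (P * Q) (k + l) := by
  refine map₂_mem_of_mem_spanOf (LinearMap.mul ℂ W) ?_ hx hy
  rintro R ⟨h1, h2, h3⟩ S ⟨h4, h5, h6⟩
  rw [LinearMap.mul_apply', hb.mul]
  refine basis_mem_spanOf ⟨by rw [mul_n, mul_n, h1, h4], ?_, ?_⟩
  · rw [card_mul_lists, card_mul_lists]
    omega
  · rw [len_mul]
    omega

theorem basis_mul_mem_refined (hb : IsMultiplicative b) (P : ListPartition) {Q : ListPartition}
    {l : ℕ} {y : W} (hy : y ∈ refined b Q l) : b P * y ∈ refined b (P * Q) (len P + l) := by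
  refine map_mem_of_mem_spanOf (LinearMap.mulLeft ℂ (b P)) ?_ hy
  rintro S ⟨h4, h5, h6⟩
  rw [LinearMap.mulLeft_apply, hb.mul]
  refine basis_mem_spanOf ⟨by rw [mul_n, mul_n, h4], ?_, ?_⟩
  · rw [card_mul_lists, card_mul_lists]
    omega
  · rw [len_mul]
    omega

theorem mul_basis_mem_refined (hb : IsMultiplicative b) {P : ListPartition} (Q : ListPartition)
    {k : ℕ} {x : W} (hx : x ∈ refined b P k) : x * b Q ∈ refined b (P * Q) (k + len Q) := by
  refine map_mem_of_mem_spanOf (LinearMap.mulRight ℂ (b Q)) ?_ hx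
  rintro S ⟨h4, h5, h6⟩
  rw [LinearMap.mulRight_apply, hb.mul]
  refine basis_mem_spanOf ⟨by rw [mul_n, mul_n, h4], ?_, ?_⟩
  · rw [card_mul_lists, card_mul_lists]
    omega
  · rw [len_mul]
    omega

/-- The numbers of indivisible factors add up in products, so changing the generators by terms with
more factors changes each product by terms with more factors. -/
theorem lift_sub_mem_refined (hb : IsMultiplicative b)
    (hq : ∀ a : Atom, q a - b a.1 ∈ refined b a.1 (len a.1)) (P : ListPartition) :
    lift q P - b P ∈ refined b P (len P) := by
  induction P using induction_atom with
  | one =>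
    rw [map_one, hb.one, sub_self]
    exact zero_mem _
  | mul a P ih =>
    rw [map_mul, lift_atom, ← hb.mul, len_mul]
    have : q a * lift q P - b a.1 * b P = (q a - b a.1) * (lift q P - b P) +
        b a.1 * (lift q P - b P) + (q a - b a.1) * b P := by noncomm_ring
    rw [this]
    exact add_mem (add_mem (mul_mem_refined hb (hq a) ih) (basis_mul_mem_refined hb _ ih))
      (mul_basis_mem_refined hb _ (hq a))

/-- The weight `P.n - len P` decreases on the correction terms: their degree is that of `P`, and
they have more factors. It is a genuine difference, as `len P ≤ P.n`. -/
theorem liftHom_bijective (hb : IsMultiplicative b)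
    (hq : ∀ a : Atom, q a - b a.1 ∈ refined b a.1 (len a.1)) :
    Function.Bijective (liftHom hb q) := by
  refine b.bijective_of_unitriangular (liftHom hb q).toLinearMap (fun P => P.n - len P) fun P => ?_
  rw [AlgHom.toLinearMap_apply, liftHom_apply]
  refine Submodule.span_mono (Set.image_mono ?_) (lift_sub_mem_refined hb hq P)
  rintro R ⟨h1, -, h2⟩
  have := len_le R
  rw [Set.mem_ofPred_eq]
  omega

/-- Algebra maps that agree on a unitriangular modification of the generators are equal. -/
theorem algHom_ext_of_atom (hb : IsMultiplicative b)
    (hq : ∀ a : Atom, q a - b a.1 ∈ refined b a.1 (len a.1)) {X : Type} [Semiring X] [Algebra ℂ X]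
    {f g : W →ₐ[ℂ] X} (h : ∀ a, f (q a) = g (q a)) : f = g := by
  have h1 : f.comp (liftHom hb q) = g.comp (liftHom hb q) := by
    refine AlgHom.toLinearMap_injective (b.ext fun P => ?_)
    simp only [AlgHom.toLinearMap_apply, AlgHom.comp_apply, liftHom_apply]
    induction P using induction_atom with
    | one => rw [map_one, map_one, map_one]
    | mul a P ih => rw [map_mul, map_mul, map_mul, lift_atom, h, ih]
  ext x
  obtain ⟨y, rfl⟩ := (liftHom_bijective hb hq).2 x
  exact DFunLike.congr_fun h1 y

theorem lift_mem_fil (hb : IsMultiplicative b)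
    (hq : ∀ a : Atom, q a - b a.1 ∈ refined b a.1 (len a.1)) (P : ListPartition) :
    lift q P ∈ fil b P.n (#P.lists + 1) := by
  rw [← sub_add_cancel (lift q P) (b P)]
  exact add_mem (refined_le_fil _ _ (lift_sub_mem_refined hb hq P))
    (basis_mem_fil rfl (Nat.lt_succ_self _))

/-- Multiplying by one generator at a time, the error splits into the error of the generator, the
error of the rest, and the failure of `basisMap` to be multiplicative; each has fewer lists. -/
theorem lift_sub_basisMap_mem (hb : IsMultiplicative b) (hc : IsFiltered c)
    (hq : ∀ a : Atom, q a - b a.1 ∈ refined b a.1 (len a.1))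
    (hp : ∀ a : Atom, p a - basisMap b c (q a) ∈ fil c a.1.n #a.1.lists) (P : ListPartition) :
    lift p P - basisMap b c (lift q P) ∈ fil c P.n #P.lists := by
  induction P using induction_atom with
  | one =>
    rw [map_one, map_one, ← hb.one, basisMap_apply, hc.one, sub_self]
    exact zero_mem _
  | mul a P ih =>
    have h1 : q a ∈ fil b a.1.n (#a.1.lists + 1) := by
      have := lift_mem_fil hb hq a.1
      rwa [lift_atom] at this
    have h2 := lift_mem_fil hb hq P
    have h3 : lift p P ∈ fil c P.n (#P.lists + 1) := by
      rw [← sub_add_cancel (lift p P) (basisMap b c (lift q P))]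
      exact add_mem (fil_mono (Nat.le_succ _) ih) (basisMap_mem_fil h2)
    rw [map_mul, map_mul, lift_atom, lift_atom, mul_n, card_mul_lists]
    have : p a * lift p P - basisMap b c (q a * lift q P) =
        (p a - basisMap b c (q a)) * lift p P +
        basisMap b c (q a) * (lift p P - basisMap b c (lift q P)) +
        (basisMap b c (q a) * basisMap b c (lift q P) - basisMap b c (q a * lift q P)) := by
      noncomm_ring
    rw [this]
    exact add_mem (add_mem (hc.mul_mem (hp a) h3) (hc.mul_mem' (basisMap_mem_fil h1) ih))
      (basisMap_mul_sub_mem hb hc h1 h2)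

/-- An isomorphism of algebras with given values at a unitriangular modification of the
generators. -/
theorem exists_algEquiv (hb : IsMultiplicative b) (hc : IsFiltered c)
    (hq : ∀ a : Atom, q a - b a.1 ∈ refined b a.1 (len a.1))
    (hp : ∀ a : Atom, p a - basisMap b c (q a) ∈ fil c a.1.n #a.1.lists) :
    ∃ η : W ≃ₐ[ℂ] A, (∀ a, η (q a) = p a) ∧ ∀ P, η (b P) - c P ∈ fil c P.n #P.lists := by
  -- The automorphism `α` carries the standard generators to the values of `q`; undoing it first
  -- reduces the prescription at `q` to one at the standard generators.
  let α : W ≃ₐ[ℂ] W := AlgEquiv.ofBijective (liftHom hb q) (liftHom_bijective hb hq)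
  let η : W →ₐ[ℂ] A := (liftHom hb p).comp α.symm.toAlgHom
  have hη : ∀ P, η (lift q P) = lift p P := by
    intro P
    have h1 : α (b P) = lift q P := liftHom_apply hb q P
    rw [← h1]
    change liftHom hb p (α.symm (α (b P))) = _
    rw [α.symm_apply_apply, liftHom_apply]
  -- Induction on `P.n - len P`: `b P` is `lift q P`, where the claim is `lift_sub_basisMap_mem`, up
  -- to terms with more factors, where it is known.
  have key : ∀ P, η (b P) - c P ∈ fil c P.n #P.lists := by
    intro P
    induction hw : P.n - len P using Nat.strong_induction_on generalizing P with
    | _ w ih =>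
      subst hw
      have h1 := lift_sub_mem_refined hb hq P
      have h2 : η (lift q P - b P) - basisMap b c (lift q P - b P) ∈ fil c P.n #P.lists := by
        refine map_mem_of_mem_spanOf (η.toLinearMap - (basisMap b c).toLinearMap) ?_ h1
        rintro R ⟨h3, h4, h5⟩
        rw [LinearMap.sub_apply, LinearEquiv.coe_coe, AlgHom.toLinearMap_apply, basisMap_apply,
          ← h3]
        have := len_le R
        exact fil_mono h4 (ih (R.n - len R) (by omega) R rfl)
      rw [map_sub, map_sub, hη, basisMap_apply] at h2
      have h3 := sub_mem (lift_sub_basisMap_mem hb hc hq hp P) h2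
      convert h3 using 1
      abel
  -- Read in the basis `b`, the map `η` is unitriangular for the number of lists.
  have hbij : Function.Bijective ((basisMap b c).symm.toLinearMap ∘ₗ η.toLinearMap) := by
    refine b.bijective_of_unitriangular _ (fun P => #P.lists) fun P => ?_
    have h1 : ((basisMap b c).symm.toLinearMap ∘ₗ η.toLinearMap) (b P) - b P =
        (basisMap b c).symm (η (b P) - c P) := by
      rw [map_sub, basisMap_symm_apply]
      rfl
    rw [h1]
    refine map_mem_of_mem_spanOf (basisMap b c).symm.toLinearMap ?_ (key P)
    rintro R ⟨-, hR⟩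
    rw [LinearEquiv.coe_coe, basisMap_symm_apply]
    exact Submodule.subset_span ⟨R, hR, rfl⟩
  have hη' : Function.Bijective η := by
    have h1 : (η : W → A) = basisMap b c ∘
        ((basisMap b c).symm.toLinearMap ∘ₗ η.toLinearMap) := by
      funext x
      simp
    rw [h1]
    exact (basisMap b c).bijective.comp hbij
  refine ⟨AlgEquiv.ofBijective η hη', fun a => ?_, key⟩
  have := hη a.1
  rwa [lift_atom, lift_atom] at this

end Filtered

/-! ### Isomorphisms of Hopf algebras -/

namespace ListPartition

theorem len_pos {P : ListPartition} (h : P ≠ 1) : 0 < len P := by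
  refine Nat.pos_of_ne_zero fun h1 => h ?_
  rw [len, FreeMonoid.length_eq_zero] at h1
  exact (map_eq_one_iff _ wordEquiv.symm.injective).1 h1

theorem restr_ne_one {P : ListPartition} {E : Finset (List ℕ)} (hE : E ⊆ P.lists) (h : E ≠ ∅) :
    P.restr E ≠ 1 := by
  intro h1
  have h2 := restr_card P hE
  rw [h1] at h2
  exact h (card_eq_zero.1 h2.symm)

theorem restr_card_add_compl (P : ListPartition) {E : Finset (List ℕ)} (hE : E ⊆ P.lists) :
    #(P.restr E).lists + #(P.restr (P.lists \ E)).lists = #P.lists := by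
  rw [restr_card P hE, restr_card P sdiff_subset, add_comm, card_sdiff_add_card_eq_card hE]

theorem restr_compl_n_lt (P : ListPartition) {E : Finset (List ℕ)} (hE : E ⊆ P.lists)
    (h : E ≠ ∅) : (P.restr (P.lists \ E)).n < P.n := by
  have h1 := P.restr_n_add_compl hE
  have h2 : (P.restr E).n ≠ 0 := fun h0 => restr_ne_one hE h (n_eq_zero.1 h0)
  omega

end ListPartition

/-! ### Primitive generators from the Dynkin operator -/

section SplitComul

open Coalgebra WithConv

variable {H : Type} [Ring H] [HopfAlgebra ℂ H]

/-- The coproduct of a basis element is the sum over the ways to split the set of lists. -/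
def HasSplitComul (b : Module.Basis ListPartition ℂ H) : Prop :=
  ∀ P, comul (R := ℂ) (b P) =
    ∑ E ∈ P.lists.powerset, b (P.restr E) ⊗ₜ[ℂ] b (P.restr (P.lists \ E))

variable {b : Module.Basis ListPartition ℂ H}

/-- Exchanging a set of lists with its complement permutes the terms. -/
theorem HasSplitComul.isCocomm (h : HasSplitComul b) : IsCocomm ℂ H where
  comm_comp_comul := b.ext fun P => by
    rw [LinearMap.comp_apply, h P, map_sum]
    refine sum_nbij' (P.lists \ ·) (P.lists \ ·) ?_ ?_ ?_ ?_ ?_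
    · exact fun E _ => mem_powerset.2 sdiff_subset
    · exact fun E _ => mem_powerset.2 sdiff_subset
    · exact fun E hE => Finset.sdiff_sdiff_eq_self (mem_powerset.1 hE)
    · exact fun E hE => Finset.sdiff_sdiff_eq_self (mem_powerset.1 hE)
    · intro E hE
      rw [Finset.sdiff_sdiff_eq_self (mem_powerset.1 hE)]
      rfl

variable (b) in
/-- The linear map that multiplies every basis element with its degree. -/
def degreeMap : H →ₗ[ℂ] H := b.constr ℂ fun P => (P.n : ℂ) • b P

theorem degreeMap_apply (P : ListPartition) : degreeMap b (b P) = (P.n : ℂ) • b P :=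
  b.constr_basis ℂ _ _

/-- The degrees of the two parts of a splitting add up to the degree of the partition; this makes
the degree map a coderivation, as `comul_dynkin` requires. -/
theorem HasSplitComul.comul_degreeMap (h : HasSplitComul b) :
    comul ∘ₗ degreeMap b = ((degreeMap b).rTensor H + (degreeMap b).lTensor H) ∘ₗ comul := by
  refine b.ext fun P => ?_
  rw [LinearMap.comp_apply, LinearMap.comp_apply, degreeMap_apply, map_smul, h P, map_sum, smul_sum]
  refine sum_congr rfl fun E hE => ?_
  rw [LinearMap.add_apply, LinearMap.rTensor_tmul, LinearMap.lTensor_tmul, degreeMap_apply,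
    degreeMap_apply, TensorProduct.tmul_smul, ← TensorProduct.smul_tmul', ← add_smul,
    ← Nat.cast_add, P.restr_n_add_compl (mem_powerset.1 hE)]

/-- The identity `id * D = Y` at `b P`, solved for the term `E = ∅`. It is a recursion, as the
complement of a non-empty `E` has smaller degree. -/
theorem HasSplitComul.dynkin_apply (h : HasSplitComul b) (h1 : b 1 = 1) (P : ListPartition) :
    dynkin (degreeMap b) (b P) = (P.n : ℂ) • b P - ∑ E ∈ P.lists.powerset.erase ∅,
      b (P.restr E) * dynkin (degreeMap b) (b (P.restr (P.lists \ E))) := by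
  have h2 := congrArg (fun f : WithConv (H →ₗ[ℂ] H) => f (b P)) (id_mul_dynkin (degreeMap b))
  have h3 : (toConv (degreeMap b) : WithConv (H →ₗ[ℂ] H)) (b P) = (P.n : ℂ) • b P :=
    degreeMap_apply P
  dsimp only at h2
  rw [h3, LinearMap.convMul_apply, h P, map_sum, map_sum,
    ← add_sum_erase _ _ (empty_mem_powerset P.lists)] at h2
  rw [← h2, eq_sub_iff_add_eq]
  congr 1
  rw [restr_empty, sdiff_empty, restr_self]
  change _ = b 1 * dynkin (degreeMap b) (b P)
  rw [h1, one_mul]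

theorem HasSplitComul.dynkin_one (h : HasSplitComul b) (h1 : b 1 = 1) :
    dynkin (degreeMap b) (b 1) = 0 := by
  rw [h.dynkin_apply h1, one_n]
  have : (1 : ListPartition).lists = ∅ := rfl
  simp [this]

theorem counit_eq_zero_of_comul {x : H} (h : comul (R := ℂ) x = x ⊗ₜ[ℂ] 1 + 1 ⊗ₜ[ℂ] x) :
    counit (R := ℂ) x = 0 := by
  have h1 := Coalgebra.rTensor_counit_comul (R := ℂ) x
  rw [h, map_add, LinearMap.rTensor_tmul, LinearMap.rTensor_tmul, Bialgebra.counit_one,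
    add_eq_right] at h1
  have h2 := congrArg (fun t => counit (R := ℂ) (TensorProduct.lid ℂ H t)) h1
  simpa using h2

/-- In the recursion every term of the sum is a product of two elements of positive degree, hence
has at least two indivisible factors. So the operator multiplies by the degree, modulo products. -/
theorem HasSplitComul.dynkin_sub_mem (h : HasSplitComul b) (hb : IsMultiplicative b)
    (P : ListPartition) :
    dynkin (degreeMap b) (b P) - (P.n : ℂ) • b P ∈ refined b P 1 := by
  induction hn : P.n using Nat.strong_induction_on generalizing P with
  | _ n ih =>
    subst hn
    rw [h.dynkin_apply hb.one, sub_sub_cancel_left]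
    refine neg_mem (Submodule.sum_mem _ fun E hE => ?_)
    obtain ⟨hne, hE⟩ := mem_erase.1 hE
    rw [mem_powerset] at hE
    have hlt := P.restr_compl_n_lt hE hne
    have hn := P.restr_n_add_compl hE
    have hl := P.restr_card_add_compl hE
    have hpos := len_pos (restr_ne_one hE hne)
    generalize P.restr (P.lists \ E) = Q at *
    -- For `E = P.lists` the second factor is the operator at the unit, which vanishes; otherwise
    -- this term would have only the factors of `P` itself.
    by_cases hQ : Q = 1
    · rw [hQ, h.dynkin_one hb.one, mul_zero]
      exact zero_mem _
    have h1 : dynkin (degreeMap b) (b Q) ∈ refined b Q 0 := by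
      have h2 : refined b Q 1 ≤ refined b Q 0 :=
        spanOf_mono fun R hR => ⟨hR.1, hR.2.1, Nat.zero_lt_of_lt hR.2.2⟩
      have h3 : b Q ∈ refined b Q 0 := basis_mem_spanOf ⟨rfl, le_rfl, len_pos hQ⟩
      rw [← sub_add_cancel (dynkin (degreeMap b) (b Q)) ((Q.n : ℂ) • b Q)]
      exact add_mem (h2 (ih Q.n hlt Q rfl)) (Submodule.smul_mem _ _ h3)
    refine spanOf_mono ?_ (basis_mul_mem_refined hb (P.restr E) h1)
    rintro R ⟨h2, h3, h4⟩
    rw [mul_n] at h2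
    rw [card_mul_lists] at h3
    exact ⟨by omega, by omega, by omega⟩

variable {A : Type} [Ring A] [HopfAlgebra ℂ A] {c : Module.Basis ListPartition ℂ A}

theorem HasSplitComul.dynkin_mem_fil (h : HasSplitComul b) (hb : IsMultiplicative b)
    (P : ListPartition) : dynkin (degreeMap b) (b P) ∈ fil b P.n (#P.lists + 1) := by
  rw [← sub_add_cancel (dynkin (degreeMap b) (b P)) ((P.n : ℂ) • b P)]
  exact add_mem (refined_le_fil P 1 (h.dynkin_sub_mem hb P))
    (Submodule.smul_mem _ _ (basis_mem_fil rfl (Nat.lt_succ_self _)))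

/-- Both operators obey the same recursion, with products that agree up to fewer lists, so by
induction on the degree their values agree up to fewer lists. -/
theorem dynkin_sub_basisMap_mem (h : HasSplitComul b) (hb : IsMultiplicative b)
    (h' : HasSplitComul c) (hc : IsFiltered c) (P : ListPartition) :
    dynkin (degreeMap c) (c P) - basisMap b c (dynkin (degreeMap b) (b P)) ∈
      fil c P.n #P.lists := by
  induction hn : P.n using Nat.strong_induction_on generalizing P with
  | _ n ih =>
    subst hn
    rw [h.dynkin_apply hb.one, h'.dynkin_apply hc.one, map_sub, map_smul, basisMap_apply,
      sub_sub_sub_cancel_left, map_sum, ← sum_sub_distrib]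
    refine Submodule.sum_mem _ fun E hE => ?_
    obtain ⟨hne, hE⟩ := mem_erase.1 hE
    rw [mem_powerset] at hE
    have hlt := P.restr_compl_n_lt hE hne
    rw [← P.restr_n_add_compl hE, ← P.restr_card_add_compl hE]
    generalize P.restr (P.lists \ E) = Q at *
    generalize P.restr E = R at *
    have hR : b R ∈ fil b R.n (#R.lists + 1) := basis_mem_fil rfl (Nat.lt_succ_self _)
    have hR' : c R ∈ fil c R.n (#R.lists + 1) := basis_mem_fil rfl (Nat.lt_succ_self _)
    have h1 := basisMap_mul_sub_mem hb hc hR (h.dynkin_mem_fil hb Q)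
    have h2 := hc.mul_mem' hR' (ih Q.n hlt Q rfl)
    have h3 := neg_mem (add_mem h2 h1)
    rw [basisMap_apply] at h3
    convert h3 using 1
    noncomm_ring

/-- An isomorphism of Hopf algebras that preserves the bases up to terms with fewer lists. -/
theorem exists_bialgEquiv (h : HasSplitComul b) (hb : IsMultiplicative b)
    (h' : HasSplitComul c) (hc : IsFiltered c) :
    ∃ η : H ≃ₐc[ℂ] A, ∀ P, η (b P) - c P ∈ fil c P.n #P.lists := by
  have _ := h.isCocomm
  have _ := h'.isCocomm
  -- Division by the degree, non-zero for a non-empty partition, gives the basis element the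
  -- coefficient one. The resulting elements are primitive and still generate freely.
  let q : Atom → H := fun a => (a.1.n : ℂ)⁻¹ • dynkin (degreeMap b) (b a.1)
  let p : Atom → A := fun a => (a.1.n : ℂ)⁻¹ • dynkin (degreeMap c) (c a.1)
  have hn : ∀ a : Atom, (a.1.n : ℂ) ≠ 0 := fun a h0 =>
    a.2.2 (n_eq_zero.1 (Nat.cast_eq_zero.1 h0))
  have hq : ∀ a : Atom, q a - b a.1 ∈ refined b a.1 (len a.1) := by
    intro a
    have h1 := Submodule.smul_mem _ (a.1.n : ℂ)⁻¹ (h.dynkin_sub_mem hb a.1)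
    rwa [smul_sub, inv_smul_smul₀ (hn a), ← len_atom a] at h1
  have hp : ∀ a : Atom, p a - basisMap b c (q a) ∈ fil c a.1.n #a.1.lists := by
    intro a
    have h1 := Submodule.smul_mem _ (a.1.n : ℂ)⁻¹ (dynkin_sub_basisMap_mem h hb h' hc a.1)
    rwa [smul_sub, ← map_smul (basisMap b c)] at h1
  have pq : ∀ a, comul (R := ℂ) (q a) = q a ⊗ₜ[ℂ] 1 + 1 ⊗ₜ[ℂ] q a := by
    intro a
    rw [map_smul, comul_dynkin _ h.comul_degreeMap, smul_add, TensorProduct.tmul_smul,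
      TensorProduct.smul_tmul']
  have pp : ∀ a, comul (R := ℂ) (p a) = p a ⊗ₜ[ℂ] 1 + 1 ⊗ₜ[ℂ] p a := by
    intro a
    rw [map_smul, comul_dynkin _ h'.comul_degreeMap, smul_add, TensorProduct.tmul_smul,
      TensorProduct.smul_tmul']
  obtain ⟨η, h1, h2⟩ := exists_algEquiv hb hc hq hp
  -- Compatibility with counit and coproduct is an equality of algebra maps, so it suffices at the
  -- generators `q a`; there it holds because `q a` and `p a` are primitive.
  refine ⟨BialgEquiv.ofAlgEquiv η (algHom_ext_of_atom hb hq fun a => ?_)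
    (algHom_ext_of_atom hb hq fun a => ?_), h2⟩
  · change counit (R := ℂ) (η (q a)) = counit (R := ℂ) (q a)
    rw [h1, counit_eq_zero_of_comul (pq a), counit_eq_zero_of_comul (pp a)]
  · change Algebra.TensorProduct.map (η : H →ₐ[ℂ] A) (η : H →ₐ[ℂ] A) (comul (R := ℂ) (q a)) =
      comul (R := ℂ) (η (q a))
    rw [h1, pq, pp, map_add, Algebra.TensorProduct.map_tmul, Algebra.TensorProduct.map_tmul]
    simp [h1]

end SplitComul

/-! ### `BWSym` and `B21` -/

theorem toBSpace_codRestrict_bijective :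
    Function.Bijective (toBSpace.codRestrict B21 toBSpace_mem) := by
  refine ⟨fun x y h => toBSpace_injective (congrArg Subtype.val h), fun ⟨y, hy⟩ => ?_⟩
  rw [← range_toBSpace] at hy
  obtain ⟨x, rfl⟩ := hy
  exact ⟨x, rfl⟩

/-- The basis of `BWSym`. -/
def basisBWSym : Module.Basis ListPartition ℂ hopfBWSym_isHopf.Carrier :=
  Finsupp.basisSingleOne.map hopfBWSym_isHopf.of

/-- The basis of `B21`. -/
def basisB21 : Module.Basis ListPartition ℂ hopfB21_isHopf.Carrier :=
  Finsupp.basisSingleOne.map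
    ((LinearEquiv.ofBijective _ toBSpace_codRestrict_bijective).trans hopfB21_isHopf.of)

theorem basisBWSym_apply (P : ListPartition) :
    basisBWSym P = hopfBWSym_isHopf.of (Finsupp.single P 1) := by
  rw [basisBWSym, Module.Basis.map_apply, Finsupp.coe_basisSingleOne]

theorem basisB21_apply (P : ListPartition) :
    basisB21 P = hopfB21_isHopf.of ⟨Finsupp.single (mDiag P) 1, mDiag_mem P⟩ := by
  rw [basisB21, Module.Basis.map_apply, Finsupp.coe_basisSingleOne, LinearEquiv.trans_apply]
  exact congrArg _ (Subtype.ext (toBSpace_single P))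

theorem basisBWSym_isMultiplicative : IsMultiplicative basisBWSym where
  one := basisBWSym_apply 1
  mul P Q := by
    rw [basisBWSym_apply, basisBWSym_apply, basisBWSym_apply]
    exact hopfBWSym_mul_single P Q

theorem basisBWSym_hasSplitComul : HasSplitComul basisBWSym := by
  intro P
  simp only [basisBWSym_apply]
  exact hopfBWSym_comul_single P

/-- The inclusion of `B21` into the space of all diagrams. -/
def inclB21 : hopfB21_isHopf.Carrier →ₗ[ℂ] BSpace := B21.subtype ∘ₗ hopfB21_isHopf.of.symm

theorem inclB21_injective : Function.Injective inclB21 := B21.injective_subtype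

theorem inclB21_basisB21 (P : ListPartition) :
    inclB21 (basisB21 P) = Finsupp.single (mDiag P) 1 := by
  rw [basisB21_apply]
  rfl

theorem map_inclB21_injective : Function.Injective (TensorProduct.map inclB21 inclB21) :=
  HopfOps.map_subtype_injective B21

theorem basisB21_isFiltered : IsFiltered basisB21 where
  one := inclB21_injective ((inclB21_basisB21 1).trans
    (congrArg (fun G => Finsupp.single G 1) (BDiagram.eq_empty (mDiag_n 1))))
  mul_sub_mem P Q := by
    have h1 : inclB21 (basisB21 P * basisB21 Q - basisB21 (P * Q)) ∈
        (fil basisB21 (P.n + Q.n) (#P.lists + #Q.lists)).map inclB21 := by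
      have h2 : inclB21 (basisB21 P * basisB21 Q) =
          hopfB.mul (inclB21 (basisB21 P)) (inclB21 (basisB21 Q)) := rfl
      rw [map_sub, h2, inclB21_basisB21, inclB21_basisB21, inclB21_basisB21, fil, spanOf,
        Submodule.map_span]
      refine Submodule.span_mono ?_ (mul_mDiag_sub_mem P Q)
      rintro _ ⟨R, h3, h4, rfl⟩
      exact ⟨_, ⟨R, ⟨h3, h4⟩, rfl⟩, inclB21_basisB21 R⟩
    obtain ⟨y, hy, he⟩ := h1
    exact inclB21_injective he ▸ hy

theorem basisB21_hasSplitComul : HasSplitComul basisB21 := by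
  intro P
  refine map_inclB21_injective ?_
  have h1 : TensorProduct.map inclB21 inclB21 (Coalgebra.comul (R := ℂ) (basisB21 P)) =
      hopfB.comul (inclB21 (basisB21 P)) :=
    HopfOps.map_subtype_restrict_comul B21_isSubHopf _
  rw [h1, inclB21_basisB21, ← toBSpace_single, ← map_toBSpace_comul, hopfBWSym_comul_single]
  simp only [map_sum, TensorProduct.map_tmul, inclB21_basisB21, toBSpace_single]

/-- The isomorphism of coalgebras that sends `Φ^Π` to `m_Π`. -/
def coalgEquivB21 : hopfBWSym_isHopf.Carrier ≃ₗc[ℂ] hopfB21_isHopf.Carrier where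
  __ := basisMap basisBWSym basisB21
  counit_comp := basisBWSym.ext fun P => by
    change Coalgebra.counit (R := ℂ) (basisMap basisBWSym basisB21 (basisBWSym P)) =
      Coalgebra.counit (R := ℂ) (basisBWSym P)
    have h1 : Coalgebra.counit (R := ℂ) (basisB21 P) = hopfB.counit (inclB21 (basisB21 P)) := rfl
    rw [basisMap_apply, h1, inclB21_basisB21, ← toBSpace_single, ← counit_toBSpace,
      basisBWSym_apply]
    rfl
  map_comp_comul := basisBWSym.ext fun P => by
    change TensorProduct.map (basisMap basisBWSym basisB21).toLinearMap
      (basisMap basisBWSym basisB21).toLinearMap (Coalgebra.comul (R := ℂ) (basisBWSym P)) =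
      Coalgebra.comul (R := ℂ) (basisMap basisBWSym basisB21 (basisBWSym P))
    rw [basisMap_apply, basisBWSym_hasSplitComul, basisB21_hasSplitComul, map_sum]
    simp only [TensorProduct.map_tmul, LinearEquiv.coe_coe, basisMap_apply]

theorem exists_algEquiv_indivisible :
    ∃ ψ : hopfBWSym_isHopf.Carrier ≃ₐ[ℂ] hopfB21_isHopf.Carrier,
      ∀ P : ListPartition, P.Indivisible → ψ (basisBWSym P) = basisB21 P := by
  -- With the basis elements themselves as generators and as values, both correction terms are zero.
  obtain ⟨ψ, h, -⟩ := exists_algEquiv (q := fun a => basisBWSym a.1) (p := fun a => basisB21 a.1)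
    basisBWSym_isMultiplicative basisB21_isFiltered
    (fun a => by rw [sub_self]; exact zero_mem _)
    (fun a => by rw [basisMap_apply, sub_self]; exact zero_mem _)
  refine ⟨ψ, fun P hP => ?_⟩
  -- The empty partition is indivisible but not an `Atom`; it is sent to the unit.
  by_cases h1 : P = 1
  · rw [h1, basisBWSym_isMultiplicative.one, basisB21_isFiltered.one, map_one]
  · exact h ⟨P, hP, h1⟩

end

/-- The last clause contains the case of exactly one list: a partition with no list has degree zero,
so no `Q` qualifies, the span is zero and `η` sends `Φ^Π` to `m_Π`. -/
theorem mainTheorem5 :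
    ∃ (_ : hopfB.IsHopf) (hS : hopfB.IsSubHopf B21)
      (hR : (hopfB.restrict B21 hS).IsHopf) (hW : hopfBWSym.IsHopf),
      (∀ n : ℕ, Set.BijOn (fun s : Equiv.Perm (Fin n) => mPerm s) Set.univ
        {G | G ∈ G21 ∧ G.Connected ∧ G.n = n}) ∧
      Set.BijOn mDiag Set.univ G21 ∧
      (∃ θ : hW.Carrier ≃ₗc[ℂ] hR.Carrier, ∀ P : ListPartition,
        θ (hW.of (Finsupp.single P 1)) = hR.of ⟨Finsupp.single (mDiag P) 1, mDiag_mem P⟩) ∧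
      (∃ ψ : hW.Carrier ≃ₐ[ℂ] hR.Carrier, ∀ P : ListPartition, P.Indivisible →
        ψ (hW.of (Finsupp.single P 1)) = hR.of ⟨Finsupp.single (mDiag P) 1, mDiag_mem P⟩) ∧
      (∃ η : hW.Carrier ≃ₐc[ℂ] hR.Carrier, ∀ P : ListPartition,
        η (hW.of (Finsupp.single P 1)) - hR.of ⟨Finsupp.single (mDiag P) 1, mDiag_mem P⟩ ∈
          Submodule.span ℂ {x | ∃ Q : ListPartition, Q.n = P.n ∧ #Q.lists < #P.lists ∧
            x = hR.of ⟨Finsupp.single (mDiag Q) 1, mDiag_mem Q⟩}) := by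
  refine ⟨hopfB_isHopf, B21_isSubHopf, hopfB21_isHopf, hopfBWSym_isHopf, bijOn_mPerm,
    bijOn_mDiag, ⟨coalgEquivB21, fun P => ?_⟩, ?_, ?_⟩
  · rw [← basisBWSym_apply, ← basisB21_apply]
    exact basisMap_apply P
  · obtain ⟨ψ, h⟩ := exists_algEquiv_indivisible
    refine ⟨ψ, fun P hP => ?_⟩
    rw [← basisBWSym_apply, ← basisB21_apply]
    exact h P hP
  · obtain ⟨η, h⟩ := exists_bialgEquiv basisBWSym_hasSplitComul basisBWSym_isMultiplicative
      basisB21_hasSplitComul basisB21_isFiltered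
    refine ⟨η, fun P => ?_⟩
    rw [← basisBWSym_apply, ← basisB21_apply]
    refine Submodule.span_mono ?_ (h P)
    rintro _ ⟨Q, ⟨h1, h2⟩, rfl⟩
    exact ⟨Q, h1, h2, basisB21_apply Q⟩
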